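/- **Theorem (Local Stability).** Let $d\ge 1$, $\beta\in\mathbb R$ (in particular any inverse temperature $\beta\ge 0$), and let $\rho$ be a symmetric, continuous (i.e. atomless) probability measure on $\mathbb R$ whose support is $\mathbb R$. Let $\nu$ be the law of i.i.d. couplings $J=(J_{xy})$ with law $\rho$, indexed by the nearest-neighbour edges $\{x,y\}$ of $\mathbb Z^d$. For a box $\Lambda\subset\mathbb Z^d$ let $G_{\Lambda,\beta,J}$ be the Gibbs measure on $\{-1,+1\}^\Lambda$ with weights proportional to $\exp\big(\beta\sum_{\{x,y\}}J_{xy}\sigma_x\sigma_y\big)$, the sum being over the edges of $\Lambda$ with periodic boundary conditions (each edge $\{x,x+e_k\}$, $x\in\Lambda$, $x+e_k\notin\Lambda$, is wrapped around and carries the coupling $J_{x,x+e_k}$). Let $(\kappa_J)$ be a metastate: a measurable family of probability measures on the space of probability measures $\Gamma$ on $\{-1,+1\}^{\mathbb Z^d}$ such that, for some sequence of boxes $\Lambda_n$ converging to $\mathbb Z^d$, for every finite $W\subset\mathbb Z^d$ and every $s\in\mathbb N$, the laws of $(J,\sigma^1_W,\dots,\sigma^s_W)$ under $\nu(dJ)\prod_{i}G_{\Lambda_n,\beta,J}(d\sigma^i)$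 converge weakly to the law of $(J,\sigma^1_W,\dots,\sigma^s_W)$ under $\nu(dJ)\int\kappa_J(d\Gamma)\prod_{i}\Gamma(d\sigma^i)$. For a finite $W\subset\mathbb Z^d$ let $W^*$ be the set of nearest-neighbour edges with both endpoints in $W$, and let $$R(\sigma,\sigma')=\lim_{N\to\infty}\frac1{|W_N^*|}\sum_{\{x,y\}\in W_N^*}\sigma_x\sigma_y\sigma'_x\sigma'_y,\qquad W_N=[-N,N]^d\cap\mathbb Z^d,$$ be the edge overlap. Then for $\nu$-almost every $J$ the following hold. 1. For $\kappa_J$-almost every $\Gamma$, the limit $R(\sigma,\sigma')$ exists for $\Gamma\times\Gamma$-almost every $(\sigma,\sigma')$. 2. For every finite $W\subset\mathbb Z^d$ and for $\nu$-almost all deterministic perturbations $J'=(J'_{xy}:\{x,y\}\in W^*)$ (that is, almost all with respect to $\rho^{\otimes W^*}$), put $H'_W(\sigma)=\sum_{\{x,y\}\in W^*}J'_{xy}\sigma_x\sigma_y$. Then for every $s\in\mathbb N$ and every continuous function $F$ of the $R$-overlaps of $s$ replicas, with $F(\vec\sigma)=F(R(\sigma^i,\sigma^j):1\le i<j\le s)$,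 $$\kappa_J\left[\frac{\Gamma^{\times s}\big(e^{\beta\sum_{i=1}^sH'_W(\sigma^i)}F(\vec\sigma)\big)}{\Gamma\big(e^{\beta H'_W(\sigma)}\big)^s}\right]=\kappa_J\left[\Gamma^{\times s}\big(F(\vec\sigma)\big)\right].$$ In other words, $Q_J\overset{\text{law}}{=}Q'_J$. Here $Q_J$ is the random $\mathbb N\times\mathbb N$ matrix with entries $R(\sigma^i,\sigma^j)$, where $\Gamma$ is sampled from $\kappa_J$ and then $\sigma^1,\sigma^2,\dots$ are sampled independently from $\Gamma$, and $Q'_J$ is defined in the same way with $\Gamma$ replaced by $$\frac{e^{\beta H'_W(\sigma)}\,\Gamma(d\sigma)}{\Gamma\big(e^{\beta H'_W(\sigma)}\big)}.$$ -/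

import Mathlib

open MeasureTheory ProbabilityTheory Filter Topology BoundedContinuousFunction

namespace EdwardsAnderson

/-! ### Lattice, spins, couplings -/

/-- Sites of the lattice `ℤ^d`. -/
abbrev Site (d : ℕ) : Type := Fin d → ℤ

/-- Nearest-neighbour edges of `ℤ^d`: the pair `(x, k)` stands for the edge `{x, x + e_k}`;
every nearest-neighbour edge is of this form for exactly one pair. -/
abbrev Edge (d : ℕ) : Type := Site d × Fin d

/-- The far endpoint `x + e_k` of the edge `(x, k)`. -/
def Edge.tip {d : ℕ} (e : Edge d) : Site d := e.1 + Pi.single e.2 1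

/-- Spin values: `ℤˣ = {-1, +1}`. -/
abbrev Spin : Type := ℤˣ

/-- Infinite-volume spin configurations, with the product `σ`-algebra. -/
abbrev Config (d : ℕ) : Type := Site d → Spin

/-- Infinite-volume states: probability measures on spin configurations. -/
abbrev State (d : ℕ) : Type := ProbabilityMeasure (Config d)

/-- Coupling configurations `J = (J_{xy})`, one real number for each edge of `ℤ^d`. -/
abbrev Couplings (d : ℕ) : Type := Edge d → ℝ

/-- The product `σ_x σ_y ∈ {-1, 1}` (as a real number) over an edge `{x, y}`. -/
def bond {d : ℕ} (σ : Config d) (e : Edge d) : ℝ := ((σ e.1 * σ e.tip : ℤˣ) : ℤ)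

/-- The set `W^*` of edges with both endpoints in the finite set `W`. -/
def edgesIn {d : ℕ} (W : Finset (Site d)) : Finset (Edge d) :=
  (W ×ˢ Finset.univ).filter fun e => e.tip ∈ W

/-- The i.i.d. law of the couplings with single-coupling law `ρ`. -/
noncomputable def couplingLaw (d : ℕ) (ρ : Measure ℝ) : Measure (Couplings d) :=
  Measure.infinitePi fun _ => ρ

/-! ### Finite-volume Gibbs measures on boxes with periodic boundary conditions -/

/-- The representative in the box `[a, b]` of the site `x`, modulo the side lengths of the box. -/
def wrap {d : ℕ} (a b : Site d) (x : Site d) : Site d :=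
  fun k => a k + (x k - a k) % (b k - a k + 1)

/-- The periodic extension to `ℤ^d` of a configuration on the box `[a, b]`. (If the box is nonempty
then `wrap a b x` lies in it and the default value `1` is never used.) -/
noncomputable def periodicExt {d : ℕ} (a b : Site d) (τ : Finset.Icc a b → Spin) : Config d :=
  fun x => if h : wrap a b x ∈ Finset.Icc a b then τ ⟨wrap a b x, h⟩ else 1

/-- The Edwards-Anderson Hamiltonian `-∑ J_{xy} σ_x σ_y` of the box `[a, b]` with periodic boundary
conditions. The edges of the discrete torus are the pairs `(x, k)` with `x` in the box; such an edge
joins `x` to `x + e_k` modulo the side lengths, and carries the coupling of `{x, x + e_k}`. -/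
noncomputable def hamiltonian {d : ℕ} (a b : Site d) (J : Couplings d)
    (τ : Finset.Icc a b → Spin) : ℝ :=
  -∑ e ∈ Finset.Icc a b ×ˢ (Finset.univ : Finset (Fin d)), J e * bond (periodicExt a b τ) e

/-- The probability of `τ` under the Gibbs measure of the box `[a, b]`. -/
noncomputable def gibbs {d : ℕ} (β : ℝ) (a b : Site d) (J : Couplings d)
    (τ : Finset.Icc a b → Spin) : ℝ :=
  Real.exp (-β * hamiltonian a b J τ) / ∑ τ', Real.exp (-β * hamiltonian a b J τ')

/-! ### Metastates -/

/-- `κ` is a metastate of the Edwards-Anderson model with periodic boundary conditions: there are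
boxes `[a n, b n]` converging to `ℤ^d` such that, for every finite window `W` and every number `s`
of replicas, the law of `(J, σ^1_W, …, σ^s_W)`, where `J` has law `ν` and the replicas are sampled
independently from the Gibbs measure of the `n`-th box given `J`, converges weakly to the
corresponding law under `ν(dJ) ∫ κ_J(dΓ) Γ^{⊗ ℕ}`. As the space of values of the replicas in the
window is finite, a bounded continuous test function is a finite family of bounded continuous
functions of `J`. -/
def IsMetastate {d : ℕ} (β : ℝ) (ρ : Measure ℝ) (κ : Kernel (Couplings d) (State d)) : Prop :=
  ∃ a b : ℕ → Site d, (∀ x : Site d, ∀ᶠ n in atTop, x ∈ Finset.Icc (a n) (b n)) ∧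
    ∀ (W : Finset (Site d)) (s : ℕ) (f : (Fin s → W → Spin) → (Couplings d →ᵇ ℝ)),
      Tendsto
        (fun n => ∫ J, ∑ τ : Fin s → Finset.Icc (a n) (b n) → Spin,
          (∏ i, gibbs β (a n) (b n) J (τ i)) *
            f (fun i x => periodicExt (a n) (b n) (τ i) x) J ∂(couplingLaw d ρ))
        atTop
        (𝓝 (∫ J, ∫ Γ : State d, ∫ σ : Fin s → Config d, f (fun i x => σ i x) J
          ∂(Measure.pi fun _ => (Γ : Measure (Config d))) ∂(κ J) ∂(couplingLaw d ρ)))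

/-! ### Overlaps and random overlap structures -/

/-- The edge overlap `R^W(σ, σ')` in the finite window `W`. -/
noncomputable def localOverlap {d : ℕ} (W : Finset (Site d)) (σ σ' : Config d) : ℝ :=
  (∑ e ∈ edgesIn W, bond σ e * bond σ' e) / (edgesIn W).card

/-- The cube `[-N, N]^d`. -/
noncomputable def cube (d N : ℕ) : Finset (Site d) := Finset.Icc (fun _ => -(N : ℤ)) (fun _ => (N : ℤ))

/-- The limit defining the edge overlap `R(σ, σ')` exists. -/
def OverlapExists {d : ℕ} (σ σ' : Config d) : Prop :=
  ∃ r : ℝ, Tendsto (fun N => localOverlap (cube d N) σ σ') atTop (𝓝 r)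

/-- The edge overlap `R(σ, σ') = lim_W R^W(σ, σ')`, the limit being along the cubes
`W = [-N, N]^d`. -/
noncomputable def overlap {d : ℕ} (σ σ' : Config d) : ℝ :=
  limUnder atTop fun N => localOverlap (cube d N) σ σ'

/-- The overlaps `R(σ^i, σ^j)`, `i < j`, of `s` replicas. -/
noncomputable def replicaOverlaps {d s : ℕ} (σ : Fin s → Config d) :
    {p : Fin s × Fin s // p.1 < p.2} → ℝ :=
  fun p => overlap (σ p.1.1) (σ p.1.2)

/-- The law `Γ^{⊗ ℕ}` of an infinite sequence of replicas sampled from `Γ`, as a kernel in `Γ`. -/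
noncomputable def replicaKernel (d : ℕ) : Kernel (State d) (ℕ → Config d) where
  toFun Γ := Measure.infinitePi fun _ => (Γ : Measure (Config d))
  measurable' := by
    refine Measurable.measure_of_isPiSystem_of_isProbabilityMeasure
      (generateFrom_squareCylinders (α := fun _ : ℕ => Config d)).symm
      (isPiSystem_squareCylinders (fun _ => MeasurableSpace.isPiSystem_measurableSet)
        (fun _ => by simp)) ?_
    rintro _ ⟨s, t, ht, rfl⟩
    simp only [Set.mem_pi, Set.mem_univ, forall_const, Set.mem_ofPred_eq] at ht
    simp_rw [Measure.infinitePi_pi (s := s) _ (fun i _ => ht i)]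
    exact Finset.measurable_prod _ fun i _ =>
      (Measure.measurable_coe (ht i)).comp measurable_subtype_coe

/-- The law of the random overlap structure built from a law `K` on states and the overlap `R`: the
law of the matrix `(R(σ^i, σ^j))_{i,j}`, where the replicas `σ^i` are sampled independently from a
state `Γ`, itself sampled from `K`. -/
noncomputable def overlapStructureLaw {d : ℕ} (K : Measure (State d)) : Measure (ℕ → ℕ → ℝ) :=
  (K.bind (replicaKernel d)).map fun σ i j => overlap (σ i) (σ j)

/-! ### Local perturbations -/

/-- `H'_W(σ) = ∑_{{x,y} ∈ W^*} J'_{xy} σ_x σ_y`. -/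
noncomputable def perturbation {d : ℕ} (W : Finset (Site d)) (J' : edgesIn W → ℝ)
    (σ : Config d) : ℝ :=
  ∑ e : edgesIn W, J' e * bond σ e

instance measurableSingletonClassSpin : MeasurableSingletonClass Spin where
  measurableSet_singleton u := by
    refine ⟨{(u : ℤ)}, measurableSet_singleton _, ?_⟩
    ext v
    simp [Units.ext_iff]

lemma measurable_bond {d : ℕ} (e : Edge d) : Measurable fun σ : Config d => bond σ e := by
  have h : Measurable fun p : Spin × Spin => (((p.1 * p.2 : ℤˣ) : ℤ) : ℝ) :=
    measurable_of_countable _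
  have h' : Measurable fun σ : Config d => (σ e.1, σ e.tip) :=
    (measurable_pi_apply e.1).prodMk (measurable_pi_apply e.tip)
  exact h.comp h'

lemma abs_bond {d : ℕ} (σ : Config d) (e : Edge d) : |bond σ e| = 1 := by
  unfold bond
  rcases Int.units_eq_one_or (σ e.1 * σ e.tip) with h | h <;> simp [h]

lemma measurable_perturbation {d : ℕ} (W : Finset (Site d)) (J' : edgesIn W → ℝ) :
    Measurable (perturbation W J') :=
  Finset.measurable_sum _ fun e _ => (measurable_bond e.1).const_mul _

lemma integrable_exp_perturbation {d : ℕ} (β : ℝ) (W : Finset (Site d)) (J' : edgesIn W → ℝ)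
    (Γ : State d) :
    Integrable (fun σ => Real.exp (β * perturbation W J' σ)) (Γ : Measure (Config d)) := by
  refine Integrable.of_bound
    (((measurable_perturbation W J').const_mul β).exp).aestronglyMeasurable
    (Real.exp (|β| * ∑ e, |J' e|)) (ae_of_all _ fun σ => ?_)
  rw [Real.norm_eq_abs, Real.abs_exp, Real.exp_le_exp]
  refine (le_abs_self _).trans ?_
  rw [abs_mul]
  refine mul_le_mul_of_nonneg_left ?_ (abs_nonneg _)
  refine (Finset.abs_sum_le_sum_abs _ _).trans (Finset.sum_le_sum fun e _ => ?_)
  rw [abs_mul, abs_bond, mul_one]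

/-- The tilted state `e^{β H'_W(σ)} Γ(dσ) / Γ(e^{β H'_W})`. -/
noncomputable def tilt {d : ℕ} (β : ℝ) (W : Finset (Site d)) (J' : edgesIn W → ℝ)
    (Γ : State d) : State d :=
  ⟨(Γ : Measure (Config d)).tilted fun σ => β * perturbation W J' σ,
    isProbabilityMeasure_tilted (integrable_exp_perturbation β W J' Γ)⟩

/-- Tilting is a measurable map on states, so that the image of a metastate under it makes sense. -/
lemma measurable_tilt {d : ℕ} (β : ℝ) (W : Finset (Site d)) (J' : edgesIn W → ℝ) :
    Measurable (tilt β W J') := by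
  have hm : Measurable fun σ => ENNReal.ofReal (Real.exp (β * perturbation W J' σ)) :=
    (((measurable_perturbation W J').const_mul β).exp).ennreal_ofReal
  refine Measurable.subtype_mk (Measure.measurable_of_measurable_coe _ fun s hs => ?_)
  have key : ∀ Γ : State d,
      ((Γ : Measure (Config d)).tilted fun σ => β * perturbation W J' σ) s =
      (∫⁻ σ, s.indicator (fun σ => ENNReal.ofReal (Real.exp (β * perturbation W J' σ))) σ
        ∂(Γ : Measure (Config d))) /
      ∫⁻ σ, ENNReal.ofReal (Real.exp (β * perturbation W J' σ)) ∂(Γ : Measure (Config d)) := by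
    intro Γ
    have hpos : 0 < ∫ σ, Real.exp (β * perturbation W J' σ) ∂(Γ : Measure (Config d)) :=
      integral_exp_pos (integrable_exp_perturbation β W J' Γ)
    rw [tilted_apply' _ _ hs, lintegral_indicator hs,
      ← ofReal_integral_eq_lintegral_ofReal (integrable_exp_perturbation β W J' Γ)
        (ae_of_all _ fun σ => (Real.exp_pos _).le), div_eq_mul_inv,
      ← lintegral_mul_const _ hm]
    refine lintegral_congr fun σ => ?_
    rw [ENNReal.ofReal_div_of_pos hpos, div_eq_mul_inv]
  simp_rw [key]
  exact ((Measure.measurable_lintegral (hm.indicator hs)).comp measurable_subtype_coe).div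
    ((Measure.measurable_lintegral hm).comp measurable_subtype_coe)

end EdwardsAnderson

/-! The law of the overlap structure is a translation-invariant function of J, hence almost surely
constant. A local perturbation of the states amounts to changing finitely many couplings, and a
constant does not notice such a change.

Translations. The periodic Gibbs measures are exactly covariant under rotations of the torus, and
the i.i.d. law of the couplings is rotation invariant. Seen from a fixed window, a rotation of a
large box is a translation, so in the limit the replicas drawn at translated couplings are
distributed as translated replicas (`IsMetastate.ae_bind_shift`). The edge overlap is unchanged by a
common translation (`overlap_shift`), and ergodicity of the couplings (`ergodic_shiftCouplings`)
makes the law of the overlaps constant.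

Couplings. Replacing the couplings in W by an independent copy J' tilts the finite-volume Gibbs
measure by J' - J. This passes to the limit (`IsMetastate.ae_bind_swap`), although the metastate
controls only moments of local probabilities: the Boltzmann weight is a function of the spins in W,
and the division by its mean is a limit of polynomials, by the geometric series
(`tendsto_integral_tilt`). Exchanging J' with the couplings in W preserves their joint law, so for
almost every pair the tilted states have the same constant overlap law. The tilts producing that law
form a closed set, and a law with full support charges every nonempty open set; hence, for almost
every J, every tilt produces it.

Existence of the overlaps. For fixed J the law of two replicas need not be translation invariant,
but its average over J is. The pointwise ergodic theorem along cubes (`ae_exists_tendsto_cubeAvg`)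
then applies; it combines convex combinations of translates, close in L² to an invariant function,
with the maximal inequality `mul_measure_exists_le_sum_cube_le`. -/

namespace EdwardsAnderson

/-! ### Cubes -/

lemma mem_cube {d N : ℕ} {x : Site d} : x ∈ cube d N ↔ ∀ i, |x i| ≤ N := by
  simp only [cube, Finset.mem_Icc, Pi.le_def, abs_le]
  exact ⟨fun h i => ⟨h.1 i, h.2 i⟩, fun h => ⟨fun i => (h i).1, fun i => (h i).2⟩⟩

lemma card_cube (d N : ℕ) : (cube d N).card = (2 * N + 1) ^ d := by
  have : ((N : ℤ) + 1 + (N : ℤ)).toNat = 2 * N + 1 := by omega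
  simp [cube, Pi.card_Icc, Int.card_Icc, this]

lemma card_cube_pos (d N : ℕ) : 0 < ((cube d N).card : ℝ) := by
  rw [card_cube]; positivity

lemma cube_mono (d : ℕ) : Monotone (cube d) := fun M N h x hx => by
  rw [mem_cube] at hx ⊢
  exact fun i => (hx i).trans (by exact_mod_cast h)

lemma add_mem_cube {d M N : ℕ} {x y : Site d} (hx : x ∈ cube d M) (hy : y ∈ cube d N) :
    x + y ∈ cube d (M + N) := by
  rw [mem_cube] at *
  intro i
  have := abs_add_le (x i) (y i)
  have := hx i
  have := hy i
  push_cast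
  simp only [Pi.add_apply]
  linarith

lemma exists_mem_cube {d : ℕ} (x : Site d) : ∃ m, x ∈ cube d m := by
  refine ⟨∑ i, (x i).natAbs, mem_cube.2 fun i => ?_⟩
  have : (x i).natAbs ≤ ∑ i, (x i).natAbs :=
    Finset.single_le_sum (f := fun i => (x i).natAbs) (fun _ _ => Nat.zero_le _) (Finset.mem_univ i)
  rw [Int.abs_eq_natAbs]
  exact_mod_cast this

/-- The Følner property of cubes: a boundary layer of fixed width has vanishing relative size. -/
lemma tendsto_card_cube_add_div (d m : ℕ) :
    Tendsto (fun N => ((cube d (N + m)).card : ℝ) / (cube d N).card) atTop (𝓝 1) := by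
  have h0 : Tendsto (fun N : ℕ => 1 + (2 * m : ℝ) / (2 * (N : ℝ) + 1)) atTop (𝓝 (1 + 0)) := by
    refine tendsto_const_nhds.add (Tendsto.div_atTop tendsto_const_nhds ?_)
    exact tendsto_atTop_add_const_right _ _
      (Tendsto.const_mul_atTop (by norm_num) tendsto_natCast_atTop_atTop)
  have h1 := h0.pow d
  rw [add_zero, one_pow] at h1
  refine h1.congr fun N => ?_
  rw [card_cube, card_cube]
  push_cast
  rw [← div_pow]
  congr 1
  have : (2 * (N : ℝ) + 1) ≠ 0 := by positivity
  field_simp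
  ring

lemma abs_sum_sub_sum_le {ι : Type*} {F : ι → ℝ} {C : ℝ} (hF : ∀ i, |F i| ≤ C) {S U : Finset ι}
    (h : S ⊆ U) : |∑ i ∈ U, F i - ∑ i ∈ S, F i| ≤ C * ((U.card : ℝ) - S.card) := by
  classical
  rw [← Finset.sum_sdiff h, add_sub_cancel_right]
  refine (Finset.abs_sum_le_sum_abs _ _).trans ((Finset.sum_le_sum fun i _ => hF i).trans ?_)
  rw [Finset.sum_const, nsmul_eq_mul, Finset.card_sdiff_of_subset h,
    Nat.cast_sub (Finset.card_le_card h), mul_comm]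

/-- Averages of a bounded function over a cube and over a translate of it merge. -/
lemma tendsto_sum_cube_shift_sub {d : ℕ} (v : Site d) {F : Site d → ℝ} {C : ℝ}
    (hF : ∀ x, |F x| ≤ C) :
    Tendsto (fun N => (∑ x ∈ cube d N, F x - ∑ x ∈ cube d N, F (v + x)) / (cube d N).card)
      atTop (𝓝 0) := by
  classical
  obtain ⟨m, hm⟩ := exists_mem_cube v
  have hlim : Tendsto (fun N => 2 * C * (((cube d (N + m)).card : ℝ) / (cube d N).card - 1))
      atTop (𝓝 0) := by
    simpa using ((tendsto_card_cube_add_div d m).sub_const 1).const_mul (2 * C)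
  refine squeeze_zero_norm (fun N => ?_) hlim
  rw [Real.norm_eq_abs, abs_div, abs_of_pos (card_cube_pos d N), div_le_iff₀ (card_cube_pos d N)]
  have hshift : ∑ x ∈ cube d N, F (v + x) = ∑ x ∈ (cube d N).map (addLeftEmbedding v), F x := by
    simp [Finset.sum_map]
  -- The cube and its translate by v both lie in the cube of radius N + m; each sum is compared with
  -- the sum over that larger cube.
  have h1 := abs_sum_sub_sum_le hF (cube_mono d (Nat.le_add_right N m))
  have h2 := abs_sum_sub_sum_le hF (S := (cube d N).map (addLeftEmbedding v))
    (U := cube d (N + m)) (by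
      intro x hx
      obtain ⟨y, hy, rfl⟩ := Finset.mem_map.1 hx
      simpa [add_comm] using add_mem_cube hy hm)
  rw [Finset.card_map, ← hshift] at h2
  have h3 := card_cube_pos d N
  have : 2 * C * (((cube d (N + m)).card : ℝ) / (cube d N).card - 1) * (cube d N).card
      = 2 * (C * ((cube d (N + m)).card - (cube d N).card)) := by
    field_simp
  rw [this]
  rw [abs_le] at *
  constructor <;> linarith [h1.1, h1.2, h2.1, h2.2]

/-! ### The maximal inequality -/

open scoped ENNReal

/-- Cubes are the closed balls of the sup distance, which makes the Vitali covering lemma available.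
-/
lemma mem_closedBall_iff_sub_mem_cube {d N : ℕ} {x y : Site d} :
    y ∈ Metric.closedBall x (N : ℝ) ↔ y - x ∈ cube d N := by
  rw [Metric.mem_closedBall, dist_pi_le_iff (Nat.cast_nonneg N), mem_cube]
  refine forall_congr' fun i => ?_
  rw [Int.dist_eq, Pi.sub_apply]
  exact_mod_cast Iff.rfl

/-- Source of the constant 5 ^ d of the maximal inequality: 5 is the enlargement factor used in the
Vitali covering. -/
lemma card_cube_five_mul_le (d N : ℕ) : (cube d (5 * N)).card ≤ 5 ^ d * (cube d N).card := by
  rw [card_cube, card_cube, ← mul_pow]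
  exact Nat.pow_le_pow_left (by omega) d

/-- Vitali covering of a finite set of centres of cubes with large averages. -/
lemma mul_card_le_sum_cube {d : ℕ} (F : Site d → ℝ≥0∞) (S : Finset (Site d)) (r : Site d → ℕ)
    {R L : ℕ} (hS : S ⊆ cube d L) (hr : ∀ x ∈ S, r x ≤ R) (a : ℝ≥0∞)
    (h : ∀ x ∈ S, a * (cube d (r x)).card ≤ ∑ y ∈ cube d (r x), F (y + x)) :
    a * S.card ≤ 5 ^ d * ∑ y ∈ cube d (L + R), F y := by
  classical
  obtain ⟨u, huS, hdisj, hcov⟩ := Vitali.exists_disjoint_subfamily_covering_enlargement_closedBall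
    (S : Set (Site d)) id (fun x => (r x : ℝ)) R (fun x hx => by exact_mod_cast hr x hx) 5
    (by norm_num)
  obtain ⟨u, rfl⟩ := (S.finite_toSet.subset huS).exists_finset_coe
  have huS' : u ⊆ S := by exact_mod_cast huS
  set B : Site d → ℕ → Finset (Site d) := fun b n => (cube d n).map (addRightEmbedding b) with hB
  have hmem : ∀ b n x, x ∈ B b n ↔ x - b ∈ cube d n := by
    intro b n x
    simp only [hB, Finset.mem_map, addRightEmbedding_apply]
    exact ⟨by rintro ⟨y, hy, rfl⟩; simpa using hy, fun hx => ⟨x - b, hx, by simp⟩⟩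
  -- Each centre belongs to its own cube, hence to an enlarged cube of the disjoint subfamily.
  have hsub : S ⊆ u.biUnion fun b => B b (5 * r b) := by
    intro x hx
    obtain ⟨b, hb, hxb⟩ := hcov x (by exact_mod_cast hx)
    refine Finset.mem_biUnion.2 ⟨b, by exact_mod_cast hb, (hmem _ _ _).2 ?_⟩
    rw [← mem_closedBall_iff_sub_mem_cube]
    push_cast
    exact hxb (Metric.mem_closedBall_self (Nat.cast_nonneg _))
  have hcard : (S.card : ℝ≥0∞) ≤ 5 ^ d * ∑ b ∈ u, ((cube d (r b)).card : ℝ≥0∞) := by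
    have : S.card ≤ 5 ^ d * ∑ b ∈ u, (cube d (r b)).card := by
      refine (Finset.card_le_card hsub).trans (Finset.card_biUnion_le.trans ?_)
      rw [Finset.mul_sum]
      refine Finset.sum_le_sum fun b _ => ?_
      rw [hB, Finset.card_map]
      exact card_cube_five_mul_le d _
    exact_mod_cast this
  have hdisj' : (u : Set (Site d)).PairwiseDisjoint fun b => B b (r b) := by
    intro b hb c hc hbc
    have := hdisj hb hc hbc
    simp only [Function.onFun] at this ⊢
    rw [Finset.disjoint_left]
    intro x hx hx'
    rw [hmem, ← mem_closedBall_iff_sub_mem_cube] at hx hx'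
    exact Set.disjoint_left.1 this hx hx'
  calc a * S.card ≤ a * (5 ^ d * ∑ b ∈ u, ((cube d (r b)).card : ℝ≥0∞)) := by gcongr
    _ = 5 ^ d * ∑ b ∈ u, a * ((cube d (r b)).card : ℝ≥0∞) := by
        rw [← Finset.mul_sum]; ring
    _ ≤ 5 ^ d * ∑ b ∈ u, ∑ y ∈ cube d (r b), F (y + b) := by
        gcongr with b hb
        exact h b (huS' hb)
    _ = 5 ^ d * ∑ b ∈ u, ∑ y ∈ B b (r b), F y := by simp [hB, Finset.sum_map]
    _ = 5 ^ d * ∑ y ∈ u.biUnion fun b => B b (r b), F y := by rw [Finset.sum_biUnion hdisj']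
    _ ≤ 5 ^ d * ∑ y ∈ cube d (L + R), F y := by
        gcongr
        intro y hy
        obtain ⟨b, hb, hy⟩ := Finset.mem_biUnion.1 hy
        have h1 := cube_mono d (hr b (huS' hb)) ((hmem _ _ _).1 hy)
        simpa using add_mem_cube (hS (huS' hb)) h1

variable {X : Type*} [MeasurableSpace X] {d : ℕ}

/-- The maximal inequality for averages over cubes along a measure-preserving action of `ℤ^d`. -/
theorem mul_measure_exists_le_sum_cube_le {μ : Measure X} [IsProbabilityMeasure μ]
    {T : Site d → X → X} (hmp : ∀ x, MeasurePreserving (T x) μ μ)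
    (hadd : ∀ x y ω, T x (T y ω) = T (x + y) ω) {f : X → ℝ≥0∞} (hf : Measurable f) (a : ℝ≥0∞) :
    a * μ {ω | ∃ N, a * (cube d N).card ≤ ∑ y ∈ cube d N, f (T y ω)} ≤ 5 ^ d * ∫⁻ ω, f ω ∂μ := by
  classical
  -- Radii are truncated at R, so that the cubes centred in `cube d L` stay inside `cube d (L + R)`.
  set E : ℕ → Set X := fun R => {ω | ∃ N ≤ R, a * (cube d N).card ≤ ∑ y ∈ cube d N, f (T y ω)}
    with hE
  have hfT : ∀ y, Measurable fun ω => f (T y ω) := fun y => hf.comp (hmp y).measurable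
  have hEm : ∀ R, MeasurableSet (E R) := by
    intro R
    have : E R = ⋃ N ∈ Set.Iic R, {ω | a * (cube d N).card ≤ ∑ y ∈ cube d N, f (T y ω)} := by
      ext ω; simp [hE]
    rw [this]
    exact MeasurableSet.biUnion (Set.to_countable _) fun N _ =>
      measurableSet_le measurable_const (Finset.measurable_sum _ fun y _ => hfT y)
  have hmono : Monotone E := fun R R' h ω ⟨N, hN, hω⟩ => ⟨N, hN.trans h, hω⟩
  have hunion : {ω | ∃ N, a * (cube d N).card ≤ ∑ y ∈ cube d N, f (T y ω)} = ⋃ R, E R := by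
    ext ω
    simp only [hE, Set.mem_ofPred_eq, Set.mem_iUnion]
    exact ⟨fun ⟨N, h⟩ => ⟨N, N, le_rfl, h⟩, fun ⟨_, N, _, h⟩ => ⟨N, h⟩⟩
  rw [hunion, hmono.measure_iUnion, ENNReal.mul_iSup]
  refine iSup_le fun R => ?_
  -- Transference: the covering bound is applied on the lattice, along the orbit of each ω, to the
  -- function y ↦ f (T y ω), and is then integrated using invariance of μ.
  have key : ∀ L, ((cube d L).card : ℝ≥0∞) * (a * μ (E R)) ≤
      5 ^ d * ((cube d (L + R)).card * ∫⁻ ω, f ω ∂μ) := by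
    intro L
    have h1 : ∀ ω, a * ∑ x ∈ cube d L, (E R).indicator 1 (T x ω) ≤
        5 ^ d * ∑ y ∈ cube d (L + R), f (T y ω) := by
      intro ω
      have hr : ∀ x : Site d, ∃ N, T x ω ∈ E R →
          N ≤ R ∧ a * (cube d N).card ≤ ∑ y ∈ cube d N, f (T y (T x ω)) := by
        intro x
        by_cases hx : T x ω ∈ E R
        · obtain ⟨N, hN⟩ := hx
          exact ⟨N, fun _ => hN⟩
        · exact ⟨0, fun h => absurd h hx⟩
      choose r hr using hr
      have h2 := mul_card_le_sum_cube (fun y => f (T y ω))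
        ((cube d L).filter fun x => T x ω ∈ E R) r (R := R) (L := L) (Finset.filter_subset _ _)
        (fun x hx => (hr x (Finset.mem_filter.1 hx).2).1) a
        (fun x hx => by
          have := (hr x (Finset.mem_filter.1 hx).2).2
          simpa only [hadd] using this)
      convert h2 using 2
      rw [Finset.card_filter]
      push_cast
      exact Finset.sum_congr rfl fun x _ => by simp [Set.indicator_apply]
    have h3 := lintegral_mono h1 (μ := μ)
    have hind : ∀ x, Measurable fun ω => (E R).indicator (1 : X → ℝ≥0∞) (T x ω) :=
      fun x => (measurable_one.indicator (hEm R)).comp (hmp x).measurable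
    rw [lintegral_const_mul _ (Finset.measurable_sum _ fun x _ => hind x),
      lintegral_const_mul _ (Finset.measurable_sum _ fun x _ => hfT x),
      lintegral_finsetSum _ fun x _ => hind x, lintegral_finsetSum _ fun x _ => hfT x] at h3
    have h4 : ∀ x, ∫⁻ ω, (E R).indicator (1 : X → ℝ≥0∞) (T x ω) ∂μ = μ (E R) := fun x => by
      rw [(hmp x).lintegral_comp (measurable_one.indicator (hEm R)), lintegral_indicator_one (hEm R)]
    simp_rw [h4, fun x => (hmp x).lintegral_comp hf, Finset.sum_const, nsmul_eq_mul] at h3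
    calc _ = a * ((cube d L).card * μ (E R)) := by ring
      _ ≤ _ := h3
  -- As L grows with R fixed, the ratio of the two cardinalities disappears.
  have hlim : Tendsto (fun L => 5 ^ d * (∫⁻ ω, f ω ∂μ) *
      ENNReal.ofReal (((cube d (L + R)).card : ℝ) / (cube d L).card)) atTop
      (𝓝 (5 ^ d * (∫⁻ ω, f ω ∂μ) * ENNReal.ofReal 1)) :=
    ENNReal.Tendsto.const_mul ((ENNReal.continuous_ofReal.tendsto 1).comp
      (tendsto_card_cube_add_div d R)) (Or.inl (by simp))
  rw [ENNReal.ofReal_one, mul_one] at hlim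
  refine ge_of_tendsto' hlim fun L => ?_
  have hc : ((cube d L).card : ℝ≥0∞) ≠ 0 := by
    have := card_cube_pos d L
    exact_mod_cast this.ne'
  rw [ENNReal.ofReal_div_of_pos (card_cube_pos d L), ENNReal.ofReal_natCast, ENNReal.ofReal_natCast,
    ← mul_div_assoc, ENNReal.le_div_iff_mul_le (Or.inl hc) (Or.inl (ENNReal.natCast_ne_top _))]
  calc _ = ((cube d L).card : ℝ≥0∞) * (a * μ (E R)) := by ring
    _ ≤ _ := key L
    _ = _ := by ring

end EdwardsAnderson

namespace EdwardsAnderson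

/-! ### The pointwise ergodic theorem -/

open scoped ENNReal

/-- In a closed convex set stable under a family of norm-preserving maps there is a common fixed
point, the element of minimal norm. -/
lemma exists_mem_forall_eq_of_norm_preserving {E : Type*} [NormedAddCommGroup E]
    [InnerProductSpace ℝ E] [CompleteSpace E] {K : Set E} (hne : K.Nonempty) (hcl : IsClosed K)
    (hconv : Convex ℝ K) {ι : Type*} (U : ι → E → E) (hU : ∀ i, ∀ w ∈ K, U i w ∈ K)
    (hnorm : ∀ i w, ‖U i w‖ = ‖w‖) : ∃ v ∈ K, ∀ i, U i v = v := by
  obtain ⟨v, hvK, hv⟩ := exists_norm_eq_iInf_of_complete_convex hne hcl.isComplete hconv 0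
  refine ⟨v, hvK, fun i => ?_⟩
  -- Minimality of v gives ‖v‖² ≤ ⟪v, U v⟫. As ‖U v‖ = ‖v‖, expanding the square then gives ‖U v -
  -- v‖² ≤ 0.
  have h := (norm_eq_iInf_iff_real_inner_le_zero hconv hvK).1 hv _ (hU i v hvK)
  have h2 := norm_sub_sq_real (U i v) v
  rw [hnorm] at h2
  rw [zero_sub, inner_neg_left, inner_sub_right, real_inner_self_eq_norm_sq,
    real_inner_comm] at h
  have h3 : ‖U i v - v‖ ^ 2 ≤ 0 := by linarith
  have h4 : ‖U i v - v‖ = 0 := by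
    have := sq_nonneg ‖U i v - v‖
    exact pow_eq_zero_iff (two_ne_zero) |>.1 (le_antisymm h3 this)
  exact sub_eq_zero.1 (norm_eq_zero.1 h4)

variable {X : Type*} [MeasurableSpace X] {d : ℕ}

/-- The average of `f` over the cube `[-N, N]^d` of translates. -/
noncomputable def cubeAvg (T : Site d → X → X) (f : X → ℝ) (N : ℕ) (ω : X) : ℝ :=
  (∑ x ∈ cube d N, f (T x ω)) / (cube d N).card

/-- The averages of a bounded function are approximated, in the limit, by those of functions which
are close in `L²` to an invariant function. -/
lemma exists_invariant_approx {μ : Measure X} [IsProbabilityMeasure μ]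
    {T : Site d → X → X} (hmp : ∀ x, MeasurePreserving (T x) μ μ)
    (hadd : ∀ x y ω, T x (T y ω) = T (x + y) ω) {f : X → ℝ} (hf : Measurable f) {C : ℝ}
    (hC : ∀ ω, |f ω| ≤ C) :
    ∃ φ : X → ℝ, Measurable φ ∧ (∀ x, (fun ω => φ (T x ω)) =ᵐ[μ] φ) ∧
      ∀ η : ℝ≥0∞, 0 < η → ∃ u : X → ℝ, Measurable u ∧ ∫⁻ ω, ‖u ω - φ ω‖ₑ ∂μ ≤ η ∧
        ∀ ω, Tendsto (fun N => cubeAvg T f N ω - cubeAvg T u N ω) atTop (𝓝 0) := by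
  have hfm : ∀ x, Measurable fun ω => f (T x ω) := fun x => hf.comp (hmp x).measurable
  have hfL : ∀ x, MemLp (fun ω => f (T x ω)) 2 μ := fun x =>
    MemLp.of_bound (hfm x).aestronglyMeasurable C (ae_of_all _ fun ω => hC _)
  set g : Site d → Lp ℝ 2 μ := fun x => (hfL x).toLp _ with hg
  set K : Set (Lp ℝ 2 μ) := convexHull ℝ (Set.range g) with hK
  set U : Site d → Lp ℝ 2 μ →ₗᵢ[ℝ] Lp ℝ 2 μ := fun x => Lp.compMeasurePreservingₗᵢ ℝ (T x) (hmp x)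
    with hUdef
  have hU_coe : ∀ x (w : Lp ℝ 2 μ), U x w =ᵐ[μ] w ∘ T x := fun x w =>
    Lp.coeFn_compMeasurePreserving w (hmp x)
  have hUg : ∀ x y, U x (g y) = g (y + x) := by
    intro x y
    refine Lp.ext ((hU_coe x _).trans ?_)
    have h1 := (hmp x).quasiMeasurePreserving.ae_eq_comp (hfL y).coeFn_toLp
    filter_upwards [h1, (hfL (y + x)).coeFn_toLp] with ω h2 h3
    rw [h2, h3, Function.comp_apply, hadd]
  have hUK : ∀ x, ∀ w ∈ K, U x w ∈ K := by
    intro x w hw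
    have : U x w ∈ (U x).toLinearMap '' K := ⟨w, hw, rfl⟩
    rw [hK, LinearMap.image_convexHull] at this
    refine convexHull_mono ?_ this
    rintro _ ⟨_, ⟨y, rfl⟩, rfl⟩
    exact ⟨y + x, (hUg x y).symm⟩
  have hUKc : ∀ x, ∀ w ∈ closure K, U x w ∈ closure K := fun x w hw =>
    map_mem_closure (U x).continuous hw (hUK x)
  obtain ⟨φ, hφK, hφ⟩ := exists_mem_forall_eq_of_norm_preserving
    ((Set.range_nonempty g).convexHull.closure) isClosed_closure
    ((convex_convexHull ℝ _).closure) (fun x => (U x : Lp ℝ 2 μ → Lp ℝ 2 μ)) hUKc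
    (fun x w => (U x).norm_map w)
  -- The classes having a version whose averages merge with those of f at every point. This set is
  -- convex and contains the translates of f, hence also their convex hull; it need not be closed,
  -- which is why φ itself is only approximated.
  set P : Set (Lp ℝ 2 μ) := {w | ∃ u : X → ℝ, Measurable u ∧ w =ᵐ[μ] u ∧
    ∀ ω, Tendsto (fun N => cubeAvg T f N ω - cubeAvg T u N ω) atTop (𝓝 0)} with hP
  have hPconv : Convex ℝ P := by
    rintro w ⟨u, hum, hwu, hu⟩ w' ⟨u', hum', hwu', hu'⟩ a b - - hab
    refine ⟨fun ω => a * u ω + b * u' ω, (hum.const_mul a).add (hum'.const_mul b), ?_, fun ω => ?_⟩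
    · filter_upwards [Lp.coeFn_add (a • w) (b • w'), Lp.coeFn_smul a w, Lp.coeFn_smul b w', hwu,
        hwu'] with ω h1 h2 h3 h4 h5
      rw [h1, Pi.add_apply, h2, h3, Pi.smul_apply, Pi.smul_apply, h4, h5, smul_eq_mul, smul_eq_mul]
    · have := ((hu ω).const_mul a).add ((hu' ω).const_mul b)
      simp only [mul_zero, add_zero] at this
      refine this.congr fun N => ?_
      have e : cubeAvg T (fun ω => a * u ω + b * u' ω) N ω =
          a * cubeAvg T u N ω + b * cubeAvg T u' N ω := by
        simp only [cubeAvg, Finset.sum_add_distrib, ← Finset.mul_sum]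
        ring
      rw [e]
      have : b = 1 - a := by linarith
      subst this
      ring
  have hgP : Set.range g ⊆ P := by
    rintro _ ⟨v, rfl⟩
    refine ⟨fun ω => f (T v ω), hfm v, (hfL v).coeFn_toLp, fun ω => ?_⟩
    refine (tendsto_sum_cube_shift_sub v (F := fun x => f (T x ω)) fun x => hC _).congr fun N => ?_
    simp only [cubeAvg, hadd, sub_div]
  have hKP : K ⊆ P := convexHull_min hgP hPconv
  have hφm : AEStronglyMeasurable φ μ := Lp.aestronglyMeasurable φ
  refine ⟨hφm.mk φ, hφm.stronglyMeasurable_mk.measurable, fun x => ?_, fun η hη => ?_⟩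
  · have h1 := (hmp x).quasiMeasurePreserving.ae_eq_comp hφm.ae_eq_mk
    have h2 := hU_coe x φ
    rw [show U x φ = φ from hφ x] at h2
    exact h1.symm.trans (h2.symm.trans hφm.ae_eq_mk)
  · obtain ⟨w, hwK, hw⟩ := EMetric.mem_closure_iff.1 hφK η hη
    obtain ⟨u, hum, hwu, hu⟩ := hKP hwK
    refine ⟨u, hum, ?_, hu⟩
    rw [edist_comm, Lp.edist_def] at hw
    -- On a probability space the L¹ norm is bounded by the L² norm; the maximal inequality needs
    -- the former.
    have h1 : eLpNorm (⇑w - ⇑φ) 1 μ ≤ eLpNorm (⇑w - ⇑φ) 2 μ :=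
      eLpNorm_le_eLpNorm_of_exponent_le (by norm_num)
        ((Lp.aestronglyMeasurable w).sub (Lp.aestronglyMeasurable φ))
    rw [eLpNorm_one_eq_lintegral_enorm] at h1
    refine le_trans (le_of_eq (lintegral_congr_ae ?_)) (h1.trans hw.le)
    filter_upwards [hwu, hφm.ae_eq_mk] with ω h2 h3
    rw [Pi.sub_apply, h2, h3]

/-- The pointwise ergodic theorem for bounded functions, along the cubes `[-N, N]^d`. -/
theorem ae_exists_tendsto_cubeAvg {μ : Measure X} [IsProbabilityMeasure μ]
    {T : Site d → X → X} (hmp : ∀ x, MeasurePreserving (T x) μ μ)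
    (hadd : ∀ x y ω, T x (T y ω) = T (x + y) ω) {f : X → ℝ} (hf : Measurable f) {C : ℝ}
    (hC : ∀ ω, |f ω| ≤ C) :
    ∀ᵐ ω ∂μ, ∃ l, Tendsto (fun N => cubeAvg T f N ω) atTop (𝓝 l) := by
  obtain ⟨φ, hφm, hφ, happ⟩ := exists_invariant_approx hmp hadd hf hC
  have hinv : ∀ᵐ ω ∂μ, ∀ x, φ (T x ω) = φ ω := ae_all_iff.2 hφ
  have hstep : ∀ ε : ℝ, 0 < ε → ∀ᵐ ω ∂μ, ∀ᶠ N in atTop, |cubeAvg T f N ω - φ ω| < 2 * ε := by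
    intro ε hε
    set B : Set X := {ω | ¬ ∀ᶠ N in atTop, |cubeAvg T f N ω - φ ω| < 2 * ε} with hB
    have hε0 : ENNReal.ofReal ε ≠ 0 := by simpa using hε
    have hbound : ∀ η : ℝ≥0∞, 0 < η → ENNReal.ofReal ε * μ B ≤ 5 ^ d * η := by
      intro η hη
      obtain ⟨u, hum, huφ, hu⟩ := happ η hη
      -- Up to a null set, the maximal function of |u - φ| is at least ε on B: of the margin 2ε, one
      -- ε absorbs the vanishing difference between the averages of f and u. As η is arbitrary, B is
      -- null.
      have hmax := mul_measure_exists_le_sum_cube_le hmp hadd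
        (f := fun ω => ‖u ω - φ ω‖ₑ) (hum.sub hφm).enorm (ENNReal.ofReal ε)
      refine le_trans ?_ (hmax.trans (by gcongr))
      gcongr 1
      refine measure_mono_ae ?_
      filter_upwards [hinv] with ω hω hωB
      change ∃ N, _
      by_contra! hcon
      refine hωB ?_
      have h1 : ∀ N, |cubeAvg T u N ω - φ ω| < ε := by
        intro N
        have h2 := hcon N
        have hc := card_cube_pos d N
        -- Since φ is constant along the orbit, it equals its own averages.
        have h3 : cubeAvg T u N ω - φ ω =
            (∑ y ∈ cube d N, (u (T y ω) - φ (T y ω))) / (cube d N).card := by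
          simp only [cubeAvg, hω, Finset.sum_sub_distrib, Finset.sum_const, nsmul_eq_mul]
          field_simp
        rw [h3, abs_div, abs_of_pos hc, div_lt_iff₀ hc]
        refine (Finset.abs_sum_le_sum_abs _ _).trans_lt ?_
        rw [← ENNReal.ofReal_lt_ofReal_iff (by positivity),
          ENNReal.ofReal_sum_of_nonneg fun _ _ => abs_nonneg _, ENNReal.ofReal_mul hε.le,
          ENNReal.ofReal_natCast]
        simpa only [← Real.norm_eq_abs, ofReal_norm] using h2
      filter_upwards [(hu ω).eventually (Metric.ball_mem_nhds (0 : ℝ) hε)] with N hN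
      rw [dist_zero_right, Real.norm_eq_abs] at hN
      have := h1 N
      rw [abs_lt] at *
      constructor <;> linarith [hN.1, hN.2, this.1, this.2]
    have h0 : ENNReal.ofReal ε * μ B = 0 := by
      refine le_antisymm ?_ bot_le
      have hlim : Tendsto (fun η : ℝ≥0∞ => 5 ^ d * η) (𝓝[>] 0) (𝓝 (5 ^ d * 0)) :=
        (ENNReal.Tendsto.const_mul tendsto_id (Or.inr (by simp))).mono_left nhdsWithin_le_nhds
      rw [mul_zero] at hlim
      exact ge_of_tendsto hlim (by
        filter_upwards [self_mem_nhdsWithin] with η hη using hbound η hη)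
    rw [ae_iff]
    exact (mul_eq_zero.1 h0).resolve_left hε0
  have hall : ∀ᵐ ω ∂μ, ∀ n : ℕ, ∀ᶠ N in atTop,
      |cubeAvg T f N ω - φ ω| < 2 * (1 / ((n : ℝ) + 1)) :=
    ae_all_iff.2 fun n => hstep _ (by positivity)
  filter_upwards [hall] with ω hω
  refine ⟨φ ω, Metric.tendsto_nhds.2 fun ε hε => ?_⟩
  obtain ⟨n, hn⟩ := exists_nat_one_div_lt (half_pos hε)
  filter_upwards [hω n] with N hN
  rw [Real.dist_eq]
  linarith

end EdwardsAnderson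

namespace EdwardsAnderson

/-! ### Edge overlaps -/

/-- The two sequences have the same limits, and `limUnder` depends only on the predicate of being a
limit; so the equality persists when there is no limit. -/
lemma limUnder_congr_of_tendsto_sub {f g : ℕ → ℝ}
    (h : Tendsto (fun N => f N - g N) atTop (𝓝 0)) : limUnder atTop f = limUnder atTop g := by
  have key : ∀ r, Tendsto f atTop (𝓝 r) ↔ Tendsto g atTop (𝓝 r) := fun r =>
    ⟨fun hf => by simpa using hf.sub h, fun hg => by simpa using hg.add h⟩
  unfold limUnder lim
  congr 1
  ext r
  exact key r

lemma abs_bond_mul_bond {d : ℕ} (σ σ' : Config d) (e : Edge d) : |bond σ e * bond σ' e| = 1 := by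
  rw [abs_mul, abs_bond, abs_bond, one_mul]

lemma abs_localOverlap_le {d : ℕ} (W : Finset (Site d)) (σ σ' : Config d) :
    |localOverlap W σ σ'| ≤ 1 := by
  unfold localOverlap
  rw [abs_div, Nat.abs_cast]
  refine div_le_one_of_le₀ ?_ (Nat.cast_nonneg _)
  refine (Finset.abs_sum_le_sum_abs _ _).trans ?_
  simp [abs_mul, abs_bond]

/-- The overlap is bounded, also where the limit defining it does not exist. -/
lemma exists_abs_overlap_le (d : ℕ) : ∃ C, ∀ σ σ' : Config d, |overlap σ σ'| ≤ C := by
  -- Without a limit, `limUnder` is a choice from the empty predicate, which is one fixed real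
  -- number.
  refine ⟨max 1 |Classical.epsilon fun _ : ℝ => False|, fun σ σ' => ?_⟩
  by_cases h : OverlapExists σ σ'
  · have := (tendsto_nhds_limUnder h).abs
    exact (le_of_tendsto' this fun N => abs_localOverlap_le _ _ _).trans (le_max_left _ _)
  · have : overlap σ σ' = Classical.epsilon fun _ : ℝ => False := by
      unfold overlap limUnder lim
      congr 1
      ext r
      exact iff_of_false (fun hr => h ⟨r, hr⟩) id
    rw [this]
    exact le_max_right _ _

lemma measurable_localOverlap {d : ℕ} (W : Finset (Site d)) :
    Measurable fun p : Config d × Config d => localOverlap W p.1 p.2 :=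
  (Finset.measurable_sum _ fun e _ => ((measurable_bond e).comp measurable_fst).mul
    ((measurable_bond e).comp measurable_snd)).div_const _

lemma measurable_overlap {d : ℕ} : Measurable fun p : Config d × Config d => overlap p.1 p.2 :=
  (StronglyMeasurable.limUnder fun N =>
    (measurable_localOverlap (cube d N)).stronglyMeasurable).measurable

lemma measurableSet_overlapExists {d : ℕ} :
    MeasurableSet {p : Config d × Config d | OverlapExists p.1 p.2} :=
  measurableSet_exists_tendsto fun N => measurable_localOverlap (cube d N)

/-- Translation of spin configurations. -/
def shift {d : ℕ} (v : Site d) (σ : Config d) : Config d := fun x => σ (v + x)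

lemma measurable_shift {d : ℕ} (v : Site d) : Measurable (shift v) :=
  measurable_pi_lambda _ fun x => measurable_pi_apply (v + x)

lemma shift_shift {d : ℕ} (v w : Site d) (σ : Config d) : shift v (shift w σ) = shift (v + w) σ := by
  ext x
  simp [shift, add_assoc, add_left_comm]

lemma bond_shift {d : ℕ} (v : Site d) (σ : Config d) (e : Edge d) :
    bond (shift v σ) e = bond σ (v + e.1, e.2) := by
  simp [bond, shift, Edge.tip, add_assoc]

lemma mem_edgesIn {d : ℕ} {W : Finset (Site d)} {e : Edge d} :
    e ∈ edgesIn W ↔ e.1 ∈ W ∧ e.tip ∈ W := by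
  simp [edgesIn]

lemma edgesIn_cube_subset (d N : ℕ) : edgesIn (cube d N) ⊆ cube d N ×ˢ Finset.univ :=
  Finset.filter_subset _ _

lemma subset_edgesIn_cube (d N : ℕ) :
    cube d N ×ˢ (Finset.univ : Finset (Fin d)) ⊆ edgesIn (cube d (N + 1)) := by
  rintro ⟨x, k⟩ hx
  rw [Finset.mem_product] at hx
  refine mem_edgesIn.2 ⟨cube_mono d (Nat.le_succ N) hx.1, add_mem_cube hx.1 (mem_cube.2 fun i => ?_)⟩
  by_cases h : i = k
  · subst h; simp
  · simp [h]

/-- Edges inside a cube are based in it, and include all edges based in the cube of radius one less;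
these two counts sandwich the cardinality. -/
lemma tendsto_card_edgesIn_cube {d : ℕ} (hd : 0 < d) :
    Tendsto (fun N => ((edgesIn (cube d N)).card : ℝ) / (d * (cube d N).card)) atTop (𝓝 1) := by
  rw [← tendsto_add_atTop_iff_nat 1]
  have hd' : (0 : ℝ) < d := by exact_mod_cast hd
  refine tendsto_of_tendsto_of_tendsto_of_le_of_le
    (by simpa using (tendsto_card_cube_add_div d 1).inv₀ one_ne_zero)
    tendsto_const_nhds (fun N => ?_) (fun N => ?_)
  · have h := Finset.card_le_card (subset_edgesIn_cube d N)
    rw [Finset.card_product, Finset.card_univ, Fintype.card_fin] at h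
    have h' : ((cube d N).card : ℝ) * d ≤ (edgesIn (cube d (N + 1))).card := by exact_mod_cast h
    have h1 := card_cube_pos d (N + 1)
    have h0 := card_cube_pos d N
    rw [div_le_div_iff₀ h1 (by positivity)]
    nlinarith
  · have h := Finset.card_le_card (edgesIn_cube_subset d (N + 1))
    rw [Finset.card_product, Finset.card_univ, Fintype.card_fin] at h
    have h1 := card_cube_pos d (N + 1)
    simp only
    rw [div_le_one (by positivity), mul_comm]
    exact_mod_cast h

/-- Averaging over the edges in a large cube is the same as averaging over its sites. -/
lemma tendsto_avg_edges_sub_avg_sites {d : ℕ} (hd : 0 < d) {F : Edge d → ℝ} (hF : ∀ e, |F e| ≤ 1) :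
    Tendsto (fun N => (∑ e ∈ edgesIn (cube d N), F e) / (edgesIn (cube d N)).card -
      ((∑ x ∈ cube d N, ∑ k, F (x, k)) / (cube d N).card) / d) atTop (𝓝 0) := by
  have hlim : Tendsto (fun N => 2 * (1 - ((edgesIn (cube d N)).card : ℝ) / (d * (cube d N).card)))
      atTop (𝓝 0) := by
    simpa using ((tendsto_card_edgesIn_cube hd).const_sub 1).const_mul 2
  refine squeeze_zero_norm (fun N => ?_) hlim
  have h1 := abs_sum_sub_sum_le hF (edgesIn_cube_subset d N)
  rw [Finset.sum_product, Finset.card_product, Finset.card_univ, Fintype.card_fin, one_mul] at h1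
  have hs : |∑ e ∈ edgesIn (cube d N), F e| ≤ (edgesIn (cube d N)).card := by
    refine (Finset.abs_sum_le_sum_abs _ _).trans ((Finset.sum_le_sum fun e _ => hF e).trans ?_)
    simp
  have hc := card_cube_pos d N
  have hd' : (0 : ℝ) < d := by exact_mod_cast hd
  set s := ∑ e ∈ edgesIn (cube d N), F e
  set S := ∑ x ∈ cube d N, ∑ k, F (x, k)
  set c : ℝ := ((cube d N).card : ℝ)
  push_cast at h1
  -- A single site (N = 0) contains no edge: the edge average is then 0 / 0 = 0 and the claimed
  -- bound is 2.
  rcases (edgesIn (cube d N)).card.eq_zero_or_pos with h0 | h0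
  · rw [h0] at h1 hs ⊢
    simp only [Nat.cast_zero, abs_nonpos_iff, sub_zero] at h1 hs ⊢
    rw [hs, sub_zero] at h1
    rw [hs, zero_div, zero_sub, norm_neg, Real.norm_eq_abs, abs_div, abs_div, abs_of_pos hc,
      abs_of_pos hd', div_div, div_le_iff₀ (by positivity)]
    simp only [zero_div, sub_zero]
    nlinarith [mul_pos hc hd']
  · have h0' : (0 : ℝ) < (edgesIn (cube d N)).card := by exact_mod_cast h0
    set E : ℝ := ((edgesIn (cube d N)).card : ℝ)
    -- The error splits into the contribution of the boundary edges and the change of normalization;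
    -- each is at most 1 - E / (d * c).
    have e1 : s / E - S / c / d = -((S - s) / (d * c)) + s / E * (1 - E / (d * c)) := by
      field_simp
      ring
    have hE : E ≤ c * d := by linarith [(abs_nonneg _).trans h1]
    have hnn : 0 ≤ 1 - E / (d * c) := by
      rw [sub_nonneg, div_le_one (by positivity)]; linarith
    have h2 : |(S - s) / (d * c)| ≤ 1 - E / (d * c) := by
      rw [abs_div, abs_of_pos (by positivity : 0 < d * c), div_le_iff₀ (by positivity)]
      have : (1 - E / (d * c)) * (d * c) = c * d - E := by field_simp
      rw [this]; exact h1
    have h3 : |s / E * (1 - E / (d * c))| ≤ 1 - E / (d * c) := by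
      rw [abs_mul, abs_of_nonneg hnn]
      refine mul_le_of_le_one_left hnn ?_
      rw [abs_div, abs_of_pos h0']
      exact div_le_one_of_le₀ hs h0'.le
    rw [Real.norm_eq_abs, e1]
    refine (abs_add_le _ _).trans ?_
    rw [abs_neg]
    linarith

/-- Edge averages are traded for site averages, and site averages over a cube and its translate
merge. The argument is deterministic, so there is no exceptional set of configurations. -/
lemma overlap_shift {d : ℕ} (v : Site d) (σ σ' : Config d) :
    overlap (shift v σ) (shift v σ') = overlap σ σ' := by
  rcases Nat.eq_zero_or_pos d with rfl | hd
  · simp [overlap, localOverlap, edgesIn]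
  refine limUnder_congr_of_tendsto_sub ?_
  set F : Edge d → ℝ := fun e => bond σ e * bond σ' e
  have hF : ∀ e, |F e| ≤ 1 := fun e => (abs_bond_mul_bond σ σ' e).le
  have h1 := tendsto_avg_edges_sub_avg_sites hd hF
  have h2 := tendsto_avg_edges_sub_avg_sites hd (F := fun e => F (v + e.1, e.2)) fun e => hF _
  have h3 := tendsto_sum_cube_shift_sub v (F := fun x => ∑ k, F (x, k)) (C := d) fun x => by
    refine (Finset.abs_sum_le_sum_abs _ _).trans ((Finset.sum_le_sum fun k _ => hF _).trans ?_)
    simp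
  have h4 := (h2.sub h1).sub (h3.div_const (d : ℝ))
  simp only [sub_zero, zero_div] at h4
  refine h4.congr fun N => ?_
  simp only [localOverlap, bond_shift, F]
  ring

/-- Under a law of pairs of configurations which is invariant under translations, the overlap almost
surely exists. -/
lemma ae_overlapExists {d : ℕ} {μ : Measure (Config d × Config d)} [IsProbabilityMeasure μ]
    (hμ : ∀ v, MeasurePreserving (fun p : Config d × Config d => (shift v p.1, shift v p.2)) μ μ) :
    ∀ᵐ p ∂μ, OverlapExists p.1 p.2 := by
  rcases Nat.eq_zero_or_pos d with rfl | hd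
  · exact ae_of_all _ fun p => ⟨0, by simp [localOverlap, edgesIn]⟩
  -- The sum over the d edges based at the origin: its translates sum over a cube to the edges based
  -- in that cube.
  set f : Config d × Config d → ℝ := fun p => ∑ k, bond p.1 (0, k) * bond p.2 (0, k) with hf
  have hfm : Measurable f := Finset.measurable_sum _ fun k _ =>
    ((measurable_bond _).comp measurable_fst).mul ((measurable_bond _).comp measurable_snd)
  have hfC : ∀ p, |f p| ≤ d := fun p => by
    refine (Finset.abs_sum_le_sum_abs _ _).trans ?_
    simp [abs_mul, abs_bond]
  filter_upwards [ae_exists_tendsto_cubeAvg hμ (fun x y p => by simp [shift_shift]) hfm hfC]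
    with p ⟨l, hl⟩
  refine ⟨0 + l / d, ?_⟩
  have h1 := tendsto_avg_edges_sub_avg_sites hd (F := fun e => bond p.1 e * bond p.2 e)
    fun e => (abs_bond_mul_bond p.1 p.2 e).le
  refine (h1.add (hl.div_const (d : ℝ))).congr fun N => ?_
  simp [localOverlap, cubeAvg, hf, bond_shift]

end EdwardsAnderson

namespace EdwardsAnderson

/-! ### Ergodicity of the couplings -/

instance {d : ℕ} (ρ : Measure ℝ) [IsProbabilityMeasure ρ] :
    IsProbabilityMeasure (couplingLaw d ρ) := by
  unfold couplingLaw; infer_instance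

/-- Distinct coordinates of an i.i.d. family are again i.i.d., so injectivity is enough. Both
lattice translations and rotations of a torus are handled in this way. -/
lemma measurePreserving_reindex {d : ℕ} (ρ : Measure ℝ) [IsProbabilityMeasure ρ]
    {π : Edge d → Edge d} (hπ : Function.Injective π) :
    MeasurePreserving (fun J : Couplings d => fun e => J (π e)) (couplingLaw d ρ)
      (couplingLaw d ρ) :=
  ⟨measurable_pi_lambda _ fun e => measurable_pi_apply (π e),
    Measure.map_infinitePi_infinitePi_of_inj hπ⟩

/-- Translation of edges. -/
def shiftEdge {d : ℕ} (v : Site d) (e : Edge d) : Edge d := (v + e.1, e.2)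

/-- Translation of couplings. -/
def shiftCouplings {d : ℕ} (v : Site d) (J : Couplings d) : Couplings d :=
  fun e => J (shiftEdge v e)

lemma shiftEdge_injective {d : ℕ} (v : Site d) : Function.Injective (shiftEdge v) := by
  rintro ⟨x, k⟩ ⟨y, l⟩ h
  simpa [shiftEdge] using h

lemma measurePreserving_shiftCouplings {d : ℕ} (ρ : Measure ℝ) [IsProbabilityMeasure ρ]
    (v : Site d) : MeasurePreserving (shiftCouplings v) (couplingLaw d ρ) (couplingLaw d ρ) :=
  measurePreserving_reindex ρ (shiftEdge_injective v)

lemma shiftCouplings_shiftCouplings {d : ℕ} (v w : Site d) (J : Couplings d) :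
    shiftCouplings v (shiftCouplings w J) = shiftCouplings (v + w) J := by
  ext e
  simp [shiftCouplings, shiftEdge, add_assoc, add_left_comm]

lemma shiftCouplings_zero {d : ℕ} (J : Couplings d) : shiftCouplings 0 J = J := by
  ext e
  simp [shiftCouplings, shiftEdge]

lemma iterate_shiftCouplings {d : ℕ} (v : Site d) (n : ℕ) :
    (shiftCouplings v)^[n] = shiftCouplings (n • v) := by
  induction n with
  | zero => ext J e; simp [shiftCouplings_zero]
  | succ n ih =>
    rw [Function.iterate_succ', ih]
    ext1 J
    rw [Function.comp_apply, shiftCouplings_shiftCouplings, succ_nsmul']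

lemma measure_inter_cylinder {d : ℕ} (ρ : Measure ℝ) [IsProbabilityMeasure ρ]
    {I I' : Finset (Edge d)} (hI : Disjoint I I') {S : Set (I → ℝ)} {S' : Set (I' → ℝ)}
    (hS : MeasurableSet S) (hS' : MeasurableSet S') :
    couplingLaw d ρ (cylinder I S ∩ cylinder I' S') =
      couplingLaw d ρ (cylinder I S) * couplingLaw d ρ (cylinder I' S') := by
  have h : iIndepFun (fun (e : Edge d) (J : Couplings d) => J e) (couplingLaw d ρ) :=
    iIndepFun_infinitePi (P := fun _ : Edge d => ρ) (X := fun _ x => x) fun _ => measurable_id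
  have h2 := h.indepFun_finset I I' hI fun e => measurable_pi_apply e
  exact h2.measure_inter_preimage_eq_mul _ _ hS hS'

/-- An i.i.d. field of couplings is ergodic under the translation by a lattice vector. -/
lemma ergodic_shiftCouplings {d : ℕ} (ρ : Measure ℝ) [IsProbabilityMeasure ρ] (k : Fin d) :
    Ergodic (shiftCouplings (Pi.single k 1)) (couplingLaw d ρ) := by
  classical
  set ν := couplingLaw d ρ
  set v : Site d := Pi.single k 1
  refine ⟨measurePreserving_shiftCouplings ρ v, ⟨fun s hs hinv => ?_⟩⟩
  have hinv' : ∀ n : ℕ, shiftCouplings (n • v) ⁻¹' s = s := fun n => by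
    rw [← iterate_shiftCouplings]
    exact (Function.IsFixedPt.preimage_iterate hinv n)
  have hdense := Measure.MeasureDense.of_generateFrom_isSetAlgebra_finite ν
    (isSetAlgebra_measurableCylinders (α := fun _ : Edge d => ℝ))
    generateFrom_measurableCylinders.symm
  -- Mixing argument: s is close to a cylinder t and, being invariant, equally close to a far
  -- translate t' of t. By independence ν s ≈ ν (t ∩ t') = (ν t)² ≈ (ν s)².
  have key : ∀ ε : ℝ, 0 < ε → |ν.real s - ν.real s ^ 2| ≤ 4 * ε := by
    intro ε hε
    obtain ⟨t, ht, hst⟩ := hdense.approx s hs (measure_ne_top _ _) ε hε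
    obtain ⟨I, S, hS, rfl⟩ := (mem_measurableCylinders _).1 ht
    -- A displacement exceeding twice every k-th coordinate occurring in I, so that I and its
    -- translate are disjoint.
    set n : ℕ := 2 * (∑ e ∈ I, (e.1 k).natAbs) + 1
    have hb : ∀ e ∈ I, (e.1 k).natAbs ≤ ∑ e ∈ I, (e.1 k).natAbs := fun e he =>
      Finset.single_le_sum (f := fun e : Edge d => (e.1 k).natAbs) (fun _ _ => Nat.zero_le _) he
    set I' : Finset (Edge d) := I.image (shiftEdge (n • v))
    have hdisj : Disjoint I I' := by
      rw [Finset.disjoint_left]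
      intro e he he'
      obtain ⟨e', he'', rfl⟩ := Finset.mem_image.1 he'
      have h1 := hb _ he
      have h2 := hb _ he''
      have h3 : (n • v) k = n := by
        rw [Pi.smul_apply, nsmul_eq_mul]
        simp [v]
      simp only [shiftEdge, Pi.add_apply, h3] at h1
      omega
    set t : Set (Couplings d) := cylinder (α := fun _ => ℝ) I S
    have htm : MeasurableSet t := hS.cylinder I
    set t' := shiftCouplings (n • v) ⁻¹' t
    have ht'm : MeasurableSet t' := (measurePreserving_shiftCouplings ρ _).measurable htm
    have hmul : ν (t ∩ t') = ν t * ν t' := by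
      set S' : Set (I' → ℝ) := (fun (J : I' → ℝ) (e : I) =>
        J ⟨shiftEdge (n • v) e, Finset.mem_image_of_mem _ e.2⟩) ⁻¹' S
      have hS' : MeasurableSet S' := (measurable_pi_lambda _ fun e => measurable_pi_apply _) hS
      have : t' = cylinder I' S' := rfl
      rw [this]
      exact measure_inter_cylinder ρ hdisj hS hS'
    have ht' : ν t' = ν t :=
      (measurePreserving_shiftCouplings ρ _).measure_preimage htm.nullMeasurableSet
    have hst' : ν (symmDiff s t') = ν (symmDiff s t) := by
      have : symmDiff s t' = shiftCouplings (n • v) ⁻¹' (symmDiff s t) := by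
        conv_lhs => rw [← hinv' n]
        rfl
      rw [this]
      exact (measurePreserving_shiftCouplings ρ _).measure_preimage
        (hs.symmDiff htm).nullMeasurableSet
    have e1 : ν.real (symmDiff s t) ≤ ε := by
      rw [measureReal_def]
      exact ENNReal.toReal_le_of_le_ofReal hε.le hst.le
    have e1' : ν.real (symmDiff s t') ≤ ε := by
      rw [measureReal_def, hst', ← measureReal_def]; exact e1
    have e2 : |ν.real s - ν.real t| ≤ ε :=
      (abs_measureReal_sub_le_measureReal_symmDiff hs.nullMeasurableSet
        htm.nullMeasurableSet).trans e1
    have e3 : |ν.real s - ν.real (t ∩ t')| ≤ 2 * ε := by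
      refine (abs_measureReal_sub_le_measureReal_symmDiff hs.nullMeasurableSet
        (htm.inter ht'm).nullMeasurableSet).trans ?_
      have : symmDiff s (t ∩ t') ⊆ symmDiff s t ∪ symmDiff s t' := by
        intro x hx
        simp only [Set.mem_symmDiff, Set.mem_inter_iff, Set.mem_union] at hx ⊢
        tauto
      refine (measureReal_mono this).trans ((measureReal_union_le _ _).trans ?_)
      linarith
    have e4 : ν.real (t ∩ t') = ν.real t ^ 2 := by
      rw [measureReal_def, hmul, ht', ENNReal.toReal_mul, sq]; rfl
    have e5 : |ν.real t ^ 2 - ν.real s ^ 2| ≤ 2 * ε := by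
      rw [sq_sub_sq, abs_mul]
      have h1 : |ν.real t + ν.real s| ≤ 2 := by
        rw [abs_of_nonneg (by positivity)]
        linarith [measureReal_le_one (μ := ν) (s := t), measureReal_le_one (μ := ν) (s := s)]
      rw [abs_sub_comm] at e2
      exact mul_le_mul h1 e2 (abs_nonneg _) (by norm_num)
    rw [e4] at e3
    calc |ν.real s - ν.real s ^ 2| = |(ν.real s - ν.real t ^ 2) + (ν.real t ^ 2 - ν.real s ^ 2)| := by
          ring_nf
      _ ≤ _ := abs_add_le _ _
      _ ≤ 4 * ε := by linarith
  have h0 : ν.real s - ν.real s ^ 2 = 0 := by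
    rw [← abs_nonpos_iff]
    refine le_of_forall_pos_le_add fun ε hε => ?_
    have := key (ε / 4) (by positivity)
    linarith
  rw [eventuallyConst_set']
  have h1 : ν.real s * (1 - ν.real s) = 0 := by linarith [h0]
  rcases mul_eq_zero.1 h1 with h | h
  · left
    rw [ae_eq_empty]
    exact (measureReal_eq_zero_iff).1 h
  · right
    rw [ae_eq_univ, prob_compl_eq_zero_iff hs]
    rw [measureReal_def] at h
    rw [← ENNReal.toReal_eq_one_iff]
    linarith

/-- A measurable function of the couplings which is almost surely invariant under translations is
almost surely constant. -/
lemma exists_ae_eq_const_of_shift_invariant {d : ℕ} (ρ : Measure ℝ) [IsProbabilityMeasure ρ]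
    {Y : Type*} [Nonempty Y] [MeasurableSpace Y] [MeasurableSpace.CountablySeparated Y]
    {g : Couplings d → Y} (hg : Measurable g)
    (hinv : ∀ v, (fun J => g (shiftCouplings v J)) =ᵐ[couplingLaw d ρ] g) :
    ∃ c, ∀ᵐ J ∂(couplingLaw d ρ), g J = c := by
  rcases Nat.eq_zero_or_pos d with rfl | hd
  · exact ⟨g 0, ae_of_all _ fun J => by rw [Subsingleton.elim J 0]⟩
  · exact (ergodic_shiftCouplings ρ ⟨0, hd⟩).ae_eq_const_of_ae_eq_comp₀ hg.nullMeasurable (hinv _)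

end EdwardsAnderson

namespace EdwardsAnderson

/-! ### Local events and their probabilities -/

variable {d : ℕ}

/-- The configurations which agree with `q.2` on the window `q.1`. -/
def agree (q : Finset (Site d) × Config d) : Set (Config d) := {σ | ∀ x ∈ q.1, σ x = q.2 x}

lemma measurableSet_agree (q : Finset (Site d) × Config d) : MeasurableSet (agree q) := by
  have : agree q = ⋂ x ∈ q.1, (fun σ : Config d => σ x) ⁻¹' {q.2 x} := by
    ext σ; simp [agree]
  rw [this]
  exact Finset.measurableSet_biInter _ fun x _ => measurable_pi_apply x (measurableSet_singleton _)

/-- The probability of a local event. -/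
noncomputable def localProb (q : Finset (Site d) × Config d) (Γ : State d) : ℝ :=
  (Γ : Measure (Config d)).real (agree q)

lemma measurable_state_real {A : Set (Config d)} (hA : MeasurableSet A) :
    Measurable fun Γ : State d => (Γ : Measure (Config d)).real A :=
  ((Measure.measurable_coe hA).comp measurable_subtype_coe).ennreal_toReal

lemma measurable_localProb (q : Finset (Site d) × Config d) : Measurable (localProb q) :=
  measurable_state_real (measurableSet_agree q)

lemma localProb_nonneg (q : Finset (Site d) × Config d) (Γ : State d) : 0 ≤ localProb q Γ :=
  measureReal_nonneg

lemma localProb_le_one (q : Finset (Site d) × Config d) (Γ : State d) : localProb q Γ ≤ 1 :=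
  measureReal_le_one

/-- The probability that independent replicas realize given local events. -/
noncomputable def replicaProb (L : List (Finset (Site d) × Config d)) (Γ : State d) : ℝ :=
  (L.map fun q => localProb q Γ).prod

lemma measurable_replicaProb (L : List (Finset (Site d) × Config d)) :
    Measurable (replicaProb L) := by
  induction L with
  | nil => exact measurable_const
  | cons q L ih =>
    have : replicaProb (q :: L) = fun Γ => localProb q Γ * replicaProb L Γ := by
      ext Γ; simp [replicaProb]
    rw [this]
    exact (measurable_localProb q).mul ih

lemma replicaProb_mem_Icc (L : List (Finset (Site d) × Config d)) (Γ : State d) :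
    replicaProb L Γ ∈ Set.Icc (0 : ℝ) 1 := by
  induction L with
  | nil => simp [replicaProb]
  | cons q L ih =>
    have : replicaProb (q :: L) Γ = localProb q Γ * replicaProb L Γ := by simp [replicaProb]
    rw [this]
    exact ⟨mul_nonneg (localProb_nonneg q Γ) ih.1,
      mul_le_one₀ (localProb_le_one q Γ) ih.1 ih.2⟩

lemma abs_replicaProb_le (L : List (Finset (Site d) × Config d)) (Γ : State d) :
    |replicaProb L Γ| ≤ 1 := by
  rw [abs_of_nonneg (replicaProb_mem_Icc L Γ).1]
  exact (replicaProb_mem_Icc L Γ).2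

/-! ### Finite-volume Gibbs measures as states -/

lemma sum_exp_pos (β : ℝ) (a b : Site d) (J : Couplings d) :
    0 < ∑ τ, Real.exp (-β * hamiltonian a b J τ) :=
  Finset.sum_pos (fun _ _ => Real.exp_pos _) Finset.univ_nonempty

lemma gibbs_nonneg (β : ℝ) (a b : Site d) (J : Couplings d) (τ) : 0 ≤ gibbs β a b J τ :=
  div_nonneg (Real.exp_pos _).le (sum_exp_pos β a b J).le

lemma sum_gibbs (β : ℝ) (a b : Site d) (J : Couplings d) : ∑ τ, gibbs β a b J τ = 1 := by
  unfold gibbs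
  rw [← Finset.sum_div]
  exact div_self (sum_exp_pos β a b J).ne'

lemma measurable_gibbs (β : ℝ) (a b : Site d) (τ) :
    Measurable fun J : Couplings d => gibbs β a b J τ := by
  have h : ∀ τ, Measurable fun J : Couplings d => hamiltonian a b J τ := fun τ =>
    (Finset.measurable_sum _ fun e _ => (measurable_pi_apply e).mul_const _).neg
  exact ((h τ).const_mul _).exp.div (Finset.measurable_sum _ fun τ' _ => ((h τ').const_mul _).exp)

/-- The periodic extension of a sample of the Gibbs measure of the box `[a, b]`. -/
noncomputable def gibbsState (β : ℝ) (a b : Site d) (J : Couplings d) : State d :=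
  ⟨∑ τ, ENNReal.ofReal (gibbs β a b J τ) • Measure.dirac (periodicExt a b τ), ⟨by
    simp only [Measure.coe_finsetSum, Finset.sum_apply, Measure.smul_apply, measure_univ,
      smul_eq_mul, mul_one]
    rw [← ENNReal.ofReal_sum_of_nonneg fun τ _ => gibbs_nonneg β a b J τ, sum_gibbs,
      ENNReal.ofReal_one]⟩⟩

lemma gibbsState_apply (β : ℝ) (a b : Site d) (J : Couplings d) {A : Set (Config d)}
    (hA : MeasurableSet A) : (gibbsState β a b J : Measure (Config d)) A =
      ∑ τ, ENNReal.ofReal (gibbs β a b J τ) * A.indicator 1 (periodicExt a b τ) := by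
  simp [gibbsState, Measure.coe_finsetSum, Measure.dirac_apply' _ hA]

lemma integral_gibbsState (β : ℝ) (a b : Site d) (J : Couplings d) (g : Config d → ℝ) :
    ∫ σ, g σ ∂(gibbsState β a b J : Measure (Config d)) =
      ∑ τ, gibbs β a b J τ * g (periodicExt a b τ) := by
  change ∫ σ, g σ ∂(∑ τ, ENNReal.ofReal (gibbs β a b J τ) • Measure.dirac (periodicExt a b τ)) = _
  rw [integral_finsetSum_measure fun τ _ =>
    (integrable_dirac enorm_lt_top).smul_measure ENNReal.ofReal_ne_top]
  refine Finset.sum_congr rfl fun τ _ => ?_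
  rw [integral_smul_measure, integral_dirac, ENNReal.toReal_ofReal (gibbs_nonneg β a b J τ),
    smul_eq_mul]

lemma gibbsState_real (β : ℝ) (a b : Site d) (J : Couplings d) {A : Set (Config d)}
    (hA : MeasurableSet A) : (gibbsState β a b J : Measure (Config d)).real A =
      ∑ τ, gibbs β a b J τ * A.indicator 1 (periodicExt a b τ) := by
  rw [← integral_indicator_one hA, integral_gibbsState]

lemma measurable_gibbsState (β : ℝ) (a b : Site d) : Measurable (gibbsState β a b) := by
  refine Measurable.subtype_mk (Measure.measurable_of_measurable_coe _ fun A hA => ?_)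
  change Measurable fun J => (gibbsState β a b J : Measure (Config d)) A
  rw [funext fun J => gibbsState_apply β a b J hA]
  exact Finset.measurable_sum Finset.univ fun τ _ =>
    (measurable_gibbs β a b τ).ennreal_ofReal.mul_const _

/-! ### Changing finitely many couplings -/

lemma perturbation_congr {W : Finset (Site d)} (K : edgesIn W → ℝ) {σ σ' : Config d}
    (h : ∀ x ∈ W, σ x = σ' x) : perturbation W K σ = perturbation W K σ' := by
  refine Finset.sum_congr rfl fun e _ => ?_
  have he := mem_edgesIn.1 e.2
  rw [bond, bond, h _ he.1, h _ he.2]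

/-- The couplings `J` with those inside `W` replaced by `J'`. -/
noncomputable def replaceCouplings (W : Finset (Site d)) (J : Couplings d) (J' : edgesIn W → ℝ) :
    Couplings d := fun e => if h : e ∈ edgesIn W then J' ⟨e, h⟩ else J e

lemma tilt_real (β : ℝ) (W : Finset (Site d)) (K : edgesIn W → ℝ) (Γ : State d)
    {A : Set (Config d)} (hA : MeasurableSet A) :
    (tilt β W K Γ : Measure (Config d)).real A =
      (∫ σ in A, Real.exp (β * perturbation W K σ) ∂(Γ : Measure (Config d))) /
        ∫ σ, Real.exp (β * perturbation W K σ) ∂(Γ : Measure (Config d)) := by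
  change ((Γ : Measure (Config d)).tilted _).real A = _
  rw [measureReal_def, tilted_apply_eq_ofReal_integral' _ hA, ENNReal.toReal_ofReal, integral_div]
  exact integral_nonneg fun σ => div_nonneg (Real.exp_pos _).le
    (integral_nonneg fun _ => (Real.exp_pos _).le)

/-- The Hamiltonian is linear in the couplings, and every edge inside W is an edge of the torus
because W lies in the box. The sign is the minus sign of the Hamiltonian. -/
lemma hamiltonian_replaceCouplings {W : Finset (Site d)} {a b : Site d} (hW : W ⊆ Finset.Icc a b)
    (J : Couplings d) (J' : edgesIn W → ℝ) (τ) :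
    hamiltonian a b (replaceCouplings W J J') τ =
      hamiltonian a b J τ - perturbation W (fun e => J' e - J e) (periodicExt a b τ) := by
  have hsub : edgesIn W ⊆ Finset.Icc a b ×ˢ (Finset.univ : Finset (Fin d)) := fun e he =>
    Finset.mem_product.2 ⟨hW (mem_edgesIn.1 he).1, Finset.mem_univ _⟩
  have h1 : perturbation W (fun e => J' e - J e) (periodicExt a b τ) =
      ∑ e ∈ Finset.Icc a b ×ˢ (Finset.univ : Finset (Fin d)),
        (replaceCouplings W J J' e - J e) * bond (periodicExt a b τ) e := by
    rw [← Finset.sum_subset hsub fun e _ he => by simp [replaceCouplings, he], perturbation,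
      ← Finset.sum_coe_sort (edgesIn W)]
    exact Finset.sum_congr rfl fun e _ => by simp [replaceCouplings]
  rw [h1, hamiltonian, hamiltonian]
  simp only [sub_mul, Finset.sum_sub_distrib]
  ring

/-- Changing the couplings in a window amounts to tilting the finite-volume Gibbs measure. -/
lemma gibbsState_replaceCouplings (β : ℝ) {W : Finset (Site d)} {a b : Site d}
    (hW : W ⊆ Finset.Icc a b) (J : Couplings d) (J' : edgesIn W → ℝ)
    {A : Set (Config d)} (hA : MeasurableSet A) :
    (gibbsState β a b (replaceCouplings W J J') : Measure (Config d)).real A =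
      (tilt β W (fun e => J' e - J e) (gibbsState β a b J) : Measure (Config d)).real A := by
  rw [tilt_real β W _ _ hA, ← integral_indicator hA, integral_gibbsState, integral_gibbsState,
    gibbsState_real _ _ _ _ hA]
  set h := fun τ => β * perturbation W (fun e => J' e - J e) (periodicExt a b τ) with hh
  set w := fun τ => Real.exp (-β * hamiltonian a b J τ) with hw
  have e1 : ∀ τ, Real.exp (-β * hamiltonian a b (replaceCouplings W J J') τ) =
      w τ * Real.exp (h τ) := fun τ => by
    rw [hamiltonian_replaceCouplings hW, ← Real.exp_add]
    congr 1
    simp only [hh]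
    ring
  have hZ := sum_exp_pos β a b J
  have hZ' := sum_exp_pos β a b (replaceCouplings W J J')
  simp only [e1] at hZ'
  -- The normalization of the tilt is the ratio of the new partition function to the old one.
  have e2 : ∑ τ, gibbs β a b J τ * Real.exp (h τ) = (∑ τ, w τ * Real.exp (h τ)) / ∑ τ, w τ := by
    rw [Finset.sum_div]
    exact Finset.sum_congr rfl fun τ _ => by simp only [gibbs, hw]; ring
  rw [e2, Finset.sum_div]
  refine Finset.sum_congr rfl fun τ _ => ?_
  simp only [gibbs, e1]
  change _ * _ = w τ / (∑ τ', w τ') * _ / _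
  have hZw : (∑ τ, w τ) ≠ 0 := hZ.ne'
  by_cases hτ : periodicExt a b τ ∈ A
  · simp only [Set.indicator_of_mem hτ, Pi.one_apply]
    change _ = w τ / (∑ τ', w τ') * Real.exp (h τ) / _
    field_simp
  · simp [Set.indicator_of_notMem hτ]

/-! ### Rotating the torus -/

lemma wrap_mem_Icc {a b : Site d} (hab : a ≤ b) (x : Site d) : wrap a b x ∈ Finset.Icc a b := by
  have hpos : ∀ k, 0 < b k - a k + 1 := fun k => by
    have : a k ≤ b k := hab k
    omega
  rw [Finset.mem_Icc]
  refine ⟨fun k => ?_, fun k => ?_⟩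
  · have := Int.emod_nonneg (x k - a k) (hpos k).ne'
    simp only [wrap]; omega
  · have := Int.emod_lt_of_pos (x k - a k) (hpos k)
    simp only [wrap]; omega

lemma wrap_eq_self {a b x : Site d} (hx : x ∈ Finset.Icc a b) : wrap a b x = x := by
  rw [Finset.mem_Icc] at hx
  ext k
  have h1 : a k ≤ x k := hx.1 k
  have h2 : x k ≤ b k := hx.2 k
  simp only [wrap]
  rw [Int.emod_eq_of_lt (by omega) (by omega)]
  omega

/-- Wrapping is reduction modulo the side lengths, hence compatible with addition. -/
lemma wrap_add_wrap {a b : Site d} (v x : Site d) :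
    wrap a b (v + wrap a b x) = wrap a b (v + x) := by
  ext k
  simp only [wrap, Pi.add_apply]
  congr 1
  rw [show v k + (a k + (x k - a k) % (b k - a k + 1)) - a k =
    v k + (x k - a k) % (b k - a k + 1) by ring,
    show v k + x k - a k = v k + (x k - a k) by ring]
  exact (Int.mod_modEq _ _).add_left _

lemma periodicExt_wrap (a b : Site d) (τ) (v x : Site d) :
    periodicExt a b τ (v + wrap a b x) = periodicExt a b τ (v + x) := by
  simp only [periodicExt, wrap_add_wrap]

/-- The rotation of the torus, as a map of the edges of `ℤ^d` which only moves the edges of the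
box. -/
noncomputable def rotateEdge (a b v : Site d) (e : Edge d) : Edge d :=
  if e.1 ∈ Finset.Icc a b then (wrap a b (v + e.1), e.2) else e

lemma wrap_add_injOn {a b : Site d} (v : Site d) :
    Set.InjOn (fun x => wrap a b (v + x)) (Finset.Icc a b : Finset (Site d)) := by
  intro x hx y hy h
  have h' : wrap a b (-v + wrap a b (v + x)) = wrap a b (-v + wrap a b (v + y)) := by
    simp only at h
    rw [h]
  rwa [wrap_add_wrap, wrap_add_wrap, neg_add_cancel_left, neg_add_cancel_left,
    wrap_eq_self hx, wrap_eq_self hy] at h'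

/-- With the identity outside the box, the rotation becomes an injection of all edges, to which
`measurePreserving_reindex` applies. -/
lemma rotateEdge_injective {a b : Site d} (hab : a ≤ b) (v : Site d) :
    Function.Injective (rotateEdge a b v) := by
  rintro ⟨x, k⟩ ⟨y, l⟩ h
  by_cases hx : x ∈ Finset.Icc a b <;> by_cases hy : y ∈ Finset.Icc a b <;>
    simp only [rotateEdge, hx, hy, if_true, if_false, Prod.mk.injEq] at h
  · exact Prod.ext (wrap_add_injOn v hx hy h.1) h.2
  · exact absurd (h.1 ▸ wrap_mem_Icc hab _) hy
  · exact absurd (h.1 ▸ wrap_mem_Icc hab _) hx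
  · exact Prod.ext h.1 h.2

/-- The rotation of the sites of the box. -/
noncomputable def rotateSite {a b : Site d} (hab : a ≤ b) (v : Site d) :
    Finset.Icc a b ≃ Finset.Icc a b :=
  Equiv.ofBijective (fun x => ⟨wrap a b (v + x), wrap_mem_Icc hab _⟩)
    (Finite.injective_iff_bijective.1 fun x y h =>
      Subtype.ext (wrap_add_injOn v x.2 y.2 (Subtype.ext_iff.1 h)))

lemma periodicExt_rotate {a b : Site d} (hab : a ≤ b) (v : Site d) (τ : Finset.Icc a b → Spin) :
    periodicExt a b (τ ∘ rotateSite hab v) = shift v (periodicExt a b τ) := by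
  ext1 x
  simp only [periodicExt, shift, wrap_mem_Icc hab, dif_pos, Function.comp_apply, rotateSite,
    Equiv.ofBijective_apply, wrap_add_wrap]

/-- The rotation permutes the torus edges, and a bond of a periodic configuration does not change
when its edge is wrapped. This is where the periodic boundary conditions are needed. -/
lemma hamiltonian_rotate {a b : Site d} (hab : a ≤ b) (v : Site d) (J : Couplings d)
    (τ : Finset.Icc a b → Spin) :
    hamiltonian a b (fun e => J (rotateEdge a b v e)) (τ ∘ rotateSite hab v) =
      hamiltonian a b J τ := by
  unfold hamiltonian
  congr 1
  have hmaps : ∀ e ∈ Finset.Icc a b ×ˢ (Finset.univ : Finset (Fin d)),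
      rotateEdge a b v e ∈ Finset.Icc a b ×ˢ (Finset.univ : Finset (Fin d)) := by
    intro e he
    rw [Finset.mem_product] at he ⊢
    simp [rotateEdge, he.1, wrap_mem_Icc hab, -Finset.mem_Icc]
  refine Finset.sum_nbij (rotateEdge a b v) hmaps (rotateEdge_injective hab v).injOn
    (Finset.surjOn_of_injOn_of_card_le _ hmaps (rotateEdge_injective hab v).injOn le_rfl) ?_
  intro e he
  congr 1
  rw [Finset.mem_product] at he
  rw [periodicExt_rotate, bond_shift, rotateEdge, if_pos he.1]
  have h0 : periodicExt a b τ (wrap a b (v + e.1)) = periodicExt a b τ (v + e.1) := by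
    simpa using periodicExt_wrap a b τ 0 (v + e.1)
  have h1 : ∀ z, periodicExt a b τ (wrap a b (v + e.1) + z) = periodicExt a b τ (v + e.1 + z) := by
    intro z
    rw [add_comm, periodicExt_wrap, add_comm]
  simp only [bond, Edge.tip, h0, h1]

lemma gibbsState_rotate (β : ℝ) {a b : Site d} (hab : a ≤ b) (v : Site d) (J : Couplings d)
    {A : Set (Config d)} (hA : MeasurableSet A) :
    (gibbsState β a b (fun e => J (rotateEdge a b v e)) : Measure (Config d)).real A =
      (gibbsState β a b J : Measure (Config d)).real (shift v ⁻¹' A) := by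
  set ψ : (Finset.Icc a b → Spin) ≃ (Finset.Icc a b → Spin) :=
    (rotateSite hab v).symm.arrowCongr (Equiv.refl Spin) with hψ
  have hψ' : ∀ τ, ψ τ = τ ∘ rotateSite hab v := fun τ => by
    ext1 x; simp [hψ, Equiv.arrowCongr]
  have hg : ∀ τ, gibbs β a b (fun e => J (rotateEdge a b v e)) (ψ τ) = gibbs β a b J τ := by
    intro τ
    unfold gibbs
    rw [← ψ.sum_comp]
    simp only [hψ', hamiltonian_rotate]
  rw [gibbsState_real _ _ _ _ hA, gibbsState_real _ _ _ _ (measurable_shift v hA), ← ψ.sum_comp]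
  refine Finset.sum_congr rfl fun τ _ => ?_
  rw [hg, hψ', periodicExt_rotate]
  rfl

end EdwardsAnderson

namespace EdwardsAnderson

variable {d : ℕ}

/-! ### Convergence of tilted states -/

/-- The error `c M` does not depend on n, so the limits in n and M can be exchanged. -/
lemma tendsto_of_uniform_approx {u : ℕ → ℝ} {l : ℝ} {v : ℕ → ℕ → ℝ} {w c : ℕ → ℝ}
    (hv : ∀ M, Tendsto (v M) atTop (𝓝 (w M))) (hu : ∀ M n, |u n - v M n| ≤ c M)
    (hl : ∀ M, |l - w M| ≤ c M) (hc : Tendsto c atTop (𝓝 0)) : Tendsto u atTop (𝓝 l) := by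
  rw [Metric.tendsto_atTop]
  intro ε hε
  obtain ⟨M, hM⟩ := (hc.eventually (gt_mem_nhds (show 0 < ε / 4 by positivity))).exists
  obtain ⟨N, hN⟩ := Metric.tendsto_atTop.1 (hv M) (ε / 4) (by positivity)
  refine ⟨N, fun n hn => ?_⟩
  have h1 := hN n hn
  have h2 := hu M n
  have h3 := hl M
  rw [Real.dist_eq] at h1 ⊢
  rw [abs_lt] at *
  rw [abs_le] at h2 h3
  constructor <;> linarith [h1.1, h1.2, h2.1, h2.2, h3.1, h3.2]

/-! ### Tilted states and normalized Boltzmann weights. -/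

section Tilt

/-- The kernel which samples a configuration from a state. -/
noncomputable def stateKernel (d : ℕ) : Kernel (State d) (Config d) :=
  ⟨fun Γ => (Γ : Measure (Config d)), measurable_subtype_coe⟩

instance : IsMarkovKernel (stateKernel d) :=
  ⟨fun Γ => inferInstanceAs (IsProbabilityMeasure (Γ : Measure (Config d)))⟩

lemma continuous_perturbation (W : Finset (Site d)) (σ : Config d) :
    Continuous fun K : edgesIn W → ℝ => perturbation W K σ := by
  unfold perturbation
  fun_prop

lemma measurable_perturbation_prod (W : Finset (Site d)) :
    Measurable fun p : (edgesIn W → ℝ) × Config d => perturbation W p.1 p.2 :=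
  Finset.measurable_sum _ fun e _ => ((measurable_pi_apply e).comp measurable_fst).mul
    ((measurable_bond e.1).comp measurable_snd)

/-- Tilting is jointly measurable in the perturbation and the state. -/
lemma measurable_tilt_prod (β : ℝ) (W : Finset (Site d)) :
    Measurable fun p : (edgesIn W → ℝ) × State d => tilt β W p.1 p.2 := by
  refine Measurable.subtype_mk (Measure.measurable_of_measurable_coe _ fun A hA => ?_)
  have hm : Measurable fun p : (edgesIn W → ℝ) × Config d =>
      Real.exp (β * perturbation W p.1 p.2) :=
    ((measurable_perturbation_prod W).const_mul β).exp
  have hint : ∀ B : Set (Config d), MeasurableSet B →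
      Measurable fun p : (edgesIn W → ℝ) × State d =>
        ∫ σ in B, Real.exp (β * perturbation W p.1 σ) ∂(p.2 : Measure (Config d)) := by
    intro B hB
    have h1 : StronglyMeasurable fun q : ((edgesIn W → ℝ) × State d) × Config d =>
        B.indicator (fun σ => Real.exp (β * perturbation W q.1.1 σ)) q.2 := by
      have h2 : Measurable fun q : ((edgesIn W → ℝ) × State d) × Config d =>
          Real.exp (β * perturbation W q.1.1 q.2) :=
        hm.comp ((measurable_fst.comp measurable_fst).prodMk measurable_snd)
      exact (h2.indicator (measurable_snd hB)).stronglyMeasurable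
    have h4 := h1.integral_kernel_prod_right' (κ := (stateKernel d).comap Prod.snd measurable_snd)
    convert h4.measurable using 2 with p
    rw [← integral_indicator hB]
    rfl
  have key : ∀ p : (edgesIn W → ℝ) × State d, (tilt β W p.1 p.2 : Measure (Config d)) A =
      ENNReal.ofReal ((∫ σ in A, Real.exp (β * perturbation W p.1 σ) ∂(p.2 : Measure (Config d))) /
        ∫ σ in Set.univ, Real.exp (β * perturbation W p.1 σ) ∂(p.2 : Measure (Config d))) := by
    intro p
    rw [Measure.restrict_univ, ← tilt_real β W p.1 p.2 hA, ofReal_measureReal]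
  change Measurable fun p : (edgesIn W → ℝ) × State d =>
    (tilt β W p.1 p.2 : Measure (Config d)) A
  simp only [key]
  exact ((hint A hA).div (hint _ MeasurableSet.univ)).ennreal_ofReal

lemma measurable_tilt_comp {X : Type*} [MeasurableSpace X] (β : ℝ) (W : Finset (Site d))
    {K : X → edgesIn W → ℝ} (hK : Measurable K) :
    Measurable fun x : X × State d => tilt β W (K x.1) x.2 := by
  have hpair : Measurable fun x : X × State d => (K x.1, x.2) :=
    (hK.comp measurable_fst).prodMk measurable_snd
  have h := (measurable_tilt_prod (d := d) β W).comp hpair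
  exact h

lemma abs_mul_perturbation_le (β : ℝ) (W : Finset (Site d)) (K : edgesIn W → ℝ) (σ : Config d) :
    |β * perturbation W K σ| ≤ |β| * ∑ e, |K e| := by
  rw [abs_mul]
  refine mul_le_mul_of_nonneg_left ?_ (abs_nonneg _)
  refine (Finset.abs_sum_le_sum_abs _ _).trans (Finset.sum_le_sum fun e _ => ?_)
  rw [abs_mul, abs_bond, mul_one]

/-- The Boltzmann weight of a perturbation, normalized to be at most one. -/
noncomputable def weight (β : ℝ) (W : Finset (Site d)) (K : edgesIn W → ℝ) (σ : Config d) : ℝ :=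
  Real.exp (β * perturbation W K σ - |β| * ∑ e, |K e|)

/-- A lower bound of `weight`. -/
noncomputable def weightBound (β : ℝ) (W : Finset (Site d)) (K : edgesIn W → ℝ) : ℝ :=
  Real.exp (-(2 * (|β| * ∑ e, |K e|)))

lemma weight_pos (β : ℝ) (W : Finset (Site d)) (K : edgesIn W → ℝ) (σ : Config d) :
    0 < weight β W K σ := Real.exp_pos _

lemma weight_le_one (β : ℝ) (W : Finset (Site d)) (K : edgesIn W → ℝ) (σ : Config d) :
    weight β W K σ ≤ 1 := by
  rw [weight, Real.exp_le_one_iff]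
  linarith [(abs_le.1 (abs_mul_perturbation_le β W K σ)).2]

lemma abs_weight_le_one (β : ℝ) (W : Finset (Site d)) (K : edgesIn W → ℝ) (σ : Config d) :
    |weight β W K σ| ≤ 1 := by
  rw [abs_of_pos (weight_pos β W K σ)]
  exact weight_le_one β W K σ

lemma weightBound_le_weight (β : ℝ) (W : Finset (Site d)) (K : edgesIn W → ℝ) (σ : Config d) :
    weightBound β W K ≤ weight β W K σ := by
  rw [weight, weightBound, Real.exp_le_exp]
  linarith [(abs_le.1 (abs_mul_perturbation_le β W K σ)).1]

/-- The ratio of the geometric series for the inverse partition function; it depends on K but not on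
the state. -/
lemma one_sub_weightBound_mem_Ico (β : ℝ) (W : Finset (Site d)) (K : edgesIn W → ℝ) :
    1 - weightBound β W K ∈ Set.Ico (0 : ℝ) 1 := by
  have h1 : 0 < weightBound β W K := Real.exp_pos _
  have h2 := (weightBound_le_weight β W K fun _ => 1).trans (weight_le_one β W K fun _ => 1)
  exact ⟨by linarith, by linarith⟩

lemma continuous_weight (β : ℝ) (W : Finset (Site d)) (σ : Config d) :
    Continuous fun K : edgesIn W → ℝ => weight β W K σ := by
  have := continuous_perturbation W σ
  unfold weight
  fun_prop

lemma continuous_weightBound (β : ℝ) (W : Finset (Site d)) :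
    Continuous fun K : edgesIn W → ℝ => weightBound β W K := by
  unfold weightBound
  fun_prop

lemma weight_congr (β : ℝ) {W : Finset (Site d)} (K : edgesIn W → ℝ) {σ σ' : Config d}
    (h : ∀ x ∈ W, σ x = σ' x) : weight β W K σ = weight β W K σ' := by
  rw [weight, weight, perturbation_congr K h]

lemma measurable_weight (β : ℝ) (W : Finset (Site d)) (K : edgesIn W → ℝ) :
    Measurable (weight β W K) :=
  (((measurable_perturbation W K).const_mul β).sub_const _).exp

lemma integrable_weight (β : ℝ) (W : Finset (Site d)) (K : edgesIn W → ℝ) (Γ : State d) :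
    Integrable (weight β W K) (Γ : Measure (Config d)) :=
  Integrable.of_bound (measurable_weight β W K).aestronglyMeasurable 1 (ae_of_all _ fun σ =>
    abs_weight_le_one β W K σ)

/-- The constant that normalizes `weight` cancels in the quotient. -/
lemma localProb_tilt (β : ℝ) (W : Finset (Site d)) (K : edgesIn W → ℝ) (Γ : State d)
    (q : Finset (Site d) × Config d) :
    localProb q (tilt β W K Γ) =
      (∫ σ, (agree q).indicator (weight β W K) σ ∂(Γ : Measure (Config d))) /
        ∫ σ, weight β W K σ ∂(Γ : Measure (Config d)) := by
  rw [localProb, tilt_real β W K Γ (measurableSet_agree q),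
    integral_indicator (measurableSet_agree q)]
  simp only [weight, Real.exp_sub]
  rw [integral_div, integral_div, div_div_div_cancel_right₀ (Real.exp_ne_zero _)]

end Tilt

/-! ### The algebra of local observables of states. -/

section Algebra

variable {Ω : Type*} [TopologicalSpace Ω]

/-- The algebra of functions of `(ω, Γ)` generated by bounded continuous functions of `ω` and the
probabilities of local events under `Γ`. -/
noncomputable def localAlgebra (Ω : Type*) [TopologicalSpace Ω] (d : ℕ) :
    Subalgebra ℝ (Ω × State d → ℝ) :=
  Algebra.adjoin ℝ (Set.range (fun (f : Ω →ᵇ ℝ) (x : Ω × State d) => f x.1) ∪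
    Set.range fun q (x : Ω × State d) => localProb q x.2)

lemma mem_localAlgebra_of_bcf (f : Ω →ᵇ ℝ) :
    (fun x : Ω × State d => f x.1) ∈ localAlgebra Ω d :=
  Algebra.subset_adjoin (Or.inl ⟨f, rfl⟩)

lemma localProb_mem_localAlgebra (q : Finset (Site d) × Config d) :
    (fun x : Ω × State d => localProb q x.2) ∈ localAlgebra Ω d :=
  Algebra.subset_adjoin (Or.inr ⟨q, rfl⟩)

lemma list_prod_mem_localAlgebra {α : Type*} (L : List α) {g : α → Ω × State d → ℝ}
    (hg : ∀ q, g q ∈ localAlgebra Ω d) :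
    (fun x => (L.map fun q => g q x).prod) ∈ localAlgebra Ω d := by
  induction L with
  | nil => exact (localAlgebra Ω d).one_mem
  | cons q L ih =>
    simp only [List.map_cons, List.prod_cons]
    exact (localAlgebra Ω d).mul_mem (hg q) ih

/-- A property of functions which is linear and holds for all monomials holds on the algebra. -/
lemma localAlgebra_induction {p : (Ω × State d → ℝ) → Prop}
    (hmono : ∀ (f : Ω →ᵇ ℝ) L, p fun x => f x.1 * replicaProb L x.2)
    (hadd : ∀ g h, p g → p h → p (g + h)) (hsmul : ∀ (c : ℝ) g, p g → p (c • g))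
    {g : Ω × State d → ℝ} (hg : g ∈ localAlgebra Ω d) : p g := by
  have hg' : g ∈ Subalgebra.toSubmodule (localAlgebra Ω d) := hg
  rw [localAlgebra, Algebra.adjoin_eq_span] at hg'
  -- Products of generators are monomials: bounded continuous functions multiply, and lists of local
  -- events concatenate.
  have hclos : ∀ g ∈ Submonoid.closure
      (Set.range (fun (f : Ω →ᵇ ℝ) (x : Ω × State d) => f x.1) ∪
        Set.range fun q (x : Ω × State d) => localProb q x.2),
      ∃ (f : Ω →ᵇ ℝ) (L : _), g = fun x => f x.1 * replicaProb L x.2 := by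
    intro g hg
    induction hg using Submonoid.closure_induction with
    | mem g hg =>
      rcases hg with ⟨f, rfl⟩ | ⟨q, rfl⟩
      · exact ⟨f, [], by simp [replicaProb]⟩
      · exact ⟨1, [q], by simp [replicaProb]⟩
    | one => exact ⟨1, [], by ext; simp [replicaProb]⟩
    | mul g h _ _ hg hh =>
      obtain ⟨f, L, rfl⟩ := hg
      obtain ⟨f', L', rfl⟩ := hh
      refine ⟨f * f', L ++ L', ?_⟩
      ext x
      simp only [replicaProb, Pi.mul_apply, BoundedContinuousFunction.mul_apply, List.map_append,
        List.prod_append]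
      ring
  clear hg
  induction hg' using Submodule.span_induction with
  | mem g hg =>
    obtain ⟨f, L, rfl⟩ := hclos g hg
    exact hmono f L
  | zero =>
    have := hsmul 0 _ (hmono 0 [])
    rwa [zero_smul] at this
  | add g h _ _ ihg ihh => exact hadd g h ihg ihh
  | smul c g _ ih => exact hsmul c g ih

/-- The expectation under `Γ` of a local function depending continuously on a parameter. -/
lemma integral_mem_localAlgebra {U : Finset (Site d)} {Φ : Ω → Config d → ℝ}
    (hcont : ∀ σ, Continuous fun ω => Φ ω σ) {C : ℝ} (hC : ∀ ω σ, |Φ ω σ| ≤ C)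
    (hloc : ∀ ω σ σ', (∀ x ∈ U, σ x = σ' x) → Φ ω σ = Φ ω σ') :
    (fun x : Ω × State d => ∫ σ, Φ x.1 σ ∂(x.2 : Measure (Config d))) ∈ localAlgebra Ω d := by
  classical
  set ext : (U → Spin) → Config d := fun τ x => if h : x ∈ U then τ ⟨x, h⟩ else 1 with hext
  have hext' : ∀ τ (x : U), ext τ x = τ x := fun τ x => by simp [hext]
  set fc : (U → Spin) → Ω →ᵇ ℝ := fun τ =>
    BoundedContinuousFunction.ofNormedAddCommGroup (fun ω => Φ ω (ext τ)) (hcont _) C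
      fun ω => hC _ _
  -- Expansion over the finitely many patterns in U; only the pattern of σ itself contributes.
  have hsum : ∀ ω σ, Φ ω σ =
      ∑ τ : U → Spin, Φ ω (ext τ) * (agree (U, ext τ)).indicator (1 : Config d → ℝ) σ := by
    intro ω σ
    rw [Finset.sum_eq_single fun x : U => σ x]
    · have h1 : σ ∈ agree (U, ext fun x : U => σ x) := fun x hx =>
        (hext' (fun x : U => σ x) ⟨x, hx⟩).symm
      rw [Set.indicator_of_mem h1, Pi.one_apply, mul_one]
      exact hloc _ _ _ h1
    · intro τ _ hτ
      rw [Set.indicator_of_notMem, mul_zero]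
      intro h1
      refine hτ (funext fun x => ?_)
      rw [← hext' τ x]
      exact (h1 x x.2).symm
    · simp
  have : (fun x : Ω × State d => ∫ σ, Φ x.1 σ ∂(x.2 : Measure (Config d))) =
      ∑ τ : U → Spin, (fun x : Ω × State d => fc τ x.1) *
        fun x : Ω × State d => localProb (U, ext τ) x.2 := by
    ext x
    rw [Finset.sum_apply]
    have hint : ∀ τ, Integrable (fun σ => Φ x.1 (ext τ) *
        (agree (U, ext τ)).indicator (1 : Config d → ℝ) σ) (x.2 : Measure (Config d)) := fun τ =>
      ((integrable_const (1 : ℝ)).indicator (measurableSet_agree _)).const_mul _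
    rw [integral_congr_ae (ae_of_all _ (hsum x.1)), integral_finsetSum _ fun τ _ => hint τ]
    refine Finset.sum_congr rfl fun τ _ => ?_
    rw [integral_const_mul, integral_indicator_one (measurableSet_agree _)]
    rfl
  rw [this]
  exact sum_mem fun τ _ => (localAlgebra Ω d).mul_mem (mem_localAlgebra_of_bcf (fc τ))
    (localProb_mem_localAlgebra _)

lemma integral_weight_mem_localAlgebra (β : ℝ) (W : Finset (Site d)) {K : Ω → edgesIn W → ℝ}
    (hK : Continuous K) :
    (fun x : Ω × State d => ∫ σ, weight β W (K x.1) σ ∂(x.2 : Measure (Config d))) ∈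
      localAlgebra Ω d := by
  refine integral_mem_localAlgebra (U := W) (C := 1) (Φ := fun ω σ => weight β W (K ω) σ)
    (fun σ => (continuous_weight β W σ).comp hK) (fun ω σ => abs_weight_le_one β W _ σ) fun ω σ σ' h =>
    weight_congr β _ h

lemma integral_indicator_weight_mem_localAlgebra (β : ℝ) (W : Finset (Site d))
    {K : Ω → edgesIn W → ℝ} (hK : Continuous K) (q : Finset (Site d) × Config d) :
    (fun x : Ω × State d =>
      ∫ σ, (agree q).indicator (weight β W (K x.1)) σ ∂(x.2 : Measure (Config d))) ∈
      localAlgebra Ω d := by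
  classical
  refine integral_mem_localAlgebra (U := q.1 ∪ W) (C := 1)
    (Φ := fun ω σ => (agree q).indicator (weight β W (K ω)) σ) (fun σ => ?_) (fun ω σ => ?_)
    fun ω σ σ' h => ?_
  · by_cases hσ : σ ∈ agree q
    · simp only [Set.indicator_of_mem hσ]
      exact (continuous_weight β W σ).comp hK
    · simp only [Set.indicator_of_notMem hσ]
      exact continuous_const
  · by_cases hσ : σ ∈ agree q
    · rw [Set.indicator_of_mem hσ]
      exact abs_weight_le_one β W _ σ
    · rw [Set.indicator_of_notMem hσ]
      simp
  · have h1 : σ ∈ agree q ↔ σ' ∈ agree q :=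
      forall₂_congr fun x hx => by rw [h x (Finset.mem_union_left _ hx)]
    have h2 := weight_congr β (K ω) (σ := σ) (σ' := σ') fun x hx => h x (Finset.mem_union_right _ hx)
    by_cases hσ : σ ∈ agree q
    · rw [Set.indicator_of_mem hσ, Set.indicator_of_mem (h1.1 hσ), h2]
    · rw [Set.indicator_of_notMem hσ, Set.indicator_of_notMem fun h => hσ (h1.2 h)]

/-- The polynomial approximation of the probabilities of local events under a tilted state. -/
noncomputable def tiltApprox (β : ℝ) (W : Finset (Site d)) (M : ℕ)
    (L : List (Finset (Site d) × Config d)) (K : edgesIn W → ℝ) (Γ : State d) : ℝ :=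
  (L.map fun q => (∫ σ, (agree q).indicator (weight β W K) σ ∂(Γ : Measure (Config d))) *
    ∑ i ∈ Finset.range M, (1 - ∫ σ, weight β W K σ ∂(Γ : Measure (Config d))) ^ i).prod

/-- Dividing by the partition function Z is the only operation of a tilt that leaves the algebra. It
is replaced by the polynomial ∑_{i < M} (1 - Z)^i, a truncation of the series for 1 / Z. -/
lemma tiltApprox_mem_localAlgebra (β : ℝ) (W : Finset (Site d)) (M : ℕ)
    (L : List (Finset (Site d) × Config d)) {K : Ω → edgesIn W → ℝ} (hK : Continuous K) :
    (fun x : Ω × State d => tiltApprox β W M L (K x.1) x.2) ∈ localAlgebra Ω d := by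
  set Z : Ω × State d → ℝ := fun x => ∫ σ, weight β W (K x.1) σ ∂(x.2 : Measure (Config d)) with hZ
  have h1 : 1 - Z ∈ localAlgebra Ω d :=
    (localAlgebra Ω d).sub_mem (localAlgebra Ω d).one_mem (integral_weight_mem_localAlgebra β W hK)
  have h2 : (∑ i ∈ Finset.range M, (1 - Z) ^ i) ∈ localAlgebra Ω d :=
    sum_mem fun i _ => (localAlgebra Ω d).pow_mem h1 i
  have h3 : (fun x => ∑ i ∈ Finset.range M, (1 - Z x) ^ i) ∈ localAlgebra Ω d := by
    have : (fun x => ∑ i ∈ Finset.range M, (1 - Z x) ^ i) = ∑ i ∈ Finset.range M, (1 - Z) ^ i := by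
      ext x
      rw [Finset.sum_apply]
      rfl
    rw [this]
    exact h2
  exact list_prod_mem_localAlgebra L fun q =>
    (localAlgebra Ω d).mul_mem (integral_indicator_weight_mem_localAlgebra β W hK q) h3

end Algebra

end EdwardsAnderson

namespace EdwardsAnderson

variable {d : ℕ}

/-! ### From convergence of moments to convergence under tilting. -/

section Convergence

variable {Ω : Type*} [TopologicalSpace Ω] [MeasurableSpace Ω] [OpensMeasurableSpace Ω]

/-- Convergence for monomials implies convergence for the algebra they generate. -/
lemma tendsto_integral_of_mem_localAlgebra {m : Measure Ω} [IsProbabilityMeasure m]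
    {G : ℕ → Ω → State d} (hG : ∀ n, Measurable (G n)) {P : Measure (Ω × State d)}
    [IsProbabilityMeasure P]
    (H : ∀ L (f : Ω →ᵇ ℝ), Tendsto (fun n => ∫ ω, f ω * replicaProb L (G n ω) ∂m) atTop
      (𝓝 (∫ x, f x.1 * replicaProb L x.2 ∂P)))
    {g : Ω × State d → ℝ} (hg : g ∈ localAlgebra Ω d) :
    Measurable g ∧ (∃ C, ∀ x, |g x| ≤ C) ∧
      Tendsto (fun n => ∫ ω, g (ω, G n ω) ∂m) atTop (𝓝 (∫ x, g x ∂P)) := by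
  have hint : ∀ {g : Ω × State d → ℝ}, Measurable g → (∃ C, ∀ x, |g x| ≤ C) →
      Integrable g P ∧ ∀ n, Integrable (fun ω => g (ω, G n ω)) m := by
    rintro g hm ⟨C, hC⟩
    exact ⟨Integrable.of_bound hm.aestronglyMeasurable C (ae_of_all _ hC), fun n =>
      Integrable.of_bound (hm.comp (measurable_id.prodMk (hG n))).aestronglyMeasurable C
        (ae_of_all _ fun ω => hC _)⟩
  refine localAlgebra_induction (p := fun g => Measurable g ∧ (∃ C, ∀ x, |g x| ≤ C) ∧
      Tendsto (fun n => ∫ ω, g (ω, G n ω) ∂m) atTop (𝓝 (∫ x, g x ∂P))) ?_ ?_ ?_ hg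
  · intro f L
    refine ⟨(f.continuous.measurable.comp measurable_fst).mul
      ((measurable_replicaProb L).comp measurable_snd), ⟨‖f‖ * 1, fun x => ?_⟩, H L f⟩
    rw [abs_mul]
    exact mul_le_mul (f.norm_coe_le_norm x.1) (abs_replicaProb_le L x.2) (abs_nonneg _)
      (norm_nonneg _)
  · rintro g h ⟨hg1, hg2, hg3⟩ ⟨hh1, hh2, hh3⟩
    refine ⟨hg1.add hh1, ?_, ?_⟩
    · obtain ⟨C, hC⟩ := hg2
      obtain ⟨C', hC'⟩ := hh2
      exact ⟨C + C', fun x => (abs_add_le _ _).trans (add_le_add (hC x) (hC' x))⟩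
    · have := hg3.add hh3
      rw [← integral_add (hint hg1 hg2).1 (hint hh1 hh2).1] at this
      refine this.congr fun n => ?_
      rw [← integral_add ((hint hg1 hg2).2 n) ((hint hh1 hh2).2 n)]
      rfl
  · rintro c g ⟨hg1, hg2, hg3⟩
    refine ⟨hg1.const_smul c, ?_, ?_⟩
    · obtain ⟨C, hC⟩ := hg2
      refine ⟨|c| * C, fun x => ?_⟩
      rw [Pi.smul_apply, smul_eq_mul, abs_mul]
      exact mul_le_mul_of_nonneg_left (hC x) (abs_nonneg _)
    · have := hg3.const_mul c
      rw [← integral_const_mul] at this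
      refine this.congr fun n => ?_
      rw [← integral_const_mul]
      rfl

/-- Each truncated factor is the exact one times 1 - (1 - Z)^M, so the product is the exact one
times a power of this number; Bernoulli's inequality bounds the loss. -/
lemma abs_replicaProb_tilt_sub_tiltApprox_le (β : ℝ) (W : Finset (Site d)) (M : ℕ)
    (L : List (Finset (Site d) × Config d)) (K : edgesIn W → ℝ) (Γ : State d) :
    |replicaProb L (tilt β W K Γ) - tiltApprox β W M L K Γ| ≤
      L.length * (1 - weightBound β W K) ^ M := by
  set Z := ∫ σ, weight β W K σ ∂(Γ : Measure (Config d)) with hZ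
  have hδ : 0 < weightBound β W K := Real.exp_pos _
  have hZδ : weightBound β W K ≤ Z := by
    have := integral_mono (integrable_const (weightBound β W K)) (integrable_weight β W K Γ)
      (weightBound_le_weight β W K)
    simpa using this
  have hZ1 : Z ≤ 1 := by
    have := integral_mono (integrable_weight β W K Γ) (integrable_const (1 : ℝ))
      (weight_le_one β W K)
    simpa using this
  have hZ0 : Z ≠ 0 := (hδ.trans_le hZδ).ne'
  set ε := (1 - Z) ^ M with hε
  have hε0 : 0 ≤ ε := pow_nonneg (by linarith) _
  have hε1 : ε ≤ 1 := pow_le_one₀ (by linarith) (by linarith)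
  have h1 : tiltApprox β W M L K Γ = replicaProb L (tilt β W K Γ) * (1 - ε) ^ L.length := by
    unfold tiltApprox replicaProb
    rw [← hZ]
    induction L with
    | nil => simp
    | cons q L ih =>
      simp only [List.map_cons, List.prod_cons, ih, List.length_cons, pow_succ]
      have hgeom : Z * ∑ i ∈ Finset.range M, (1 - Z) ^ i = 1 - ε := by
        have := mul_neg_geom_sum (1 - Z) M
        rwa [sub_sub_cancel] at this
      have hgeom' : ∑ i ∈ Finset.range M, (1 - Z) ^ i = (1 - ε) / Z := by
        rw [← hgeom]; field_simp
      rw [hgeom', localProb_tilt, ← hZ]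
      ring
  have h2 := replicaProb_mem_Icc L (tilt β W K Γ)
  have h3 : (1 - ε) ^ L.length ≤ 1 := pow_le_one₀ (by linarith) (by linarith)
  have h4 : 1 - L.length * ε ≤ (1 - ε) ^ L.length := by
    have := one_add_mul_le_pow (a := -ε) (by linarith) L.length
    calc 1 - L.length * ε = 1 + L.length * -ε := by ring
      _ ≤ (1 + -ε) ^ L.length := this
      _ = _ := by ring
  have h5 : ε ≤ (1 - weightBound β W K) ^ M := pow_le_pow_left₀ (by linarith) (by linarith) _
  have h6 : (L.length : ℝ) * ε ≤ L.length * (1 - weightBound β W K) ^ M := by gcongr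
  rw [h1, show ∀ p t : ℝ, p - p * t = p * (1 - t) by intros; ring,
    abs_of_nonneg (mul_nonneg h2.1 (by linarith))]
  calc _ ≤ 1 * (1 - (1 - ε) ^ L.length) := mul_le_mul_of_nonneg_right h2.2 (by linarith)
    _ ≤ _ := by linarith

/-- Convergence is preserved by approximation, uniformly in the state and pointwise in the
parameter. -/
lemma tendsto_integral_of_approx {m : Measure Ω} [IsProbabilityMeasure m]
    {G : ℕ → Ω → State d} (hG : ∀ n, Measurable (G n)) {P : Measure (Ω × State d)}
    [IsProbabilityMeasure P] (hP : P.map Prod.fst = m)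
    (H : ∀ L (f : Ω →ᵇ ℝ), Tendsto (fun n => ∫ ω, f ω * replicaProb L (G n ω) ∂m) atTop
      (𝓝 (∫ x, f x.1 * replicaProb L x.2 ∂P)))
    {g : Ω × State d → ℝ} (hg : Measurable g) {C : ℝ} (hgC : ∀ x, |g x| ≤ C)
    {h : ℕ → Ω × State d → ℝ} (hh : ∀ M, h M ∈ localAlgebra Ω d)
    {e : ℕ → Ω → ℝ} (hem : ∀ M, Measurable (e M)) {D : ℝ} (heD : ∀ M ω, |e M ω| ≤ D)
    (hdiff : ∀ M x, |g x - h M x| ≤ e M x.1) (he : ∀ ω, Tendsto (fun M => e M ω) atTop (𝓝 0)) :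
    Tendsto (fun n => ∫ ω, g (ω, G n ω) ∂m) atTop (𝓝 (∫ x, g x ∂P)) := by
  have hgood := fun M => tendsto_integral_of_mem_localAlgebra hG H (hh M)
  have hei : ∀ M, Integrable (e M) m := fun M =>
    Integrable.of_bound (hem M).aestronglyMeasurable _ (ae_of_all _ (heD M))
  have hlim : Tendsto (fun M => ∫ ω, e M ω ∂m) atTop (𝓝 0) := by
    have := tendsto_integral_of_dominated_convergence (μ := m) (F := e) (f := fun _ => (0 : ℝ))
      (fun _ => D) (fun M => (hem M).aestronglyMeasurable) (integrable_const _)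
      (fun M => ae_of_all _ (heD M)) (ae_of_all _ he)
    simpa using this
  -- The error depends on ω alone, and ω has law m both along the sequence and under P; its integral
  -- therefore bounds all the differences at once.
  refine tendsto_of_uniform_approx (fun M => (hgood M).2.2) (fun M n => ?_) (fun M => ?_) hlim
  · have hpair : Measurable fun ω => (ω, G n ω) := measurable_id.prodMk (hG n)
    obtain ⟨C', hC'⟩ := (hgood M).2.1
    rw [← integral_sub]
    · rw [← Real.norm_eq_abs]
      refine norm_integral_le_of_norm_le (hei M) (ae_of_all _ fun ω => ?_)
      exact hdiff M (ω, G n ω)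
    · exact Integrable.of_bound (hg.comp hpair).aestronglyMeasurable C
        (ae_of_all _ fun ω => hgC (ω, G n ω))
    · exact Integrable.of_bound ((hgood M).1.comp hpair).aestronglyMeasurable C'
        (ae_of_all _ fun ω => hC' _)
  · obtain ⟨C', hC'⟩ := (hgood M).2.1
    have hfst : ∫ ω, e M ω ∂m = ∫ x, e M x.1 ∂P := by
      rw [← hP, integral_map measurable_fst.aemeasurable (hem M).aestronglyMeasurable]
    rw [hfst, ← integral_sub]
    · rw [← Real.norm_eq_abs]
      refine norm_integral_le_of_norm_le (g := fun x : Ω × State d => e M x.1) ?_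
        (ae_of_all _ fun x => ?_)
      swap
      · exact hdiff M x
      exact Integrable.of_bound ((hem M).comp measurable_fst).aestronglyMeasurable _
        (ae_of_all _ fun x => heD M x.1)
    · exact Integrable.of_bound hg.aestronglyMeasurable C (ae_of_all _ hgC)
    · exact Integrable.of_bound (hgood M).1.aestronglyMeasurable C' (ae_of_all _ hC')

/-- Convergence of the law of the states implies convergence of the law of the tilted states. -/
lemma tendsto_integral_tilt {m : Measure Ω} [IsProbabilityMeasure m]
    {G : ℕ → Ω → State d} (hG : ∀ n, Measurable (G n)) {P : Measure (Ω × State d)}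
    [IsProbabilityMeasure P] (hP : P.map Prod.fst = m)
    (H : ∀ L (f : Ω →ᵇ ℝ), Tendsto (fun n => ∫ ω, f ω * replicaProb L (G n ω) ∂m) atTop
      (𝓝 (∫ x, f x.1 * replicaProb L x.2 ∂P)))
    (β : ℝ) (W : Finset (Site d)) {K : Ω → edgesIn W → ℝ} (hK : Continuous K)
    (L : List (Finset (Site d) × Config d)) (f : Ω →ᵇ ℝ) :
    Tendsto (fun n => ∫ ω, f ω * replicaProb L (tilt β W (K ω) (G n ω)) ∂m) atTop
      (𝓝 (∫ x, f x.1 * replicaProb L (tilt β W (K x.1) x.2) ∂P)) := by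
  have hKm : Measurable K := hK.measurable
  have htilt := measurable_tilt_comp β W hKm
  have hg : Measurable fun x : Ω × State d => f x.1 * replicaProb L (tilt β W (K x.1) x.2) :=
    Measurable.mul (f.continuous.measurable.comp measurable_fst)
      (Measurable.comp (g := replicaProb L) (measurable_replicaProb L) htilt)
  have hgC : ∀ x : Ω × State d, |f x.1 * replicaProb L (tilt β W (K x.1) x.2)| ≤ ‖f‖ := fun x => by
    rw [abs_mul]
    exact (mul_le_mul (f.norm_coe_le_norm x.1) (abs_replicaProb_le L _) (abs_nonneg _)
      (norm_nonneg _)).trans_eq (mul_one _)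
  have hδ := fun ω => one_sub_weightBound_mem_Ico β W (K ω)
  -- The geometric rate depends on K ω, so the convergence is only pointwise in ω; the uniform bound
  -- D provides domination.
  refine tendsto_integral_of_approx hG hP H hg hgC
    (h := fun M x => f x.1 * tiltApprox β W M L (K x.1) x.2)
    (fun M => (localAlgebra Ω d).mul_mem (mem_localAlgebra_of_bcf f)
      (tiltApprox_mem_localAlgebra β W M L hK))
    (e := fun M ω => ‖f‖ * (L.length * (1 - weightBound β W (K ω)) ^ M))
    (D := ‖f‖ * L.length) (fun M => ?_) (fun M ω => ?_) (fun M x => ?_) fun ω => ?_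
  · exact (((((continuous_weightBound β W).measurable.comp hKm).const_sub 1).pow_const M).const_mul
      _).const_mul _
  · have h1 := pow_nonneg (hδ ω).1 M
    rw [abs_of_nonneg (by positivity), ← mul_assoc]
    exact mul_le_of_le_one_right (by positivity) (pow_le_one₀ (hδ ω).1 (hδ ω).2.le)
  · rw [← mul_sub, abs_mul]
    exact mul_le_mul (f.norm_coe_le_norm x.1) (abs_replicaProb_tilt_sub_tiltApprox_le β W M L _ _)
      (abs_nonneg _) (norm_nonneg _)
  · simpa using ((tendsto_pow_atTop_nhds_zero_of_lt_one (hδ ω).1 (hδ ω).2).const_mul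
      (L.length : ℝ)).const_mul ‖f‖

end Convergence

/-! ### Test functions -/

/-- Two functions with values in `[0, 1]` with the same integrals against bounded continuous
functions are almost everywhere equal. -/
lemma ae_eq_of_forall_integral_bcf_mul_eq {Ω : Type*} [TopologicalSpace Ω] [MeasurableSpace Ω]
    [BorelSpace Ω] [HasOuterApproxClosed Ω] {m : Measure Ω} [IsProbabilityMeasure m]
    {u v : Ω → ℝ} (hu : Measurable u) (hv : Measurable v) (hu01 : ∀ ω, u ω ∈ Set.Icc (0 : ℝ) 1)
    (hv01 : ∀ ω, v ω ∈ Set.Icc (0 : ℝ) 1)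
    (h : ∀ f : Ω →ᵇ ℝ, ∫ ω, f ω * u ω ∂m = ∫ ω, f ω * v ω ∂m) : u =ᵐ[m] v := by
  have key : ∀ {w : Ω → ℝ}, Measurable w → (∀ ω, w ω ∈ Set.Icc (0 : ℝ) 1) →
      ∫⁻ ω, ENNReal.ofReal (w ω) ∂m ≠ ⊤ ∧
      ∀ f : Ω →ᵇ ℝ, ∫ ω, f ω ∂(m.withDensity fun ω => ENNReal.ofReal (w ω)) =
        ∫ ω, f ω * w ω ∂m := by
    intro w hw hw01
    constructor
    · refine ne_top_of_le_ne_top ENNReal.one_ne_top ?_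
      calc ∫⁻ ω, ENNReal.ofReal (w ω) ∂m ≤ ∫⁻ _, 1 ∂m :=
            lintegral_mono fun ω => by simpa using (hw01 ω).2
        _ = 1 := by simp
    · intro f
      rw [integral_withDensity_eq_integral_toReal_smul hw.ennreal_ofReal
        (ae_of_all _ fun _ => ENNReal.ofReal_lt_top)]
      refine integral_congr_ae (ae_of_all _ fun ω => ?_)
      simp only [ENNReal.toReal_ofReal (hw01 ω).1, smul_eq_mul, mul_comm]
  -- The finite measures with densities u and v have the same integrals of bounded continuous
  -- functions, hence coincide.
  have hfu := isFiniteMeasure_withDensity (key hu hu01).1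
  have hfv := isFiniteMeasure_withDensity (key hv hv01).1
  have heq := ext_of_forall_integral_eq_of_IsFiniteMeasure
    (μ := m.withDensity fun ω => ENNReal.ofReal (u ω))
    (ν := m.withDensity fun ω => ENNReal.ofReal (v ω)) fun f => by
      rw [(key hu hu01).2, (key hv hv01).2, h]
  rw [withDensity_eq_iff hu.ennreal_ofReal.aemeasurable hv.ennreal_ofReal.aemeasurable
    (key hu hu01).1] at heq
  filter_upwards [heq] with ω hω
  have := congrArg ENNReal.toReal hω
  rwa [ENNReal.toReal_ofReal (hu01 ω).1, ENNReal.toReal_ofReal (hv01 ω).1] at this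

/-- The couplings `J` restricted to `B`, and extended by `0`. -/
noncomputable def truncateCouplings (B : Finset (Edge d)) (J : Couplings d) : Couplings d :=
  fun e => open Classical in if e ∈ B then J e else 0

lemma continuous_truncateCouplings (B : Finset (Edge d)) : Continuous (truncateCouplings B) := by
  classical
  refine continuous_pi fun e => ?_
  by_cases he : e ∈ B
  · simpa [truncateCouplings, he] using continuous_apply e
  · simpa [truncateCouplings, he] using continuous_const

lemma tendsto_truncateCouplings (J : Couplings d) :
    Tendsto (fun B => truncateCouplings B J) atTop (𝓝 J) := by
  classical
  refine tendsto_pi_nhds.2 fun e => tendsto_const_nhds.congr' ?_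
  filter_upwards [eventually_ge_atTop {e}] with B hB
  have : e ∈ B := hB (Finset.mem_singleton_self e)
  simp [truncateCouplings, this]

/-- It suffices to test against functions of finitely many couplings. -/
lemma ae_eq_of_forall_integral_truncate_mul_eq {m : Measure (Couplings d)}
    [IsProbabilityMeasure m] {u v : Couplings d → ℝ} (hu : Measurable u) (hv : Measurable v)
    (hu01 : ∀ J, u J ∈ Set.Icc (0 : ℝ) 1) (hv01 : ∀ J, v J ∈ Set.Icc (0 : ℝ) 1)
    (h : ∀ (f : Couplings d →ᵇ ℝ) B, ∫ J, f (truncateCouplings B J) * u J ∂m =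
      ∫ J, f (truncateCouplings B J) * v J ∂m) : u =ᵐ[m] v := by
  refine ae_eq_of_forall_integral_bcf_mul_eq hu hv hu01 hv01 fun f => ?_
  have key : ∀ {w : Couplings d → ℝ}, Measurable w → (∀ J, w J ∈ Set.Icc (0 : ℝ) 1) →
      Tendsto (fun B => ∫ J, f (truncateCouplings B J) * w J ∂m) atTop
        (𝓝 (∫ J, f J * w J ∂m)) := by
    intro w hw hw01
    refine tendsto_integral_filter_of_dominated_convergence (fun _ => ‖f‖)
      (Eventually.of_forall fun B => ?_) (Eventually.of_forall fun B => ae_of_all _ fun J => ?_)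
      (integrable_const _) (ae_of_all _ fun J => ?_)
    · exact ((f.continuous.comp (continuous_truncateCouplings B)).measurable.mul
        hw).aestronglyMeasurable
    · rw [norm_mul]
      refine (mul_le_mul (f.norm_coe_le_norm _) ?_ (norm_nonneg _)
        (norm_nonneg _)).trans_eq (mul_one _)
      rw [Real.norm_eq_abs, abs_of_nonneg (hw01 J).1]
      exact (hw01 J).2
    · exact ((f.continuous.tendsto J).comp (tendsto_truncateCouplings J)).mul_const _
  refine tendsto_nhds_unique (key hu hu01) ?_
  simp only [h f]
  exact key hv hv01

end EdwardsAnderson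

namespace EdwardsAnderson

variable {d : ℕ}

/-! ### Laws of infinitely many replicas -/

/-- A spin pattern in a finite window. -/
abbrev LocalPattern (d : ℕ) : Type := Σ W : Finset (Site d), (W → Spin)

/-- A pattern as a window and a configuration, extended by `1` outside of the window. -/
noncomputable def LocalPattern.extend (c : LocalPattern d) : Finset (Site d) × Config d :=
  (c.1, fun x => open Classical in if h : x ∈ c.1 then c.2 ⟨x, h⟩ else 1)

/-- There are only countably many patterns, so almost-sure identities for single local events hold
simultaneously for all of them. -/
lemma exists_agree_extend_eq (q : Finset (Site d) × Config d) :
    ∃ c : LocalPattern d, agree c.extend = agree q := by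
  refine ⟨⟨q.1, fun x => q.2 x⟩, ?_⟩
  ext σ
  refine forall₂_congr fun x hx => ?_
  have hx' : x ∈ q.1 := hx
  simp [LocalPattern.extend, hx']

/-- A configuration in the intersection supplies a common pattern on the union of the windows. -/
lemma agree_inter [DecidableEq (Site d)] {q q' : Finset (Site d) × Config d}
    (h : (agree q ∩ agree q').Nonempty) :
    ∃ q'', agree q'' = agree q ∩ agree q' := by
  obtain ⟨σ, h1, h2⟩ := h
  refine ⟨(q.1 ∪ q'.1, σ), ?_⟩
  ext τ
  simp only [agree, Set.mem_ofPred_eq, Set.mem_inter_iff, Finset.mem_union] at h1 h2 ⊢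
  constructor
  · exact fun h => ⟨fun x hx => (h x (Or.inl hx)).trans (h1 x hx),
      fun x hx => (h x (Or.inr hx)).trans (h2 x hx)⟩
  · rintro ⟨h3, h4⟩ x (hx | hx)
    · exact (h3 x hx).trans (h1 x hx).symm
    · exact (h4 x hx).trans (h2 x hx).symm

/-- The replicas `i < s` realize the local events `q i`. -/
def replicaEvent (s : ℕ) (q : ℕ → Finset (Site d) × Config d) : Set (ℕ → Config d) :=
  {σ | ∀ i < s, σ i ∈ agree (q i)}

lemma replicaEvent_eq_pi (s : ℕ) (q : ℕ → Finset (Site d) × Config d) :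
    replicaEvent s q = Set.pi (Finset.range s : Finset ℕ) fun i => agree (q i) := by
  ext σ; simp [replicaEvent, Set.mem_pi]

lemma agree_empty (σ : Config d) : agree (∅, σ) = Set.univ := by
  ext; simp [agree]

lemma measurableSet_replicaEvent (s : ℕ) (q : ℕ → Finset (Site d) × Config d) :
    MeasurableSet (replicaEvent s q) := by
  rw [replicaEvent_eq_pi]
  exact MeasurableSet.pi (Set.to_countable _) fun i _ => measurableSet_agree _

lemma isPiSystem_replicaEvent :
    IsPiSystem {A : Set (ℕ → Config d) | ∃ s q, A = replicaEvent s q} := by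
  classical
  rintro _ ⟨s, q, rfl⟩ _ ⟨s', q', rfl⟩ ⟨σ, hσ, hσ'⟩
  -- Replicas beyond the prescribed number receive the empty window, which imposes nothing.
  set p : ℕ → Finset (Site d) × Config d := fun i => if i < s then q i else (∅, 1) with hp
  set p' : ℕ → Finset (Site d) × Config d := fun i => if i < s' then q' i else (∅, 1) with hp'
  have hmem : ∀ i (τ : Config d), τ ∈ agree (p i) ↔ (i < s → τ ∈ agree (q i)) := fun i τ => by
    by_cases h : i < s <;> simp [hp, h, agree_empty]
  have hmem' : ∀ i (τ : Config d), τ ∈ agree (p' i) ↔ (i < s' → τ ∈ agree (q' i)) := fun i τ => by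
    by_cases h : i < s' <;> simp [hp', h, agree_empty]
  have h := fun i => agree_inter (q := p i) (q' := p' i)
    ⟨σ i, (hmem i _).2 (hσ i), (hmem' i _).2 (hσ' i)⟩
  choose r hr using h
  refine ⟨max s s', r, ?_⟩
  ext τ
  simp only [replicaEvent, Set.mem_inter_iff, Set.mem_ofPred_eq, hr, hmem, hmem']
  constructor
  · exact fun h i _ => ⟨h.1 i, h.2 i⟩
  · exact fun h => ⟨fun i hi => (h i (lt_max_of_lt_left hi)).1 hi,
      fun i hi => (h i (lt_max_of_lt_right hi)).2 hi⟩

lemma generateFrom_replicaEvent :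
    (inferInstance : MeasurableSpace (ℕ → Config d)) =
      MeasurableSpace.generateFrom {A : Set (ℕ → Config d) | ∃ s q, A = replicaEvent s q} := by
  classical
  refine le_antisymm ?_ (MeasurableSpace.generateFrom_le ?_)
  · set m := MeasurableSpace.generateFrom {A : Set (ℕ → Config d) | ∃ s q, A = replicaEvent s q}
    refine iSup_le fun i => ?_
    rw [MeasurableSpace.comap_le_iff_le_map]
    refine iSup_le fun x => ?_
    rw [MeasurableSpace.comap_le_iff_le_map]
    intro B _
    change MeasurableSet[m] {σ : ℕ → Config d | σ i x ∈ B}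
    have : {σ : ℕ → Config d | σ i x ∈ B} = ⋃ u ∈ B, replicaEvent (i + 1) fun j =>
        if j = i then ({x}, fun _ => u) else (∅, 1) := by
      ext σ
      simp only [Set.mem_iUnion, replicaEvent, Set.mem_ofPred_eq, exists_prop]
      constructor
      · refine fun h => ⟨σ i x, h, fun j _ => ?_⟩
        by_cases hj : j = i
        · subst hj; simp [agree]
        · simp [hj, agree_empty]
      · rintro ⟨u, hu, h⟩
        have := h i (Nat.lt_succ_self i)
        simp only [if_true, agree, Set.mem_ofPred_eq, Finset.mem_singleton, forall_eq] at this
        rwa [this]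
    rw [this]
    exact MeasurableSet.biUnion (m := m) (Set.to_countable B) fun u _ =>
      MeasurableSpace.measurableSet_generateFrom ⟨_, _, rfl⟩
  · rintro _ ⟨s, q, rfl⟩
    exact measurableSet_replicaEvent s q

lemma integrable_replicaProb (K : Measure (State d)) [IsProbabilityMeasure K]
    (L : List (Finset (Site d) × Config d)) : Integrable (replicaProb L) K :=
  Integrable.of_bound (measurable_replicaProb L).aestronglyMeasurable 1
    (ae_of_all _ fun Γ => abs_replicaProb_le L Γ)

/-- Given Γ the replicas are independent, so the conditional probability is a product of local
probabilities. -/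
lemma bind_replicaKernel_replicaEvent (K : Measure (State d)) [IsProbabilityMeasure K] (s : ℕ)
    (q : ℕ → Finset (Site d) × Config d) :
    K.bind (replicaKernel d) (replicaEvent s q) =
      ENNReal.ofReal (∫ Γ, replicaProb ((List.range s).map q) Γ ∂K) := by
  rw [Measure.bind_apply (measurableSet_replicaEvent s q) (replicaKernel d).aemeasurable,
    ofReal_integral_eq_lintegral_ofReal (integrable_replicaProb K _)
      (ae_of_all _ fun Γ => (replicaProb_mem_Icc _ Γ).1)]
  refine lintegral_congr fun Γ => ?_
  change Measure.infinitePi (fun _ => (Γ : Measure (Config d))) _ = _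
  rw [replicaEvent_eq_pi, Measure.infinitePi_pi _ fun i _ => measurableSet_agree _]
  have : replicaProb ((List.range s).map q) Γ = ∏ i ∈ Finset.range s, localProb (q i) Γ := by
    rw [replicaProb, List.map_map, ← List.prod_toFinset _ List.nodup_range, List.toFinset_range]
    rfl
  rw [this, ENNReal.ofReal_prod_of_nonneg fun i _ => localProb_nonneg _ _]
  exact Finset.prod_congr rfl fun i _ => (ofReal_measureReal).symm

instance (K : Measure (State d)) [IsProbabilityMeasure K] :
    IsProbabilityMeasure (K.bind (replicaKernel d)) := by
  refine isProbabilityMeasure_bind (replicaKernel d).aemeasurable (ae_of_all _ fun Γ => ?_)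
  change IsProbabilityMeasure (Measure.infinitePi fun _ => (Γ : Measure (Config d)))
  infer_instance

/-- The law of infinitely many replicas is determined by the moments of the probabilities of local
events. -/
lemma bind_replicaKernel_ext {K K' : Measure (State d)} [IsProbabilityMeasure K]
    [IsProbabilityMeasure K']
    (h : ∀ L : List (LocalPattern d), ∫ Γ, replicaProb (L.map LocalPattern.extend) Γ ∂K =
      ∫ Γ, replicaProb (L.map LocalPattern.extend) Γ ∂K') :
    K.bind (replicaKernel d) = K'.bind (replicaKernel d) := by
  refine ext_of_generate_finite _ generateFrom_replicaEvent isPiSystem_replicaEvent ?_ (by simp)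
  rintro _ ⟨s, q, rfl⟩
  choose c hc using fun i => exists_agree_extend_eq (q i)
  have : replicaEvent s q = replicaEvent s fun i => (c i).extend := by
    simp only [replicaEvent, hc]
  rw [this, bind_replicaKernel_replicaEvent, bind_replicaKernel_replicaEvent]
  have hL := h ((List.range s).map c)
  rw [List.map_map] at hL
  exact congrArg _ hL

/-! ### Convergence to the metastate -/

/-- The defining convergence of a metastate, for the probabilities of local events of replicas. -/
lemma IsMetastate.exists_tendsto {β : ℝ} {ρ : Measure ℝ} {κ : Kernel (Couplings d) (State d)}
    (hκ : IsMetastate β ρ κ) :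
    ∃ a b : ℕ → Site d, (∀ x : Site d, ∀ᶠ n in atTop, x ∈ Finset.Icc (a n) (b n)) ∧
      ∀ L (f : Couplings d →ᵇ ℝ),
        Tendsto (fun n => ∫ J, f J * replicaProb L (gibbsState β (a n) (b n) J) ∂couplingLaw d ρ)
          atTop (𝓝 (∫ J, f J * ∫ Γ, replicaProb L Γ ∂κ J ∂couplingLaw d ρ)) := by
  classical
  obtain ⟨a, b, hab, h⟩ := hκ
  refine ⟨a, b, hab, fun L f => ?_⟩
  set s := L.length
  set W : Finset (Site d) := Finset.univ.biUnion fun i : Fin s => (L.get i).1 with hW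
  have hmemW : ∀ i : Fin s, ∀ x ∈ (L.get i).1, x ∈ W := fun i x hx =>
    Finset.mem_biUnion.2 ⟨i, Finset.mem_univ _, hx⟩
  -- The test function f times the indicator that every replica realizes its event, viewed in the
  -- common window W.
  set g : (Fin s → W → Spin) → (Couplings d →ᵇ ℝ) := fun η =>
    if ∀ i : Fin s, ∀ x (hx : x ∈ (L.get i).1), η i ⟨x, hmemW i x hx⟩ = (L.get i).2 x then f else 0
    with hg
  have hgval : ∀ (σ : Fin s → Config d) J, g (fun i x => σ i x) J =
      f J * ∏ i, (agree (L.get i)).indicator (1 : Config d → ℝ) (σ i) := by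
    intro σ J
    by_cases hσ : ∀ i : Fin s, ∀ x ∈ (L.get i).1, σ i x = (L.get i).2 x
    · have : g (fun i x => σ i x) = f := if_pos hσ
      rw [this, Finset.prod_eq_one, mul_one]
      exact fun i _ => Set.indicator_of_mem (s := agree (L.get i)) (hσ i) _
    · have h0 : g (fun i x => σ i x) = 0 := if_neg hσ
      push Not at hσ
      obtain ⟨i, x, hx, hne⟩ := hσ
      rw [h0, Finset.prod_eq_zero (Finset.mem_univ i)]
      · simp
      · exact Set.indicator_of_notMem (fun h : σ i ∈ agree (L.get i) => hne (h x hx)) _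
  have hprod : ∀ Γ : State d, replicaProb L Γ = ∏ i, localProb (L.get i) Γ := by
    intro Γ
    rw [replicaProb, ← List.prod_ofFn]
    congr 1
    conv_lhs => rw [← List.ofFn_get L]
    rw [List.map_ofFn]
    rfl
  refine (h W s g).congr' (Eventually.of_forall fun n => ?_) |>.trans_eq ?_
  · refine integral_congr_ae (ae_of_all _ fun J => ?_)
    simp only [hgval, hprod]
    have : ∀ i, localProb (L.get i) (gibbsState β (a n) (b n) J) = ∑ τ, gibbs β (a n) (b n) J τ *
        (agree (L.get i)).indicator 1 (periodicExt (a n) (b n) τ) := fun i =>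
      gibbsState_real _ _ _ _ (measurableSet_agree _)
    simp only [this]
    rw [Finset.prod_univ_sum, Fintype.piFinset_univ, Finset.mul_sum]
    refine Finset.sum_congr rfl fun τ _ => ?_
    rw [Finset.prod_mul_distrib]
    ring
  · congr 1
    refine integral_congr_ae (ae_of_all _ fun J => ?_)
    simp only [hgval]
    rw [← integral_const_mul]
    refine integral_congr_ae (ae_of_all _ fun Γ => ?_)
    simp only
    rw [integral_const_mul, hprod, integral_fintype_prod_eq_prod]
    congr 1
    exact Finset.prod_congr rfl fun i _ => integral_indicator_one (measurableSet_agree _)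

end EdwardsAnderson

namespace EdwardsAnderson

variable {d : ℕ}

lemma integral_replicaProb_mem_Icc (K : Measure (State d)) [IsProbabilityMeasure K]
    (L : List (Finset (Site d) × Config d)) : ∫ Γ, replicaProb L Γ ∂K ∈ Set.Icc (0 : ℝ) 1 := by
  refine ⟨integral_nonneg fun Γ => (replicaProb_mem_Icc L Γ).1, ?_⟩
  have := integral_mono (integrable_replicaProb K L) (integrable_const (1 : ℝ))
    fun Γ => (replicaProb_mem_Icc L Γ).2
  simpa using this

lemma measurable_integral_replicaProb (κ : Kernel (Couplings d) (State d)) [IsMarkovKernel κ]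
    (L : List (Finset (Site d) × Config d)) : Measurable fun J => ∫ Γ, replicaProb L Γ ∂κ J :=
  (StronglyMeasurable.integral_kernel (measurable_replicaProb L).stronglyMeasurable).measurable

/-! ### Translation covariance of the metastate -/

/-- Translation of states. -/
noncomputable def shiftState (v : Site d) (Γ : State d) : State d :=
  Γ.map (measurable_shift v).aemeasurable

lemma measurable_shiftState (v : Site d) : Measurable (shiftState (d := d) v) := by
  refine Measurable.subtype_mk ?_
  exact (Measure.measurable_map _ (measurable_shift v)).comp measurable_subtype_coe

/-- Translation of local events. -/
def shiftPattern (v : Site d) (q : Finset (Site d) × Config d) : Finset (Site d) × Config d :=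
  (q.1.map (addLeftEmbedding v), shift (-v) q.2)

lemma preimage_shift_agree (v : Site d) (q : Finset (Site d) × Config d) :
    shift v ⁻¹' agree q = agree (shiftPattern v q) := by
  ext σ
  simp [agree, shiftPattern, shift]

lemma replicaProb_shiftState (v : Site d) (L : List (Finset (Site d) × Config d)) (Γ : State d) :
    replicaProb L (shiftState v Γ) = replicaProb (L.map (shiftPattern v)) Γ := by
  rw [replicaProb, replicaProb, List.map_map]
  congr 1
  refine List.map_congr_left fun q _ => ?_
  change (((Γ : Measure (Config d)).map (shift v))).real (agree q) =
    (Γ : Measure (Config d)).real (agree (shiftPattern v q))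
  rw [map_measureReal_apply (measurable_shift v) (measurableSet_agree q), preimage_shift_agree]

lemma replicaProb_congr {Γ Γ' : State d}
    (h : ∀ A : Set (Config d), MeasurableSet A → (Γ : Measure (Config d)).real A =
      (Γ' : Measure (Config d)).real A) (L : List (Finset (Site d) × Config d)) :
    replicaProb L Γ = replicaProb L Γ' := by
  rw [replicaProb, replicaProb]
  congr 1
  exact List.map_congr_left fun q _ => h _ (measurableSet_agree q)

lemma continuous_shiftCouplings (v : Site d) : Continuous (shiftCouplings (d := d) v) :=
  continuous_pi fun e => continuous_apply (shiftEdge v e)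

/-- On edges whose base point and its translate by -v both lie in the box, nothing wraps and the
shift by -v undoes the rotation by v. -/
lemma truncate_shift_rotate {a b v : Site d} {B : Finset (Edge d)}
    (h1 : ∀ e ∈ B, e.1 ∈ Finset.Icc a b) (h2 : ∀ e ∈ B, -v + e.1 ∈ Finset.Icc a b)
    (J : Couplings d) :
    truncateCouplings B (shiftCouplings (-v) fun e => J (rotateEdge a b v e)) =
      truncateCouplings B J := by
  ext e
  by_cases he : e ∈ B
  · simp only [truncateCouplings, he, if_true, shiftCouplings, shiftEdge, rotateEdge, h2 e he,
      add_neg_cancel_left, wrap_eq_self (h1 e he)]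
  · simp [truncateCouplings, he]

/-- Exact rotation covariance in finite volume, together with invariance of the coupling law, passes
to the limit. Testing against functions of finitely many couplings is what lets a rotation be read
as a translation. -/
lemma IsMetastate.ae_integral_replicaProb_shift {β : ℝ} {ρ : Measure ℝ} [IsProbabilityMeasure ρ]
    {κ : Kernel (Couplings d) (State d)} [IsMarkovKernel κ] (hκ : IsMetastate β ρ κ) (v : Site d)
    (L : List (Finset (Site d) × Config d)) :
    (fun J => ∫ Γ, replicaProb L Γ ∂κ (shiftCouplings v J)) =ᵐ[couplingLaw d ρ]
      fun J => ∫ Γ, replicaProb L (shiftState v Γ) ∂κ J := by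
  have hU := measurable_integral_replicaProb κ L
  have hshift := measurePreserving_shiftCouplings ρ v
  simp only [replicaProb_shiftState]
  refine ae_eq_of_forall_integral_truncate_mul_eq (hU.comp hshift.measurable)
    (measurable_integral_replicaProb κ _) (fun J => integral_replicaProb_mem_Icc _ L)
    (fun J => integral_replicaProb_mem_Icc _ _) fun f B => ?_
  obtain ⟨a, b, hab, hlim⟩ := hκ.exists_tendsto
  set f₁ : Couplings d →ᵇ ℝ := f.compContinuous ⟨_, continuous_truncateCouplings B⟩
  set f₂ : Couplings d →ᵇ ℝ := f₁.compContinuous ⟨_, continuous_shiftCouplings (-v)⟩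
  -- A change of variables moves the translation from the metastate to the test function, where the
  -- defining convergence applies.
  have e1 : ∫ J, f (truncateCouplings B J) * ∫ Γ, replicaProb L Γ ∂κ (shiftCouplings v J) ∂couplingLaw d ρ =
      ∫ J, f₂ J * ∫ Γ, replicaProb L Γ ∂κ J ∂couplingLaw d ρ := by
    have hm : Measurable fun J => f₂ J * ∫ Γ, replicaProb L Γ ∂κ J :=
      f₂.continuous.measurable.mul hU
    conv_rhs => rw [← hshift.map_eq]
    rw [integral_map hshift.measurable.aemeasurable hm.aestronglyMeasurable]
    refine integral_congr_ae (ae_of_all _ fun J => ?_)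
    change _ = f (truncateCouplings B (shiftCouplings (-v) (shiftCouplings v J))) * _
    rw [shiftCouplings_shiftCouplings, neg_add_cancel, shiftCouplings_zero]
  rw [e1]
  refine tendsto_nhds_unique (hlim L f₂) ((hlim (L.map (shiftPattern v)) f₁).congr' ?_)
  have hB1 : ∀ᶠ n in atTop, ∀ e ∈ B, e.1 ∈ Finset.Icc (a n) (b n) :=
    (Filter.eventually_all_finset B).2 fun e _ => hab e.1
  have hB2 : ∀ᶠ n in atTop, ∀ e ∈ B, -v + e.1 ∈ Finset.Icc (a n) (b n) :=
    (Filter.eventually_all_finset B).2 fun e _ => hab _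
  filter_upwards [hB1, hB2, hab 0] with n h1 h2 h0
  have hle : a n ≤ b n := (Finset.mem_Icc.1 h0).1.trans (Finset.mem_Icc.1 h0).2
  have hrot := measurePreserving_reindex ρ (rotateEdge_injective hle v)
  have hG : Measurable fun J => f₂ J * replicaProb L (gibbsState β (a n) (b n) J) :=
    f₂.continuous.measurable.mul ((measurable_replicaProb L).comp (measurable_gibbsState β _ _))
  conv_rhs => rw [← hrot.map_eq]
  rw [integral_map hrot.measurable.aemeasurable hG.aestronglyMeasurable]
  refine integral_congr_ae (ae_of_all _ fun J => ?_)
  have e2 : f₂ (fun e => J (rotateEdge (a n) (b n) v e)) = f₁ J := by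
    exact congrArg f (truncate_shift_rotate h1 h2 J)
  simp only
  rw [e2, ← replicaProb_shiftState]
  congr 1
  refine replicaProb_congr (fun A hA => ?_) L
  rw [gibbsState_rotate β hle v J hA]
  exact map_measureReal_apply (measurable_shift v) hA

/-- The law of the replicas is translation covariant. -/
lemma IsMetastate.ae_bind_shift {β : ℝ} {ρ : Measure ℝ} [IsProbabilityMeasure ρ]
    {κ : Kernel (Couplings d) (State d)} [IsMarkovKernel κ] (hκ : IsMetastate β ρ κ) (v : Site d) :
    ∀ᵐ J ∂couplingLaw d ρ, (κ (shiftCouplings v J)).bind (replicaKernel d) =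
      ((κ J).bind (replicaKernel d)).map fun σ i => shift v (σ i) := by
  have hall : ∀ᵐ J ∂couplingLaw d ρ, ∀ L : List (LocalPattern d),
      ∫ Γ, replicaProb (L.map LocalPattern.extend) Γ ∂κ (shiftCouplings v J) =
        ∫ Γ, replicaProb (L.map LocalPattern.extend) (shiftState v Γ) ∂κ J :=
    ae_all_iff.2 fun L => hκ.ae_integral_replicaProb_shift v _
  filter_upwards [hall] with J hJ
  have := Measure.isProbabilityMeasure_map (μ := κ J) (measurable_shiftState v).aemeasurable
  rw [bind_replicaKernel_ext (K' := (κ J).map (shiftState v)) fun L => by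
    rw [hJ, integral_map (measurable_shiftState v).aemeasurable
      (measurable_replicaProb _).aestronglyMeasurable]]
  have hm : Measurable fun (σ : ℕ → Config d) i => shift v (σ i) :=
    measurable_pi_lambda _ fun i => (measurable_shift v).comp (measurable_pi_apply i)
  ext A hA
  rw [Measure.bind_apply hA (replicaKernel d).aemeasurable, Measure.map_apply hm hA,
    Measure.bind_apply (hm hA) (replicaKernel d).aemeasurable,
    lintegral_map ((replicaKernel d).measurable_coe hA) (measurable_shiftState v)]
  refine lintegral_congr fun Γ => ?_
  rw [← Measure.map_apply hm hA]
  change Measure.infinitePi (fun _ : ℕ => (Γ : Measure (Config d)).map (shift v)) A =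
    (Measure.infinitePi fun _ : ℕ => (Γ : Measure (Config d))).map _ A
  rw [Measure.infinitePi_map_pi (μ := fun _ : ℕ => (Γ : Measure (Config d)))
    (f := fun _ => shift v) fun _ => measurable_shift v]

/-! ### Covariance under changes of finitely many couplings -/

/-- Exchange the couplings in a window with an independent copy. -/
noncomputable def swapCouplings (W : Finset (Site d)) (ω : Couplings d × (edgesIn W → ℝ)) :
    Couplings d × (edgesIn W → ℝ) :=
  (replaceCouplings W ω.1 ω.2, fun e => ω.1 e)

lemma swapCouplings_swapCouplings (W : Finset (Site d)) (ω : Couplings d × (edgesIn W → ℝ)) :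
    swapCouplings W (swapCouplings W ω) = ω := by
  refine Prod.ext (funext fun e => ?_) (funext fun e => ?_)
  · by_cases he : e ∈ edgesIn W <;> simp [swapCouplings, replaceCouplings, he]
  · simp [swapCouplings, replaceCouplings]

lemma continuous_swapCouplings (W : Finset (Site d)) : Continuous (swapCouplings W) := by
  refine Continuous.prodMk (continuous_pi fun e => ?_) (continuous_pi fun e => ?_)
  · by_cases he : e ∈ edgesIn W
    · simp only [replaceCouplings, he, dif_pos]
      fun_prop
    · simp only [replaceCouplings, he, dif_neg, not_false_eq_true]
      fun_prop
  · exact (continuous_apply _).comp continuous_fst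

/-- The couplings and the independent copy form a single i.i.d. family, so exchanging some of them
is a reindexing. -/
lemma map_sumElim_infinitePi_prod_pi {α α' : Type*} [Fintype α'] (ρ : Measure ℝ)
    [IsProbabilityMeasure ρ] :
    ((Measure.infinitePi fun _ : α => ρ).prod (Measure.pi fun _ : α' => ρ)).map
      (fun ω => Sum.elim ω.1 ω.2) = Measure.infinitePi fun _ : α ⊕ α' => ρ := by
  classical
  have hm : Measurable fun ω : (α → ℝ) × (α' → ℝ) => (Sum.elim ω.1 ω.2 : α ⊕ α' → ℝ) := by
    refine measurable_pi_lambda _ fun i => ?_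
    rcases i with i | i
    · exact (measurable_pi_apply i).comp measurable_fst
    · exact (measurable_pi_apply i).comp measurable_snd
  refine Measure.eq_infinitePi _ fun s t ht => ?_
  rw [Measure.map_apply hm (MeasurableSet.pi (Set.to_countable _) fun i _ => ht i)]
  have : (fun ω : (α → ℝ) × (α' → ℝ) => (Sum.elim ω.1 ω.2 : α ⊕ α' → ℝ)) ⁻¹' (Set.pi s t) =
      (Set.pi s.toLeft fun i => t (Sum.inl i)) ×ˢ (Set.pi s.toRight fun i => t (Sum.inr i)) := by
    ext ω
    simp [Set.mem_pi]
  rw [this, Measure.prod_prod, Measure.infinitePi_pi _ fun i _ => ht _, ← Measure.infinitePi_eq_pi,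
    Measure.infinitePi_pi _ fun i _ => ht _]
  conv_rhs => rw [← Finset.toLeft_disjSum_toRight (u := s)]
  rw [Finset.prod_disjSum]

lemma measurePreserving_swapCouplings (ρ : Measure ℝ) [IsProbabilityMeasure ρ]
    (W : Finset (Site d)) :
    MeasurePreserving (swapCouplings W) ((couplingLaw d ρ).prod (Measure.pi fun _ => ρ))
      ((couplingLaw d ρ).prod (Measure.pi fun _ => ρ)) := by
  refine ⟨(continuous_swapCouplings W).measurable, ?_⟩
  set m := (couplingLaw d ρ).prod (Measure.pi fun _ : edgesIn W => ρ)
  set Ψ : Couplings d × (edgesIn W → ℝ) → (Edge d ⊕ edgesIn W → ℝ) := fun ω => Sum.elim ω.1 ω.2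
  set Φ : (Edge d ⊕ edgesIn W → ℝ) → Couplings d × (edgesIn W → ℝ) := fun x =>
    (fun e => x (Sum.inl e), fun e => x (Sum.inr e))
  set π : Edge d ⊕ edgesIn W → Edge d ⊕ edgesIn W := Sum.elim
    (fun e => if h : e ∈ edgesIn W then Sum.inr ⟨e, h⟩ else Sum.inl e) (fun e => Sum.inl e)
  have hπ2 : ∀ i, π (π i) = i := by
    rintro (e | e)
    · by_cases he : e ∈ edgesIn W <;> simp [π, he]
    · simp [π]
  have hπ : Function.Injective π := fun i j h => by rw [← hπ2 i, h, hπ2]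
  have hΨ : Measurable Ψ := by
    refine measurable_pi_lambda _ fun i => ?_
    rcases i with i | i
    · exact (measurable_pi_apply i).comp measurable_fst
    · exact (measurable_pi_apply i).comp measurable_snd
  have hΦ : Measurable Φ := (measurable_pi_lambda _ fun e => measurable_pi_apply _).prodMk
    (measurable_pi_lambda _ fun e => measurable_pi_apply _)
  have hre : Measurable fun (x : Edge d ⊕ edgesIn W → ℝ) i => x (π i) :=
    measurable_pi_lambda _ fun e => measurable_pi_apply _
  have h1 : m.map Ψ = Measure.infinitePi fun _ => ρ := map_sumElim_infinitePi_prod_pi ρ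
  have h2 : (Measure.infinitePi fun _ : Edge d ⊕ edgesIn W => ρ).map (fun x i => x (π i)) =
      Measure.infinitePi fun _ => ρ :=
    Measure.map_infinitePi_infinitePi_of_inj (P := fun _ : Edge d ⊕ edgesIn W => ρ) hπ
  have h3 : swapCouplings W = Φ ∘ (fun x i => x (π i)) ∘ Ψ := by
    ext ω e
    · by_cases he : e ∈ edgesIn W <;> simp [Φ, Ψ, π, swapCouplings, replaceCouplings, he]
    · simp [Φ, Ψ, π, swapCouplings]
  have h4 : Φ ∘ Ψ = id := rfl
  rw [h3, ← Measure.map_map hΦ (hre.comp hΨ), ← Measure.map_map hre hΨ, h1, h2, ← h1,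
    Measure.map_map hΦ hΨ, h4, Measure.map_id]

end EdwardsAnderson

/-! ### Resampled couplings and tilted metastates. -/

namespace EdwardsAnderson

variable {d : ℕ}

/-- The difference of the couplings in a window and their replacement. -/
def couplingDiff (W : Finset (Site d)) (ω : Couplings d × (edgesIn W → ℝ)) : edgesIn W → ℝ :=
  fun e => ω.2 e - ω.1 e

lemma continuous_couplingDiff (W : Finset (Site d)) : Continuous (couplingDiff W) := by
  unfold couplingDiff
  fun_prop

lemma integrable_of_bcf_mul {Ω : Type*} [TopologicalSpace Ω] [MeasurableSpace Ω]
    [OpensMeasurableSpace Ω] {m : Measure Ω} [IsFiniteMeasure m] (f : Ω →ᵇ ℝ) {w : Ω → ℝ}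
    (hw : Measurable w) (hw1 : ∀ ω, |w ω| ≤ 1) : Integrable (fun ω => f ω * w ω) m := by
  refine Integrable.of_bound (f.continuous.measurable.mul hw).aestronglyMeasurable ‖f‖
    (ae_of_all _ fun ω => ?_)
  rw [norm_mul]
  exact (mul_le_mul (f.norm_coe_le_norm ω) (hw1 ω) (abs_nonneg _) (norm_nonneg _)).trans_eq
    (mul_one _)

/-- By Fubini the additional variable is frozen, where the hypothesis applies; dominated convergence
integrates it out. -/
lemma tendsto_integral_prod_of_forall {Y : Type*} [TopologicalSpace Y] [MeasurableSpace Y]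
    [OpensMeasurableSpace (Couplings d × Y)]
    {ν : Measure (Couplings d)} [IsProbabilityMeasure ν] {τ : Measure Y} [IsProbabilityMeasure τ]
    {r : ℕ → Couplings d → ℝ} {r' : Couplings d → ℝ} (hr : ∀ n, Measurable (r n))
    (hr' : Measurable r') (hr1 : ∀ n J, |r n J| ≤ 1) (hr1' : ∀ J, |r' J| ≤ 1)
    (h : ∀ f : Couplings d →ᵇ ℝ, Tendsto (fun n => ∫ J, f J * r n J ∂ν) atTop
      (𝓝 (∫ J, f J * r' J ∂ν))) (f : Couplings d × Y →ᵇ ℝ) :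
    Tendsto (fun n => ∫ ω, f ω * r n ω.1 ∂ν.prod τ) atTop (𝓝 (∫ ω, f ω * r' ω.1 ∂ν.prod τ)) := by
  have hi : ∀ n, Integrable (fun ω : Couplings d × Y => f ω * r n ω.1) (ν.prod τ) := fun n =>
    integrable_of_bcf_mul f ((hr n).comp measurable_fst) fun ω => hr1 n ω.1
  have hi' : Integrable (fun ω : Couplings d × Y => f ω * r' ω.1) (ν.prod τ) :=
    integrable_of_bcf_mul f (hr'.comp measurable_fst) fun ω => hr1' ω.1
  simp only [fun n => integral_prod_symm _ (hi n), integral_prod_symm _ hi']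
  refine tendsto_integral_of_dominated_convergence (fun _ => ‖f‖)
    (fun n => (hi n).integral_prod_right.aestronglyMeasurable) (integrable_const _)
    (fun n => ae_of_all _ fun y => ?_) (ae_of_all _ fun y => ?_)
  · refine (norm_integral_le_of_norm_le_const (C := ‖f‖) (ae_of_all _ fun J => ?_)).trans_eq
      (by simp)
    rw [norm_mul]
    exact (mul_le_mul (f.norm_coe_le_norm _) (hr1 n J) (abs_nonneg _) (norm_nonneg _)).trans_eq
      (mul_one _)
  · exact h (f.compContinuous ⟨fun J => (J, y), by fun_prop⟩)

lemma integral_compProd_fst {Y : Type*} [TopologicalSpace Y] [MeasurableSpace Y]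
    [OpensMeasurableSpace (Couplings d × Y)] {m : Measure (Couplings d × Y)}
    [IsProbabilityMeasure m] (κ : Kernel (Couplings d) (State d)) [IsMarkovKernel κ]
    (f : Couplings d × Y →ᵇ ℝ) {r : (Couplings d × Y) × State d → ℝ} (hr : Measurable r)
    (hr1 : ∀ x, |r x| ≤ 1) :
    ∫ x, f x.1 * r x ∂(m ⊗ₘ κ.comap Prod.fst measurable_fst) =
      ∫ ω, f ω * ∫ Γ, r (ω, Γ) ∂κ ω.1 ∂m := by
  rw [Measure.integral_compProd]
  · refine integral_congr_ae (ae_of_all _ fun ω => ?_)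
    simp only [integral_const_mul]
    rfl
  · refine Integrable.of_bound ((f.continuous.measurable.comp
      measurable_fst).mul hr).aestronglyMeasurable ‖f‖ (ae_of_all _ fun x => ?_)
    rw [norm_mul]
    exact (mul_le_mul (f.norm_coe_le_norm _) (hr1 x) (abs_nonneg _) (norm_nonneg _)).trans_eq
      (mul_one _)

/-- For large boxes the exchange of couplings is exactly a tilt of the Gibbs state, and it preserves
the joint law. The two sides are limits of the same sequence, the tilted one by
`tendsto_integral_tilt`. -/
lemma IsMetastate.ae_integral_replicaProb_swap {β : ℝ} {ρ : Measure ℝ} [IsProbabilityMeasure ρ]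
    {κ : Kernel (Couplings d) (State d)} [IsMarkovKernel κ] (hκ : IsMetastate β ρ κ)
    (W : Finset (Site d)) (L : List (Finset (Site d) × Config d)) :
    (fun ω : Couplings d × (edgesIn W → ℝ) =>
      ∫ Γ, replicaProb L Γ ∂κ (swapCouplings W ω).1) =ᵐ[(couplingLaw d ρ).prod
        (Measure.pi fun _ => ρ)]
      fun ω => ∫ Γ, replicaProb L (tilt β W (couplingDiff W ω) Γ) ∂κ ω.1 := by
  set m := (couplingLaw d ρ).prod (Measure.pi fun _ : edgesIn W => ρ) with hm
  obtain ⟨a, b, hab, hlim⟩ := hκ.exists_tendsto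
  have hS := measurePreserving_swapCouplings ρ W
  have hU := measurable_integral_replicaProb κ L
  have htilt := measurable_tilt_comp β W (continuous_couplingDiff W).measurable
  have hrt : Measurable fun x : (Couplings d × (edgesIn W → ℝ)) × State d =>
      replicaProb L (tilt β W (couplingDiff W x.1) x.2) := (measurable_replicaProb L).comp htilt
  have hV : Measurable fun ω : Couplings d × (edgesIn W → ℝ) =>
      ∫ Γ, replicaProb L (tilt β W (couplingDiff W ω) Γ) ∂κ ω.1 :=
    (StronglyMeasurable.integral_kernel_prod_right'
      (κ := κ.comap Prod.fst measurable_fst) hrt.stronglyMeasurable).measurable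
  have hV01 : ∀ ω : Couplings d × (edgesIn W → ℝ),
      ∫ Γ, replicaProb L (tilt β W (couplingDiff W ω) Γ) ∂κ ω.1 ∈ Set.Icc (0 : ℝ) 1 := by
    intro ω
    have := Measure.isProbabilityMeasure_map (μ := κ ω.1)
      (measurable_tilt β W (couplingDiff W ω)).aemeasurable
    rw [← integral_map (measurable_tilt β W (couplingDiff W ω)).aemeasurable
      (measurable_replicaProb L).aestronglyMeasurable]
    exact integral_replicaProb_mem_Icc _ L
  refine ae_eq_of_forall_integral_bcf_mul_eq (hU.comp (measurable_fst.comp hS.measurable)) hV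
    (fun ω => integral_replicaProb_mem_Icc _ L) hV01 fun f => ?_
  set G : ℕ → Couplings d × (edgesIn W → ℝ) → State d := fun n ω =>
    gibbsState β (a n) (b n) ω.1 with hGdef
  have hG : ∀ n, Measurable (G n) := fun n =>
    (measurable_gibbsState β (a n) (b n)).comp measurable_fst
  set P := m ⊗ₘ κ.comap Prod.fst measurable_fst with hPdef
  have hP : P.map Prod.fst = m := Measure.fst_compProd m _
  have H : ∀ L (f : Couplings d × (edgesIn W → ℝ) →ᵇ ℝ),
      Tendsto (fun n => ∫ ω, f ω * replicaProb L (G n ω) ∂m) atTop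
        (𝓝 (∫ x, f x.1 * replicaProb L x.2 ∂P)) := by
    intro L f
    rw [hPdef, integral_compProd_fst κ f (r := fun x => replicaProb L x.2)
      ((measurable_replicaProb L).comp measurable_snd)
      fun x => abs_replicaProb_le L x.2]
    refine tendsto_integral_prod_of_forall
      (r := fun n J => replicaProb L (gibbsState β (a n) (b n) J))
      (fun n => (measurable_replicaProb L).comp (measurable_gibbsState β _ _))
      (measurable_integral_replicaProb κ L) (fun n J => abs_replicaProb_le L _) (fun J => ?_)
      (hlim L) f
    have := integral_replicaProb_mem_Icc (κ J) L
    rw [abs_of_nonneg this.1]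
    exact this.2
  have hT := tendsto_integral_tilt hG hP H β W (continuous_couplingDiff W) L f
  set f₁ : Couplings d × (edgesIn W → ℝ) →ᵇ ℝ :=
    f.compContinuous ⟨_, continuous_swapCouplings W⟩ with hf₁
  have hT' := H L f₁
  rw [hPdef, integral_compProd_fst κ f hrt fun x => abs_replicaProb_le L _] at hT
  rw [hPdef, integral_compProd_fst κ f₁ (r := fun x => replicaProb L x.2)
    ((measurable_replicaProb L).comp measurable_snd)
    fun x => abs_replicaProb_le L x.2] at hT'
  -- The exchange is an involution preserving m, so it can be moved from the metastate to the test
  -- function.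
  have e1 : ∫ ω, f₁ ω * ∫ Γ, replicaProb L Γ ∂κ ω.1 ∂m =
      ∫ ω, f ω * ∫ Γ, replicaProb L Γ ∂κ (swapCouplings W ω).1 ∂m := by
    have hmeas : Measurable fun ω : Couplings d × (edgesIn W → ℝ) =>
        f₁ ω * ∫ Γ, replicaProb L Γ ∂κ ω.1 :=
      f₁.continuous.measurable.mul (hU.comp measurable_fst)
    conv_lhs => rw [hm, ← hS.map_eq]
    rw [integral_map hS.measurable.aemeasurable hmeas.aestronglyMeasurable]
    refine integral_congr_ae (ae_of_all _ fun ω => ?_)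
    have : f₁ (swapCouplings W ω) = f ω := congrArg f (swapCouplings_swapCouplings W ω)
    simp only [this]
  have e2 : ∀ᶠ n in atTop, ∫ ω, f₁ ω * replicaProb L (G n ω) ∂m =
      ∫ ω, f ω * replicaProb L (tilt β W (couplingDiff W ω) (G n ω)) ∂m := by
    have hW : ∀ᶠ n in atTop, ∀ x ∈ W, x ∈ Finset.Icc (a n) (b n) :=
      (Filter.eventually_all_finset W).2 fun x _ => hab x
    filter_upwards [hW] with n hn
    have hmeas : Measurable fun ω : Couplings d × (edgesIn W → ℝ) =>
        f₁ ω * replicaProb L (G n ω) :=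
      f₁.continuous.measurable.mul ((measurable_replicaProb L).comp (hG n))
    conv_lhs => rw [hm, ← hS.map_eq]
    rw [integral_map hS.measurable.aemeasurable hmeas.aestronglyMeasurable]
    refine integral_congr_ae (ae_of_all _ fun ω => ?_)
    have : f₁ (swapCouplings W ω) = f ω := congrArg f (swapCouplings_swapCouplings W ω)
    simp only [this]
    congr 1
    exact replicaProb_congr (fun A hA => gibbsState_replaceCouplings β hn ω.1 ω.2 hA) L
  rw [← e1]
  exact tendsto_nhds_unique (hT'.congr' e2) hT

/-- Replacing the couplings in a window by an independent copy amounts to tilting the states. -/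
lemma IsMetastate.ae_bind_swap {β : ℝ} {ρ : Measure ℝ} [IsProbabilityMeasure ρ]
    {κ : Kernel (Couplings d) (State d)} [IsMarkovKernel κ] (hκ : IsMetastate β ρ κ)
    (W : Finset (Site d)) :
    ∀ᵐ ω ∂(couplingLaw d ρ).prod (Measure.pi fun _ : edgesIn W => ρ),
      (κ (swapCouplings W ω).1).bind (replicaKernel d) =
        ((κ ω.1).map (tilt β W (couplingDiff W ω))).bind (replicaKernel d) := by
  have hall : ∀ᵐ ω ∂(couplingLaw d ρ).prod (Measure.pi fun _ : edgesIn W => ρ),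
      ∀ L : List (LocalPattern d),
      ∫ Γ, replicaProb (L.map LocalPattern.extend) Γ ∂κ (swapCouplings W ω).1 =
        ∫ Γ, replicaProb (L.map LocalPattern.extend) (tilt β W (couplingDiff W ω) Γ) ∂κ ω.1 :=
    ae_all_iff.2 fun L => hκ.ae_integral_replicaProb_swap W _
  filter_upwards [hall] with ω hω
  have hm := measurable_tilt β W (couplingDiff W ω)
  have := Measure.isProbabilityMeasure_map (μ := κ ω.1) hm.aemeasurable
  refine bind_replicaKernel_ext fun L => ?_
  rw [hω, integral_map hm.aemeasurable (measurable_replicaProb _).aestronglyMeasurable]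

end EdwardsAnderson

namespace EdwardsAnderson

variable {d : ℕ}

/-! ### Tilted states and finitely many replicas -/

lemma pi_tilted {α : Type*} [MeasurableSpace α] (μ : Measure α) [IsProbabilityMeasure μ]
    {f : α → ℝ} (hf : Integrable (fun x => Real.exp (f x)) μ) (s : ℕ) :
    (Measure.pi fun _ : Fin s => μ.tilted f) =
      (Measure.pi fun _ : Fin s => μ).tilted fun x => ∑ i, f (x i) := by
  have hp := isProbabilityMeasure_tilted hf
  refine Measure.pi_eq fun A hA => ?_
  have hpos : 0 < ∫ x, Real.exp (f x) ∂μ := integral_exp_pos hf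
  rw [tilted_apply_eq_ofReal_integral' _ (MeasurableSet.univ_pi hA)]
  simp_rw [tilted_apply_eq_ofReal_integral' _ (hA _)]
  rw [← ENNReal.ofReal_prod_of_nonneg fun i _ => integral_nonneg fun x =>
    div_nonneg (Real.exp_pos _).le hpos.le]
  congr 1
  simp_rw [← integral_indicator (hA _)]
  rw [← integral_indicator (MeasurableSet.univ_pi hA), ← integral_fintype_prod_eq_prod]
  refine integral_congr_ae (ae_of_all _ fun x => ?_)
  have hZ : ∫ x : Fin s → α, Real.exp (∑ i, f (x i)) ∂(Measure.pi fun _ => μ) =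
      ∏ _i : Fin s, ∫ x, Real.exp (f x) ∂μ := by
    simp_rw [Real.exp_sum]
    exact integral_fintype_prod_eq_prod fun _ x => Real.exp (f x)
  simp only [hZ]
  by_cases hx : x ∈ Set.pi Set.univ A
  · rw [Set.indicator_of_mem hx, Real.exp_sum, ← Finset.prod_div_distrib]
    exact Finset.prod_congr rfl fun i _ => by
      rw [Set.indicator_of_mem (hx i (Set.mem_univ i))]
  · rw [Set.indicator_of_notMem hx]
    simp only [Set.mem_pi, Set.mem_univ, true_implies, not_forall] at hx
    obtain ⟨i, hi⟩ := hx
    exact (Finset.prod_eq_zero (Finset.mem_univ i) (Set.indicator_of_notMem hi _)).symm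

lemma integral_pi_tilt (β : ℝ) (W : Finset (Site d)) (K : edgesIn W → ℝ) (Γ : State d) (s : ℕ)
    (G : (Fin s → Config d) → ℝ) :
    ∫ σ, G σ ∂(Measure.pi fun _ : Fin s => (tilt β W K Γ : Measure (Config d))) =
      (∫ σ, Real.exp (β * ∑ i, perturbation W K (σ i)) * G σ
        ∂(Measure.pi fun _ : Fin s => (Γ : Measure (Config d)))) /
      (∫ σ, Real.exp (β * perturbation W K σ) ∂(Γ : Measure (Config d))) ^ s := by
  change ∫ σ, G σ ∂(Measure.pi fun _ : Fin s => (Γ : Measure (Config d)).tilted _) = _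
  rw [pi_tilted _ (integrable_exp_perturbation β W K Γ), integral_tilted]
  have hZ : ∫ σ : Fin s → Config d, Real.exp (∑ i, β * perturbation W K (σ i))
      ∂(Measure.pi fun _ => (Γ : Measure (Config d))) =
      (∫ σ, Real.exp (β * perturbation W K σ) ∂(Γ : Measure (Config d))) ^ s := by
    simp_rw [Real.exp_sum]
    rw [integral_fintype_prod_eq_pow fun σ : Config d => Real.exp (β * perturbation W K σ),
      Fintype.card_fin]
  rw [hZ, ← integral_div]
  refine integral_congr_ae (ae_of_all _ fun σ => ?_)
  simp only [smul_eq_mul, Finset.mul_sum]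
  ring

/-- Normalized weights are at most one for every K, which provides the domination for continuity in
K. -/
lemma integral_pi_tilt_eq_weight (β : ℝ) (W : Finset (Site d)) (K : edgesIn W → ℝ) (Γ : State d)
    (s : ℕ) (G : (Fin s → Config d) → ℝ) :
    ∫ σ, G σ ∂(Measure.pi fun _ : Fin s => (tilt β W K Γ : Measure (Config d))) =
      (∫ σ, (∏ i, weight β W K (σ i)) * G σ
        ∂(Measure.pi fun _ : Fin s => (Γ : Measure (Config d)))) /
      (∫ σ, weight β W K σ ∂(Γ : Measure (Config d))) ^ s := by
  rw [integral_pi_tilt]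
  have hc := Real.exp_pos (|β| * ∑ e, |K e|)
  simp only [weight, Real.exp_sub, Finset.prod_div_distrib, Finset.prod_const, Finset.card_univ,
    Fintype.card_fin, integral_div, div_pow, ← Real.exp_sum, ← Finset.mul_sum, div_mul_eq_mul_div]
  rw [div_div_div_cancel_right₀ (pow_pos hc s).ne']

lemma continuous_integral_pi_tilt (β : ℝ) (W : Finset (Site d)) (Γ : State d) (s : ℕ)
    {G : (Fin s → Config d) → ℝ} (hG : Measurable G) (hG1 : ∀ σ, |G σ| ≤ 1) :
    Continuous fun K : edgesIn W → ℝ =>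
      ∫ σ, G σ ∂(Measure.pi fun _ : Fin s => (tilt β W K Γ : Measure (Config d))) := by
  simp only [integral_pi_tilt_eq_weight]
  have hw : ∀ K, Measurable fun σ : Fin s → Config d => ∏ i, weight β W K (σ i) := fun K =>
    Finset.measurable_prod _ fun i _ => (measurable_weight β W K).comp (measurable_pi_apply i)
  refine Continuous.div ?_ ?_ fun K => ?_
  · refine continuous_of_dominated (bound := fun _ => 1)
      (fun K => ((hw K).mul hG).aestronglyMeasurable) (fun K => ae_of_all _ fun σ => ?_)
      (integrable_const _) (ae_of_all _ fun σ => ?_)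
    · rw [Real.norm_eq_abs, abs_mul, Finset.abs_prod]
      exact mul_le_one₀ (Finset.prod_le_one (fun i _ => abs_nonneg _) fun i _ =>
        abs_weight_le_one β W K _) (abs_nonneg _) (hG1 σ)
    · exact (continuous_finsetProd _ fun i _ => continuous_weight β W (σ i)).mul continuous_const
  · refine Continuous.pow ?_ s
    exact continuous_of_dominated (bound := fun _ => 1)
      (fun K => (measurable_weight β W K).aestronglyMeasurable)
      (fun K => ae_of_all _ fun σ => abs_weight_le_one β W K σ) (integrable_const _)
      (ae_of_all _ fun σ => continuous_weight β W σ)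
  · exact (pow_pos (integral_exp_pos (integrable_weight β W K Γ)) s).ne'

instance : IsMarkovKernel (replicaKernel d) :=
  ⟨fun Γ => inferInstanceAs
    (IsProbabilityMeasure (Measure.infinitePi fun _ : ℕ => (Γ : Measure (Config d))))⟩

lemma integral_pi_eq_integral_replicaKernel (Γ : State d) (s : ℕ) {G : (Fin s → Config d) → ℝ}
    (hG : Measurable G) :
    ∫ σ, G σ ∂(Measure.pi fun _ : Fin s => (Γ : Measure (Config d))) =
      ∫ σ, G (fun i => σ i) ∂replicaKernel d Γ := by
  have h := Measure.map_infinitePi_infinitePi_of_inj (P := fun _ : ℕ => (Γ : Measure (Config d)))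
    (f := fun i : Fin s => (i : ℕ)) Fin.val_injective
  rw [Measure.infinitePi_eq_pi (μ := fun _ : Fin s => (Γ : Measure (Config d)))] at h
  have hm : Measurable fun (σ : ℕ → Config d) (i : Fin s) => σ i :=
    measurable_pi_lambda _ fun i => measurable_pi_apply _
  rw [← h, integral_map hm.aemeasurable hG.aestronglyMeasurable]
  rfl

lemma integral_bind_replicaKernel (K : Measure (State d)) [IsProbabilityMeasure K]
    {g : (ℕ → Config d) → ℝ} (hg : Measurable g) {C : ℝ} (hC : ∀ σ, |g σ| ≤ C) :
    ∫ σ, g σ ∂K.bind (replicaKernel d) = ∫ Γ, ∫ σ, g σ ∂replicaKernel d Γ ∂K := by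
  rw [← Measure.snd_compProd, Measure.snd,
    integral_map measurable_snd.aemeasurable hg.aestronglyMeasurable, Measure.integral_compProd]
  have hm : Measurable fun x : State d × (ℕ → Config d) => g x.2 := hg.comp measurable_snd
  exact Integrable.of_bound hm.aestronglyMeasurable C (ae_of_all _ fun x => hC _)

lemma integral_bind_replicaKernel_fin (K : Measure (State d)) [IsProbabilityMeasure K] (s : ℕ)
    {G : (Fin s → Config d) → ℝ} (hG : Measurable G) {C : ℝ} (hC : ∀ σ, |G σ| ≤ C) :
    ∫ σ : ℕ → Config d, G (fun i => σ i) ∂K.bind (replicaKernel d) =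
      ∫ Γ, ∫ σ, G σ ∂(Measure.pi fun _ : Fin s => (Γ : Measure (Config d))) ∂K := by
  have hm : Measurable fun σ : ℕ → Config d => G (fun i => σ i) :=
    hG.comp (measurable_pi_lambda _ fun i => measurable_pi_apply _)
  rw [integral_bind_replicaKernel K hm fun σ => hC _]
  simp only [integral_pi_eq_integral_replicaKernel _ s hG]

lemma measurable_integral_pi (s : ℕ) {G : (Fin s → Config d) → ℝ} (hG : Measurable G) :
    Measurable fun Γ : State d =>
      ∫ σ, G σ ∂(Measure.pi fun _ : Fin s => (Γ : Measure (Config d))) := by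
  have hm : Measurable fun σ : ℕ → Config d => G (fun i => σ i) :=
    hG.comp (measurable_pi_lambda _ fun i => measurable_pi_apply _)
  simp only [integral_pi_eq_integral_replicaKernel _ s hG]
  exact (hm.stronglyMeasurable.integral_kernel (κ := replicaKernel d)).measurable

lemma integral_bind_replicaKernel_tilt (K : Measure (State d)) [IsProbabilityMeasure K] (β : ℝ)
    (W : Finset (Site d)) (k : edgesIn W → ℝ) (s : ℕ)
    {G : (Fin s → Config d) → ℝ} (hG : Measurable G) {C : ℝ} (hC : ∀ σ, |G σ| ≤ C) :
    ∫ σ : ℕ → Config d, G (fun i => σ i) ∂(K.map (tilt β W k)).bind (replicaKernel d) =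
      ∫ Γ, ∫ σ, G σ ∂(Measure.pi fun _ : Fin s => (tilt β W k Γ : Measure (Config d))) ∂K := by
  have := Measure.isProbabilityMeasure_map (μ := K) (measurable_tilt β W k).aemeasurable
  rw [integral_bind_replicaKernel_fin _ s hG hC,
    integral_map (measurable_tilt β W k).aemeasurable
      (measurable_integral_pi s hG).aestronglyMeasurable]

lemma continuous_integral_bind_replicaKernel_tilt (K : Measure (State d)) [IsProbabilityMeasure K]
    (β : ℝ) (W : Finset (Site d)) (s : ℕ) {G : (Fin s → Config d) → ℝ} (hG : Measurable G)
    (hG1 : ∀ σ, |G σ| ≤ 1) :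
    Continuous fun k : edgesIn W → ℝ =>
      ∫ σ : ℕ → Config d, G (fun i => σ i) ∂(K.map (tilt β W k)).bind (replicaKernel d) := by
  simp only [fun k => integral_bind_replicaKernel_tilt K β W k s hG hG1]
  refine continuous_of_dominated (bound := fun _ => 1) (fun k => ?_)
    (fun k => ae_of_all _ fun Γ => ?_) (integrable_const _)
    (ae_of_all _ fun Γ => continuous_integral_pi_tilt β W Γ s hG hG1)
  · exact ((measurable_integral_pi s hG).comp (measurable_tilt β W k)).aestronglyMeasurable
  · exact (norm_integral_le_of_norm_le_const (C := 1) (ae_of_all _ hG1)).trans_eq (by simp)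

end EdwardsAnderson

namespace EdwardsAnderson

variable {d : ℕ}

/-! ### Random overlap structures -/

lemma measurable_overlaps {ι : Type*} [Countable ι] :
    Measurable fun (σ : ι → Config d) (i j : ι) => overlap (σ i) (σ j) := by
  refine measurable_pi_lambda _ fun i => measurable_pi_lambda _ fun j => ?_
  have hij : Measurable fun σ : ι → Config d => (σ i, σ j) :=
    (measurable_pi_apply i).prodMk (measurable_pi_apply j)
  have h := measurable_overlap.comp hij
  exact h

instance (K : Measure (State d)) [IsProbabilityMeasure K] :
    IsProbabilityMeasure (overlapStructureLaw K) :=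
  Measure.isProbabilityMeasure_map measurable_overlaps.aemeasurable

lemma measurable_overlapStructureLaw (κ : Kernel (Couplings d) (State d)) :
    Measurable fun J => overlapStructureLaw (κ J) :=
  (Measure.measurable_map _ measurable_overlaps).comp
    ((Measure.measurable_bind' (replicaKernel d).measurable).comp κ.measurable)

/-- The law of the random overlap structure is almost surely deterministic. -/
lemma IsMetastate.exists_ae_overlapStructureLaw_eq {β : ℝ} {ρ : Measure ℝ} [IsProbabilityMeasure ρ]
    {κ : Kernel (Couplings d) (State d)} [IsMarkovKernel κ] (hκ : IsMetastate β ρ κ) :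
    ∃ L : Measure (ℕ → ℕ → ℝ), IsProbabilityMeasure L ∧
      ∀ᵐ J ∂couplingLaw d ρ, overlapStructureLaw (κ J) = L := by
  -- A countable generating algebra encodes a law by countably many numbers, so that ergodicity
  -- applies to a law-valued function.
  set 𝒞 := generateSetAlgebra (MeasurableSpace.countableGeneratingSet (ℕ → ℕ → ℝ)) with h𝒞
  have hcount : 𝒞.Countable :=
    countable_generateSetAlgebra MeasurableSpace.countable_countableGeneratingSet
  have hgen : (inferInstance : MeasurableSpace (ℕ → ℕ → ℝ)) = MeasurableSpace.generateFrom 𝒞 := by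
    rw [h𝒞, generateFrom_generateSetAlgebra_eq]
    exact MeasurableSpace.generateFrom_countableGeneratingSet.symm
  have hpi : IsPiSystem 𝒞 := fun A hA B hB _ =>
    isSetAlgebra_generateSetAlgebra.inter_mem hA hB
  have hmeas : ∀ A ∈ 𝒞, MeasurableSet A := fun A hA => by
    have h : MeasurableSet[MeasurableSpace.generateFrom 𝒞] A :=
      MeasurableSpace.measurableSet_generateFrom hA
    rwa [← hgen] at h
  have := hcount.to_subtype
  set g : Couplings d → 𝒞 → ENNReal := fun J A => overlapStructureLaw (κ J) A with hg
  have hgm : Measurable g := measurable_pi_lambda _ fun A =>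
    (Measure.measurable_coe (hmeas A A.2)).comp (measurable_overlapStructureLaw κ)
  obtain ⟨c, hc⟩ := exists_ae_eq_const_of_shift_invariant ρ hgm fun v => by
    filter_upwards [hκ.ae_bind_shift v] with J hJ
    have : overlapStructureLaw (κ (shiftCouplings v J)) = overlapStructureLaw (κ J) := by
      have hm : Measurable fun (σ : ℕ → Config d) i => shift v (σ i) :=
        measurable_pi_lambda _ fun i => (measurable_shift v).comp (measurable_pi_apply i)
      rw [overlapStructureLaw, hJ, Measure.map_map measurable_overlaps hm, overlapStructureLaw]
      congr 1
      ext σ i j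
      exact overlap_shift v _ _
    simp only [hg, this]
  obtain ⟨J₀, hJ₀⟩ := hc.exists
  refine ⟨overlapStructureLaw (κ J₀), inferInstance, ?_⟩
  filter_upwards [hc] with J hJ
  refine ext_of_generate_finite 𝒞 hgen hpi (fun A hA => ?_) (by simp)
  exact congrFun (hJ.trans hJ₀.symm) ⟨A, hA⟩

/-- The events of overlap structures which depend on the first `s` replicas only. -/
def finiteOverlapEvents : Set (Set (ℕ → ℕ → ℝ)) :=
  {A | ∃ (s : ℕ) (B : Set (Fin s → Fin s → ℝ)), MeasurableSet B ∧
    A = (fun (q : ℕ → ℕ → ℝ) (i j : Fin s) => q i j) ⁻¹' B}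

lemma measurable_restrict_overlaps (s : ℕ) :
    Measurable fun (q : ℕ → ℕ → ℝ) (i j : Fin s) => q i j :=
  measurable_pi_lambda _ fun i => measurable_pi_lambda _ fun j =>
    (measurable_pi_apply (j : ℕ)).comp (measurable_pi_apply (i : ℕ))

lemma mem_finiteOverlapEvents_of_le {s s' : ℕ} (h : s ≤ s') {B : Set (Fin s → Fin s → ℝ)}
    (hB : MeasurableSet B) : ∃ B' : Set (Fin s' → Fin s' → ℝ), MeasurableSet B' ∧
      (fun (q : ℕ → ℕ → ℝ) (i j : Fin s) => q i j) ⁻¹' B =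
        (fun (q : ℕ → ℕ → ℝ) (i j : Fin s') => q i j) ⁻¹' B' := by
  have hm : Measurable fun (q : Fin s' → Fin s' → ℝ) (i j : Fin s) =>
      q (Fin.castLE h i) (Fin.castLE h j) :=
    measurable_pi_lambda _ fun i => measurable_pi_lambda _ fun j =>
      (measurable_pi_apply (Fin.castLE h j)).comp (measurable_pi_apply (Fin.castLE h i))
  exact ⟨_, hm hB, rfl⟩

lemma isPiSystem_finiteOverlapEvents : IsPiSystem finiteOverlapEvents := by
  rintro _ ⟨s, B, hB, rfl⟩ _ ⟨s', B', hB', rfl⟩ _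
  obtain ⟨D, hD, h1⟩ := mem_finiteOverlapEvents_of_le (le_max_left s s') hB
  obtain ⟨D', hD', h2⟩ := mem_finiteOverlapEvents_of_le (le_max_right s s') hB'
  exact ⟨max s s', D ∩ D', hD.inter hD', by rw [h1, h2, Set.preimage_inter]⟩

lemma generateFrom_finiteOverlapEvents :
    (inferInstance : MeasurableSpace (ℕ → ℕ → ℝ)) =
      MeasurableSpace.generateFrom finiteOverlapEvents := by
  refine le_antisymm ?_ (MeasurableSpace.generateFrom_le ?_)
  · refine iSup_le fun i => ?_
    rw [MeasurableSpace.comap_le_iff_le_map]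
    refine iSup_le fun j => ?_
    rw [MeasurableSpace.comap_le_iff_le_map]
    intro B hB
    refine MeasurableSpace.measurableSet_generateFrom ⟨max i j + 1,
      {q | q ⟨i, by omega⟩ ⟨j, by omega⟩ ∈ B}, ?_, rfl⟩
    exact ((measurable_pi_apply _).comp (measurable_pi_apply _)) hB
  · rintro _ ⟨s, B, hB, rfl⟩
    exact measurable_restrict_overlaps s hB

lemma overlapStructureLaw_finiteOverlapEvent (K : Measure (State d)) [IsProbabilityMeasure K]
    {s : ℕ} {B : Set (Fin s → Fin s → ℝ)} (hB : MeasurableSet B) :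
    (overlapStructureLaw K).real ((fun (q : ℕ → ℕ → ℝ) (i j : Fin s) => q i j) ⁻¹' B) =
      ∫ σ : ℕ → Config d, ((fun (σ : Fin s → Config d) i j => overlap (σ i) (σ j)) ⁻¹' B).indicator
        (1 : (Fin s → Config d) → ℝ) (fun i => σ i) ∂K.bind (replicaKernel d) := by
  have hA := measurable_restrict_overlaps s hB
  rw [overlapStructureLaw, map_measureReal_apply measurable_overlaps hA,
    ← integral_indicator_one (measurable_overlaps hA)]
  rfl

/-- The perturbations which do not change the law of the overlap structure form a closed set. -/
lemma isClosed_overlapStructureLaw_map_tilt_eq (K : Measure (State d)) [IsProbabilityMeasure K]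
    (β : ℝ) (W : Finset (Site d)) (L : Measure (ℕ → ℕ → ℝ)) [IsProbabilityMeasure L] :
    IsClosed {k : edgesIn W → ℝ | overlapStructureLaw (K.map (tilt β W k)) = L} := by
  have hprob : ∀ k, IsProbabilityMeasure (K.map (tilt β W k)) := fun k =>
    Measure.isProbabilityMeasure_map (measurable_tilt β W k).aemeasurable
  -- Events of finitely many replicas determine the law, and their probabilities are continuous in
  -- k: the tilt then enters through a finite product of weights.
  have : {k : edgesIn W → ℝ | overlapStructureLaw (K.map (tilt β W k)) = L} =
      ⋂ A ∈ finiteOverlapEvents, {k | (overlapStructureLaw (K.map (tilt β W k))).real A =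
        L.real A} := by
    ext k
    simp only [Set.mem_ofPred_eq, Set.mem_iInter]
    refine ⟨fun h A _ => by rw [h], fun h => ?_⟩
    refine ext_of_generate_finite _ generateFrom_finiteOverlapEvents
      isPiSystem_finiteOverlapEvents (fun A hA => ?_) (by simp)
    exact (measureReal_eq_measureReal_iff).1 (h A hA)
  rw [this]
  refine isClosed_biInter fun A hA => ?_
  obtain ⟨s, B, hB, rfl⟩ := hA
  simp only [overlapStructureLaw_finiteOverlapEvent _ hB]
  refine isClosed_eq ?_ continuous_const
  refine continuous_integral_bind_replicaKernel_tilt K β W s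
    (measurable_one.indicator (measurable_overlaps hB)) fun σ => ?_
  refine (abs_le.2 ⟨?_, ?_⟩ : |_| ≤ (1 : ℝ))
  · exact (by norm_num : (-1 : ℝ) ≤ 0).trans (Set.indicator_nonneg (fun _ _ => zero_le_one) σ)
  · exact Set.indicator_le_self' (fun _ _ => zero_le_one) σ

/-- Arbitrary local perturbations do not change the law of the overlap structure. -/
lemma IsMetastate.ae_overlapStructureLaw_map_tilt {β : ℝ} {ρ : Measure ℝ} [IsProbabilityMeasure ρ]
    (hsupp : ρ.support = Set.univ) {κ : Kernel (Couplings d) (State d)} [IsMarkovKernel κ]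
    (hκ : IsMetastate β ρ κ) :
    ∀ᵐ J ∂couplingLaw d ρ, ∀ (W : Finset (Site d)) (k : edgesIn W → ℝ),
      overlapStructureLaw (κ J) = overlapStructureLaw ((κ J).map (tilt β W k)) := by
  have hpos : ρ.IsOpenPosMeasure := ⟨fun U hU ⟨x, hx⟩ =>
    ((Measure.mem_support_iff_forall x).1 (hsupp ▸ Set.mem_univ x) U (hU.mem_nhds hx)).ne'⟩
  obtain ⟨L, hL, hae⟩ := hκ.exists_ae_overlapStructureLaw_eq
  have hW : ∀ W : Finset (Site d), ∀ᵐ J ∂couplingLaw d ρ, ∀ k : edgesIn W → ℝ,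
      overlapStructureLaw ((κ J).map (tilt β W k)) = L := by
    intro W
    -- The couplings after the exchange again have the law of J, so the constant law is also found
    -- there.
    have h1 : ∀ᵐ ω ∂(couplingLaw d ρ).prod (Measure.pi fun _ : edgesIn W => ρ),
        overlapStructureLaw (κ (swapCouplings W ω).1) = L :=
      (Measure.quasiMeasurePreserving_fst.comp
        (measurePreserving_swapCouplings ρ W).quasiMeasurePreserving).ae hae
    have h2 : ∀ᵐ ω ∂(couplingLaw d ρ).prod (Measure.pi fun _ : edgesIn W => ρ),
        overlapStructureLaw ((κ ω.1).map (tilt β W (couplingDiff W ω))) = L := by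
      filter_upwards [h1, hκ.ae_bind_swap W] with ω h1 h2
      rw [← h1, overlapStructureLaw, ← h2, overlapStructureLaw]
    filter_upwards [Measure.ae_ae_of_ae_prod h2] with J hJ k
    have hcl := (isClosed_overlapStructureLaw_map_tilt_eq (κ J) β W L).preimage
      (f := fun J' : edgesIn W → ℝ => fun e => J' e - J e) (by fun_prop)
    -- A closed set of full measure is everything, since ρ, and with it the product, charges
    -- nonempty open sets. The choice J' = k + J then reaches an arbitrary k.
    have huniv := hcl.ae_eq_univ_iff_eq (μ := Measure.pi fun _ : edgesIn W => ρ) |>.1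
      (eventuallyEq_univ.2 hJ)
    have hk : (fun e : edgesIn W => k e + J e) ∈ (Set.univ : Set (edgesIn W → ℝ)) := trivial
    rw [← huniv] at hk
    simpa using hk
  filter_upwards [hae, ae_all_iff.2 hW] with J h1 h2 W k
  rw [h1, h2]

end EdwardsAnderson

namespace EdwardsAnderson

variable {d : ℕ}

/-- The bounded continuous functions of the overlaps of finitely many replicas are determined by the
law of the overlap structure. -/
lemma integral_replicaOverlaps_eq {K K' : Measure (State d)} [IsProbabilityMeasure K]
    [IsProbabilityMeasure K'] (h : overlapStructureLaw K = overlapStructureLaw K') {s : ℕ}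
    {F : ({p : Fin s × Fin s // p.1 < p.2} → ℝ) → ℝ} (hF : Continuous F) :
    ∫ σ : ℕ → Config d, F (replicaOverlaps fun i : Fin s => σ i) ∂K.bind (replicaKernel d) =
      ∫ σ : ℕ → Config d, F (replicaOverlaps fun i : Fin s => σ i) ∂K'.bind (replicaKernel d) := by
  have hm : Measurable fun q : ℕ → ℕ → ℝ =>
      F fun p : {p : Fin s × Fin s // p.1 < p.2} => q p.1.1 p.1.2 :=
    hF.measurable.comp (measurable_pi_lambda _ fun p =>
      (measurable_pi_apply _).comp (measurable_pi_apply _))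
  have key : ∀ K : Measure (State d),
      ∫ σ : ℕ → Config d, F (replicaOverlaps fun i : Fin s => σ i) ∂K.bind (replicaKernel d) =
      ∫ q, F (fun p : {p : Fin s × Fin s // p.1 < p.2} => q p.1.1 p.1.2)
        ∂overlapStructureLaw K := fun K => by
    rw [overlapStructureLaw, integral_map measurable_overlaps.aemeasurable hm.aestronglyMeasurable]
    rfl
  rw [key, key, h]

lemma measurable_replicaOverlaps (s : ℕ) :
    Measurable fun σ : Fin s → Config d => replicaOverlaps σ := by
  have h : Measurable fun q : Fin s → Fin s → ℝ =>
      fun p : {p : Fin s × Fin s // p.1 < p.2} => q p.1.1 p.1.2 :=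
    measurable_pi_lambda _ fun p => (measurable_pi_apply _).comp (measurable_pi_apply _)
  have h' := h.comp (measurable_overlaps (d := d))
  exact h'

/-- Overlaps stay in a compact interval, so continuity of F already bounds it where it is evaluated.
-/
lemma exists_abs_comp_replicaOverlaps_le {s : ℕ} {F : ({p : Fin s × Fin s // p.1 < p.2} → ℝ) → ℝ}
    (hF : Continuous F) : ∃ C, ∀ σ : Fin s → Config d, |F (replicaOverlaps σ)| ≤ C := by
  obtain ⟨C, hC⟩ := exists_abs_overlap_le d
  obtain ⟨D, hD⟩ := (isCompact_univ_pi fun _ : {p : Fin s × Fin s // p.1 < p.2} =>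
    isCompact_Icc (a := -C) (b := C)).exists_bound_of_continuousOn hF.continuousOn
  exact ⟨D, fun σ => hD _ fun p _ => abs_le.1 (hC _ _)⟩

/-- Invariance of the expectations of continuous functions of the overlaps. -/
lemma integral_tilted_replicaOverlaps {K : Measure (State d)} [IsProbabilityMeasure K] {β : ℝ}
    {W : Finset (Site d)} {k : edgesIn W → ℝ}
    (h : overlapStructureLaw K = overlapStructureLaw (K.map (tilt β W k))) {s : ℕ}
    {F : ({p : Fin s × Fin s // p.1 < p.2} → ℝ) → ℝ} (hF : Continuous F) :
    ∫ Γ : State d, (∫ σ, Real.exp (β * ∑ i, perturbation W k (σ i)) * F (replicaOverlaps σ)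
        ∂(Measure.pi fun _ : Fin s => (Γ : Measure (Config d)))) /
        (∫ σ, Real.exp (β * perturbation W k σ) ∂(Γ : Measure (Config d))) ^ s ∂K =
      ∫ Γ : State d, ∫ σ, F (replicaOverlaps σ)
        ∂(Measure.pi fun _ : Fin s => (Γ : Measure (Config d))) ∂K := by
  have := Measure.isProbabilityMeasure_map (μ := K) (measurable_tilt β W k).aemeasurable
  obtain ⟨C, hC⟩ := exists_abs_comp_replicaOverlaps_le (d := d) hF
  have hm : Measurable fun σ : Fin s → Config d => F (replicaOverlaps σ) :=
    hF.measurable.comp (measurable_replicaOverlaps s)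
  simp only [← integral_pi_tilt]
  rw [← integral_bind_replicaKernel_tilt K β W k s hm hC,
    ← integral_bind_replicaKernel_fin K s hm hC]
  exact (integral_replicaOverlaps_eq h hF).symm

/-! ### Existence of the overlaps -/

/-- Covariance becomes invariance after averaging over J, because the coupling law is translation
invariant. -/
lemma measurePreserving_shift_replicas {β : ℝ} {ρ : Measure ℝ} [IsProbabilityMeasure ρ]
    {κ : Kernel (Couplings d) (State d)} [IsMarkovKernel κ] (hκ : IsMetastate β ρ κ) (v : Site d) :
    MeasurePreserving (fun (σ : ℕ → Config d) i => shift v (σ i))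
      ((couplingLaw d ρ).bind fun J => (κ J).bind (replicaKernel d))
      ((couplingLaw d ρ).bind fun J => (κ J).bind (replicaKernel d)) := by
  have hm : Measurable fun (σ : ℕ → Config d) i => shift v (σ i) :=
    measurable_pi_lambda _ fun i => (measurable_shift v).comp (measurable_pi_apply i)
  have hb : Measurable fun J => (κ J).bind (replicaKernel d) :=
    (Measure.measurable_bind' (replicaKernel d).measurable).comp κ.measurable
  refine ⟨hm, Measure.ext fun A hA => ?_⟩
  have hmA : Measurable fun J => (κ J).bind (replicaKernel d) A :=
    (Measure.measurable_coe hA).comp hb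
  rw [Measure.map_apply hm hA, Measure.bind_apply (hm hA) hb.aemeasurable,
    Measure.bind_apply hA hb.aemeasurable,
    ← (measurePreserving_shiftCouplings ρ v).lintegral_comp hmA]
  refine lintegral_congr_ae ?_
  filter_upwards [hκ.ae_bind_shift v] with J hJ
  rw [hJ, Measure.map_apply hm hA]

/-- The overlap of two replicas exists almost surely. -/
lemma IsMetastate.ae_overlapExists {β : ℝ} {ρ : Measure ℝ} [IsProbabilityMeasure ρ]
    {κ : Kernel (Couplings d) (State d)} [IsMarkovKernel κ] (hκ : IsMetastate β ρ κ) :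
    ∀ᵐ J ∂couplingLaw d ρ, ∀ᵐ Γ : State d ∂κ J,
      ∀ᵐ p ∂(Γ : Measure (Config d)).prod (Γ : Measure (Config d)), OverlapExists p.1 p.2 := by
  have hb : Measurable fun J => (κ J).bind (replicaKernel d) :=
    (Measure.measurable_bind' (replicaKernel d).measurable).comp κ.measurable
  set R := (couplingLaw d ρ).bind fun J => (κ J).bind (replicaKernel d) with hR
  have : IsProbabilityMeasure R :=
    isProbabilityMeasure_bind hb.aemeasurable (ae_of_all _ fun J => inferInstance)
  have hpair : Measurable fun σ : ℕ → Config d => (σ 0, σ 1) :=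
    (measurable_pi_apply 0).prodMk (measurable_pi_apply 1)
  have := Measure.isProbabilityMeasure_map (μ := R) hpair.aemeasurable
  -- The ergodic theorem is used for the law of two replicas averaged over J; the null set is then
  -- disintegrated over J and Γ.
  have hae := EdwardsAnderson.ae_overlapExists (μ := R.map fun σ => (σ 0, σ 1)) fun v => by
    have hs : Measurable fun p : Config d × Config d => (shift v p.1, shift v p.2) :=
      ((measurable_shift v).comp measurable_fst).prodMk ((measurable_shift v).comp measurable_snd)
    refine ⟨hs, ?_⟩
    have h := measurePreserving_shift_replicas hκ v
    rw [Measure.map_map hs hpair]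
    conv_rhs => rw [hR, ← h.map_eq, Measure.map_map hpair h.measurable]
    rfl
  rw [ae_map_iff hpair.aemeasurable measurableSet_overlapExists] at hae
  filter_upwards [Measure.ae_ae_of_ae_bind hb.aemeasurable hae] with J hJ
  filter_upwards [Measure.ae_ae_of_ae_bind (replicaKernel d).aemeasurable hJ] with Γ hΓ
  have h01 := Measure.infinitePi_map_eval_prod (P := fun _ : ℕ => (Γ : Measure (Config d)))
    (zero_ne_one (α := ℕ))
  rw [← h01, ae_map_iff hpair.aemeasurable measurableSet_overlapExists]
  exact hΓ

end EdwardsAnderson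

/-! ### Local stability. -/

theorem mainTheorem2 (d : ℕ) (β : ℝ)
    (ρ : Measure ℝ) [IsProbabilityMeasure ρ] (hsymm : ρ.map (fun x => -x) = ρ)
    (hcont : NullSingletonClass ρ) (hsupp : ρ.support = Set.univ)
    (κ : Kernel (EdwardsAnderson.Couplings d) (EdwardsAnderson.State d)) [IsMarkovKernel κ]
    (hκ : EdwardsAnderson.IsMetastate β ρ κ) :
    ∀ᵐ J ∂(EdwardsAnderson.couplingLaw d ρ),
      (∀ᵐ Γ : EdwardsAnderson.State d ∂(κ J), ∀ᵐ p ∂((Γ : Measure (EdwardsAnderson.Config d)).prod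
          (Γ : Measure (EdwardsAnderson.Config d))), EdwardsAnderson.OverlapExists p.1 p.2) ∧
      ∀ W : Finset (EdwardsAnderson.Site d),
        ∀ᵐ J' ∂(Measure.pi fun _ : EdwardsAnderson.edgesIn W => ρ),
          (∀ (s : ℕ) (F : ({p : Fin s × Fin s // p.1 < p.2} → ℝ) → ℝ), Continuous F →
            ∫ Γ : EdwardsAnderson.State d,
                (∫ σ, Real.exp (β * ∑ i, EdwardsAnderson.perturbation W J' (σ i)) *
                    F (EdwardsAnderson.replicaOverlaps σ)
                  ∂(Measure.pi fun _ : Fin s => (Γ : Measure (EdwardsAnderson.Config d)))) /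
                (∫ σ, Real.exp (β * EdwardsAnderson.perturbation W J' σ)
                  ∂(Γ : Measure (EdwardsAnderson.Config d))) ^ s ∂(κ J) =
              ∫ Γ : EdwardsAnderson.State d,
                ∫ σ, F (EdwardsAnderson.replicaOverlaps σ)
                  ∂(Measure.pi fun _ : Fin s => (Γ : Measure (EdwardsAnderson.Config d))) ∂(κ J)) ∧
          EdwardsAnderson.overlapStructureLaw (κ J) =
            EdwardsAnderson.overlapStructureLaw ((κ J).map (EdwardsAnderson.tilt β W J')) := by
  filter_upwards [hκ.ae_overlapExists, hκ.ae_overlapStructureLaw_map_tilt hsupp] with J h1 h2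
  -- Once J is typical, the invariance holds for every J', without an exceptional set.
  exact ⟨h1, fun W => ae_of_all _ fun J' =>
    ⟨fun s F hF => EdwardsAnderson.integral_tilted_replicaOverlaps (h2 W J') hF, h2 W J'⟩⟩
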